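/- Let $k$ be a field and let $A=k\oplus A_1\oplus A_2\oplus\cdots$ be a connected graded $k$-algebra that is finitely generated in degree $1$ (i.e. $\dim_k A_1<\infty$ and $A$ is generated by $A_1$ as an algebra). Put $\mathfrak m=\bigoplus_{i\ge 1}A_i$ and write $(-)^{\#}$ for the graded $k$-linear dual. *The $A_\infty$-Ext-algebra.* Let $B^{\#}A$ be the graded dual of the bar construction of $A$: the DG algebra which in cohomological degree $p$ is $(\mathfrak m^{\otimes p})^{\#}$, with the product $(f\cdot g)[a_1|\cdots|a_{p+q}]=(-1)^{pq}f[a_1|\cdots|a_p]\,g[a_{p+1}|\cdots|a_{p+q}]$ and the differential $\partial f=-(-1)^{\deg f}f\circ d$, where $d[a_1|\cdots|a_m]=\sum_{i=2}^m(-1)^{i-1}[a_1|\cdots|a_{i-1}a_i|\cdots|a_m]$; functionals on the Adams degree $s$ part of $\mathfrak m^{\otimes p}$ have Adams degree $-s$. Its cohomology is the bigraded Ext-algebra $E=\operatorname{Ext}^*_A(k_A,k_A)$. An $A_\infty$-Ext-algebra of $A$ is a strictly unital $A_\infty$-structure $(m_n)$ on $E$, with $m_n$ of degree $2-n$ and preserving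 the Adams degree and with $m_1=0$, together with an (Adams graded, unital) $A_\infty$-quasi-isomorphism $E\to B^{\#}A$ that lifts the identity of the cohomology. *The relations.* Choose linear embeddings $\theta_n:A_n\hookrightarrow A_1^{\otimes n}$ which split the multiplication maps $A_1^{\otimes n}\to A_n$ and satisfy $\theta_{n+1}(A_{n+1})\subset A_1\otimes\theta_n(A_n)$, and use them to regard $A_1\otimes A_{n-1}$ as a subspace of $A_1^{\otimes n}$. Let $R=\bigoplus_{n\ge 2}R_n$ be a minimal graded space of relations of $A$, i.e. a graded subspace of the tensor algebra $T(A_1)$ that generates the kernel of $T(A_1)\to A$ as a two-sided ideal and is minimal with this property, chosen so that $R_n\subset A_1\otimes A_{n-1}\subset A_1^{\otimes n}$ for all $n\ge 2$. Let $i_n:R_n\to A_1^{\otimes n}$ be the inclusion and $i_n^{\#}$ its $k$-linear dual. Then restricting cocycles $\mathfrak m\to k$ to $A_1$ gives an isomorphism $E^1=A_1^{\#}$; for each $n\ge 2$, restricting cocycles $\mathfrak m\otimes\mathfrak m\to k$ to $R_n\subset A_1\otimes A_{n-1}\subset\mathfrak m\otimes\mathfrak m$ gives an isomorphism from the Adams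 degree $-n$ part $E^2_{-n}$ of $E^2$ to $R_n^{\#}$, so that $R_n^{\#}\subset E^2$; and there is an $A_\infty$-Ext-algebra of $A$ whose multiplications satisfy, for every $n\ge 2$, that $m_n$ restricted to $(E^1)^{\otimes n}$ is equal to the map $$i_n^{\#}:(E^1)^{\otimes n}=(A_1^{\#})^{\otimes n}\longrightarrow R_n^{\#}\subset E^2 .$$ Here $(A_1^{\#})^{\otimes n}$ is identified with $(A_1^{\otimes n})^{\#}$ by means of the product of $B^{\#}A$, that is, by the Koszul sign rule (elements of $E^1=A_1^{\#}$ have degree $1$): $(\beta_1\otimes\cdots\otimes\beta_n)(a_1\otimes\cdots\otimes a_n)=(-1)^{n(n-1)/2}\beta_1(a_1)\cdots\beta_n(a_n)$. -/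

import Mathlib

open scoped TensorProduct DirectSum

noncomputable section

/-! ## `A_∞`-algebras with an Adams grading -/

namespace AInf

/-- The list of inputs of `id^{⊗ r} ⊗ m_s ⊗ id^{⊗ t}`, written for sequences: the block
`x r, …, x (r + s - 1)` is replaced by the single entry `y`. -/
def graft {V : Type*} (x : ℕ → V) (r s : ℕ) (y : V) : ℕ → V := fun i =>
  if i < r then x i else if i = r then y else x (i + s - 1)

/-- A strictly unital `A_∞`-algebra structure, with an Adams grading, on a `k`-vector space `V`
with bigrading `𝒱 p s` (`p` the cohomological degree, `s` the Adams degree) and strict unit `e`.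
The Stasheff identities are evaluated on homogeneous elements `x 0, …, x (n - 1)` of degrees
`p 0, …, p (n - 1)`; the summand `s * ∑ p l` of the exponent is the Koszul sign that arises when
`m_s`, of degree `2 - s`, moves past `x 0, …, x (r - 1)`. The value `m 0` plays no role. -/
structure AInfinityStructure (k : Type*) [Field k] {V : Type*} [AddCommGroup V] [Module k V]
    (𝒱 : ℤ → ℤ → Submodule k V) (e : V) where
  /-- the multiplications `m_n : V^{⊗ n} → V` -/
  m : ∀ n : ℕ, MultilinearMap k (fun _ : Fin n => V) V
  /-- `m_n` has degree `2 - n` and preserves the Adams degree -/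
  m_mem : ∀ (n : ℕ) (p a : Fin n → ℤ) (x : Fin n → V), (∀ i, x i ∈ 𝒱 (p i) (a i)) →
    m n x ∈ 𝒱 ((∑ i, p i) + 2 - n) (∑ i, a i)
  /-- `∑ (-1)^{r + st} m_u (id^{⊗ r} ⊗ m_s ⊗ id^{⊗ t}) = 0`, over `r + s + t = n`, `s ≥ 1`,
  with `u = r + 1 + t` -/
  stasheff : ∀ (n : ℕ), 1 ≤ n → ∀ (p a : ℕ → ℤ) (x : ℕ → V), (∀ i, x i ∈ 𝒱 (p i) (a i)) →
    ∑ r ∈ Finset.range n, ∑ s ∈ Finset.Icc 1 (n - r),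
      Int.negOnePow ((r : ℤ) + s * (n - r - s : ℕ) + s * ∑ l ∈ Finset.range r, p l) •
        m (r + 1 + (n - r - s))
          (fun i => graft x r s (m s (fun j => x (r + j))) i) = 0
  /-- the unit has degree `(0, 0)` -/
  unit_mem : e ∈ 𝒱 0 0
  unit_mul : ∀ x, m 2 ![e, x] = x
  mul_unit : ∀ x, m 2 ![x, e] = x
  m_unit : ∀ (n : ℕ), n ≠ 2 → ∀ x : Fin n → V, (∃ i, x i = e) → m n x = 0

/-- A (strictly unital, Adams graded) morphism of `A_∞`-algebras from `E` to a DG algebra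
`(W, d, mul)` with unit `e'` and bigrading `𝒲`. The DG algebra is viewed as an `A_∞`-algebra with
`m_1 = d`, `m_2 = mul` and `m_q = 0` for `q ≥ 3`, so that on the right-hand side of the morphism
identities only the terms with `q = 1` and `q = 2` are present. As before the exponents contain the
Koszul signs for evaluation on homogeneous elements. The value `f 0` plays no role. -/
structure MorphismToDG {k : Type*} [Field k] {V : Type*} [AddCommGroup V] [Module k V]
    {𝒱 : ℤ → ℤ → Submodule k V} {e : V} (E : AInfinityStructure k 𝒱 e)
    {W : Type*} [AddCommGroup W] [Module k W] (𝒲 : ℤ → ℤ → Submodule k W)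
    (d : W →ₗ[k] W) (mul : W →ₗ[k] W →ₗ[k] W) (e' : W) where
  /-- the components `f_n : V^{⊗ n} → W` -/
  f : ∀ n : ℕ, MultilinearMap k (fun _ : Fin n => V) W
  /-- `f_n` has degree `1 - n` and preserves the Adams degree -/
  f_mem : ∀ (n : ℕ) (p a : Fin n → ℤ) (x : Fin n → V), (∀ i, x i ∈ 𝒱 (p i) (a i)) →
    f n x ∈ 𝒲 ((∑ i, p i) + 1 - n) (∑ i, a i)
  /-- `∑ (-1)^{r + st} f_u (id^{⊗ r} ⊗ m_s ⊗ id^{⊗ t})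
    = d f_n + ∑_{i + j = n} (-1)^{i - 1} mul (f_i ⊗ f_j)` -/
  morphism : ∀ (n : ℕ), 1 ≤ n → ∀ (p a : ℕ → ℤ) (x : ℕ → V), (∀ i, x i ∈ 𝒱 (p i) (a i)) →
    ∑ r ∈ Finset.range n, ∑ s ∈ Finset.Icc 1 (n - r),
      Int.negOnePow ((r : ℤ) + s * (n - r - s : ℕ) + s * ∑ l ∈ Finset.range r, p l) •
        f (r + 1 + (n - r - s))
          (fun i => graft x r s (E.m s (fun j => x (r + j))) i) =
    d (f n (fun i => x i)) +
      ∑ i ∈ Finset.Ico 1 n,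
        Int.negOnePow (((i : ℤ) - 1) + (1 - ((n : ℤ) - i)) * ∑ l ∈ Finset.range i, p l) •
          mul (f i (fun l => x l)) (f (n - i) (fun l => x (i + l)))
  f_unit : f 1 (fun _ => e) = e'
  f_unit_zero : ∀ (n : ℕ), 2 ≤ n → ∀ x : Fin n → V, (∃ i, x i = e) → f n x = 0

end AInf

/-! ## The dual bar construction of a connected graded algebra -/

section Bar

variable {k A : Type*} [Field k] [Ring A] [Algebra k A]
  (𝒜 : ℕ → Submodule k A) [GradedAlgebra 𝒜]

/-- The augmentation ideal `𝔪 = ⨁_{i ≥ 1} A_i`: the elements without component in degree `0`. -/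
def augIdeal : Submodule k A := LinearMap.ker (GradedAlgebra.proj 𝒜 0)

lemma mem_augIdeal_iff (a : A) : a ∈ augIdeal 𝒜 ↔ GradedRing.projZeroRingHom 𝒜 a = 0 := by
  rw [augIdeal, LinearMap.mem_ker, GradedAlgebra.proj_apply, GradedRing.projZeroRingHom_apply]

lemma mul_mem_augIdeal {a b : A} (ha : a ∈ augIdeal 𝒜) : a * b ∈ augIdeal 𝒜 := by
  rw [mem_augIdeal_iff] at ha ⊢
  rw [map_mul, ha, zero_mul]

lemma mem_augIdeal_of_mem {i : ℕ} (hi : i ≠ 0) {a : A} (ha : a ∈ 𝒜 i) : a ∈ augIdeal 𝒜 := by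
  rw [augIdeal, LinearMap.mem_ker, GradedAlgebra.proj_apply]
  exact DirectSum.decompose_of_mem_ne 𝒜 ha hi

/-- The multiplication `𝔪 × 𝔪 → 𝔪`. -/
def augMul : augIdeal 𝒜 →ₗ[k] augIdeal 𝒜 →ₗ[k] augIdeal 𝒜 :=
  LinearMap.mk₂ k (fun a b => ⟨(a : A) * b, mul_mem_augIdeal 𝒜 a.2⟩)
    (fun _ _ _ => Subtype.ext (by simp [add_mul])) (fun _ _ _ => Subtype.ext (by simp))
    (fun _ _ _ => Subtype.ext (by simp [mul_add])) (fun _ _ _ => Subtype.ext (by simp))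

/-- All `k`-linear functionals on `𝔪^{⊗ p}`, as multilinear forms in `p` variables. -/
abbrev BarForm (p : ℕ) : Type _ := MultilinearMap k (fun _ : Fin p => augIdeal 𝒜) k

/-- The form `f` vanishes on all tensors `a_1 ⊗ ⋯ ⊗ a_p` of Adams degree `> N`. -/
def VanishesAbove {p : ℕ} (N : ℕ) (f : BarForm 𝒜 p) : Prop :=
  ∀ (s : Fin p → ℕ) (a : Fin p → augIdeal 𝒜), (∀ i, (a i : A) ∈ 𝒜 (s i)) →
    N < ∑ i, s i → f a = 0

/-- The part `(𝔪^{⊗ p})^#` of cohomological degree `p` of the dual bar construction: the *graded*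
dual `⨁_s ((𝔪^{⊗ p})_s)^*`, i.e. the functionals on `𝔪^{⊗ p}` that vanish in all large Adams
degrees. -/
def barCochain (p : ℕ) : Submodule k (BarForm 𝒜 p) where
  carrier := {f | ∃ N, VanishesAbove 𝒜 N f}
  zero_mem' := ⟨0, fun _ _ _ _ => rfl⟩
  add_mem' := by
    rintro f g ⟨N, hN⟩ ⟨M, hM⟩
    refine ⟨max N M, fun s a ha hs => ?_⟩
    rw [add_apply, hN s a ha (lt_of_le_of_lt (le_max_left _ _) hs),
      hM s a ha (lt_of_le_of_lt (le_max_right _ _) hs), add_zero]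
  smul_mem' := by
    rintro c f ⟨N, hN⟩
    refine ⟨N, fun s a ha hs => ?_⟩
    rw [smul_apply, hN s a ha hs, smul_zero]

/-- Updating one entry of `a` updates one entry of `[a_0 | ⋯ | a_j a_{j+1} | ⋯ | a_p]`,
linearly. -/
lemma exists_contractNth_update {p : ℕ} (j : Fin p) (a : Fin (p + 1) → augIdeal 𝒜)
    (i : Fin (p + 1)) :
    ∃ φ : augIdeal 𝒜 →ₗ[k] augIdeal 𝒜, ∀ x,
      Fin.contractNth j.castSucc (fun u v => augMul 𝒜 u v) (Function.update a i x) =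
        Function.update (Fin.contractNth j.castSucc (fun u v => augMul 𝒜 u v) a)
          (j.predAbove i) (φ x) := by
  have key : ∀ (φ : augIdeal 𝒜 →ₗ[k] augIdeal 𝒜),
      (∀ x (l : Fin p), Fin.contractNth j.castSucc (fun u v => augMul 𝒜 u v)
        (Function.update a i x) l = if l = j.predAbove i then φ x else
          Fin.contractNth j.castSucc (fun u v => augMul 𝒜 u v) a l) →
      ∃ φ : augIdeal 𝒜 →ₗ[k] augIdeal 𝒜, ∀ x,
      Fin.contractNth j.castSucc (fun u v => augMul 𝒜 u v) (Function.update a i x) =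
        Function.update (Fin.contractNth j.castSucc (fun u v => augMul 𝒜 u v) a)
          (j.predAbove i) (φ x) :=
    fun φ h => ⟨φ, fun x => funext fun l => by rw [h x l, Function.update_apply]⟩
  have hpred : ∀ l : Fin p, (l = j.predAbove i) ↔
      (l : ℕ) = if (j : ℕ) < i then (i : ℕ) - 1 else i := by
    intro l
    rw [Fin.ext_iff, Fin.predAbove]
    split_ifs with h1 h2 h2
    · simp
    · exact absurd (by simpa [Fin.lt_def] using h1) h2
    · exact absurd (by simpa [Fin.lt_def] using h2) h1
    · simp
  rcases lt_trichotomy (i : ℕ) j with h | h | h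
  · refine key LinearMap.id fun x l => ?_
    simp only [hpred, Fin.contractNth, Function.update_apply, Fin.ext_iff, Fin.val_castSucc,
      Fin.val_succ, LinearMap.id_apply]
    grind
  · refine key ((augMul 𝒜).flip (a j.succ)) fun x l => ?_
    simp only [hpred, Fin.contractNth, Function.update_apply, Fin.ext_iff, Fin.val_castSucc,
      Fin.val_succ, LinearMap.flip_apply]
    rcases lt_trichotomy (l : ℕ) j with h' | h' | h'
    · grind
    · obtain rfl : l = j := Fin.ext h'
      grind
    · grind
  · rcases eq_or_lt_of_le (Nat.succ_le_of_lt h) with h2 | h2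
    · refine key (augMul 𝒜 (a j.castSucc)) fun x l => ?_
      simp only [hpred, Fin.contractNth, Function.update_apply, Fin.ext_iff, Fin.val_castSucc,
        Fin.val_succ]
      rcases lt_trichotomy (l : ℕ) j with h' | h' | h'
      · grind
      · obtain rfl : l = j := Fin.ext h'
        grind
      · grind
    · refine key LinearMap.id fun x l => ?_
      simp only [hpred, Fin.contractNth, Function.update_apply, Fin.ext_iff, Fin.val_castSucc,
        Fin.val_succ, LinearMap.id_apply]
      grind

/-- The functional `[a_0 | ⋯ | a_p] ↦ f [a_0 | ⋯ | a_j a_{j+1} | ⋯ | a_p]`. -/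
def contractForm {p : ℕ} (j : Fin p) : BarForm 𝒜 p →ₗ[k] BarForm 𝒜 (p + 1) where
  toFun f := MultilinearMap.mk'
    (fun a => f (Fin.contractNth j.castSucc (fun u v => augMul 𝒜 u v) a))
    (by
      intro a i x y
      obtain ⟨φ, hφ⟩ := exists_contractNth_update 𝒜 j a i
      simp only [hφ, map_add, MultilinearMap.map_update_add])
    (by
      intro a i c x
      obtain ⟨φ, hφ⟩ := exists_contractNth_update 𝒜 j a i
      simp only [hφ, map_smul, MultilinearMap.map_update_smul])
  map_add' _ _ := rfl
  map_smul' _ _ := rfl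

/-- The dual `f ↦ f ∘ d` of the differential
`d [a_1 | ⋯ | a_m] = ∑_{i=2}^m (-1)^{i-1} [a_1 | ⋯ | a_{i-1} a_i | ⋯ | a_m]`
of the bar construction, with the sign `∂ f = -(-1)^{deg f} f ∘ d`. -/
def formDifferential (p : ℕ) : BarForm 𝒜 p →ₗ[k] BarForm 𝒜 (p + 1) :=
  (-(-1 : k) ^ p) • ∑ j : Fin p, (-1 : k) ^ ((j : ℕ) + 1) • contractForm 𝒜 j

lemma formDifferential_mem {p : ℕ} {f : BarForm 𝒜 p} (hf : f ∈ barCochain 𝒜 p) :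
    formDifferential 𝒜 p f ∈ barCochain 𝒜 (p + 1) := by
  obtain ⟨N, hN⟩ := hf
  refine ⟨N, fun s a ha hs => ?_⟩
  have h : ∀ j : Fin p, contractForm 𝒜 j f a = 0 := fun j => by
    refine hN (Fin.contractNth j.castSucc (· + ·) s) _ (fun i => ?_) ?_
    · simp only [Fin.contractNth]
      split_ifs
      · exact ha _
      · exact SetLike.mul_mem_graded (ha _) (ha _)
      · exact ha _
    · have h1 := congrFun (Fin.partialSum_contractNth s j.castSucc) (Fin.last p)
      have h2 : (j.castSucc.succ).succAbove (Fin.last p) = Fin.last (p + 1) := by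
        rw [Fin.succAbove_of_le_castSucc, Fin.succ_last]
        simp [Fin.le_def]
      rw [Function.comp_apply, h2] at h1
      simp only [Fin.partialSum, Fin.val_last, List.take_of_length_le, List.length_ofFn, le_refl,
        List.sum_ofFn] at h1
      rw [h1]
      exact hs
  simp [formDifferential, LinearMap.sum_apply, h]

/-- The product of functionals dual to the deconcatenation coproduct, with the Koszul sign:
`(f · g) [a_1 | ⋯ | a_{p+q}] = (-1)^{pq} f [a_1 | ⋯ | a_p] g [a_{p+1} | ⋯ | a_{p+q}]`. -/
def formMul (p q : ℕ) (f : BarForm 𝒜 p) (g : BarForm 𝒜 q) : BarForm 𝒜 (p + q) :=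
  (-1 : k) ^ (p * q) •
    (LinearMap.mul' k k).compMultilinearMap ((f.domCoprod g).domDomCongr finSumFinEquiv)

lemma formMul_apply (p q : ℕ) (f : BarForm 𝒜 p) (g : BarForm 𝒜 q)
    (a : Fin (p + q) → augIdeal 𝒜) :
    formMul 𝒜 p q f g a = (-1 : k) ^ (p * q) *
      (f (fun i => a (Fin.castAdd q i)) * g (fun i => a (Fin.natAdd p i))) := by
  simp [formMul]

lemma formMul_mem {p q : ℕ} {f : BarForm 𝒜 p} {g : BarForm 𝒜 q} (hf : f ∈ barCochain 𝒜 p)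
    (hg : g ∈ barCochain 𝒜 q) : formMul 𝒜 p q f g ∈ barCochain 𝒜 (p + q) := by
  obtain ⟨N, hN⟩ := hf
  obtain ⟨M, hM⟩ := hg
  refine ⟨N + M, fun s a ha hs => ?_⟩
  rw [formMul_apply]
  rw [Fin.sum_univ_add] at hs
  rcases lt_or_ge N (∑ i, s (Fin.castAdd q i)) with h | h
  · rw [hN _ (fun i => a (Fin.castAdd q i)) (fun i => ha _) h, zero_mul, mul_zero]
  · rw [hM _ (fun i => a (Fin.natAdd p i)) (fun i => ha _) (by omega), mul_zero, mul_zero]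

/-- The underlying vector space of the dual bar construction `B^# A`, the graded dual of the bar
construction on `A`. It is a DG algebra whose cohomology is the Ext-algebra
`Ext_A^*(k_A, k_A)`. -/
abbrev BarDual : Type _ := ⨁ p : ℕ, barCochain 𝒜 p

instance instAddCommGroupBarCochain (p : ℕ) : AddCommGroup (barCochain 𝒜 p) := inferInstance

instance instAddCommGroupBarDual : AddCommGroup (BarDual 𝒜) :=
  inferInstanceAs (AddCommGroup (Π₀ p : ℕ, barCochain 𝒜 p))

/-- The differential of `B^# A`. -/
def barD : BarDual 𝒜 →ₗ[k] BarDual 𝒜 :=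
  DirectSum.toModule k ℕ _ fun p =>
    DirectSum.lof k ℕ (fun p => barCochain 𝒜 p) (p + 1) ∘ₗ
      (formDifferential 𝒜 p).restrict (fun _ hf => formDifferential_mem 𝒜 hf)

/-- The product on homogeneous components of `B^# A`. -/
def cochainMul (p q : ℕ) :
    barCochain 𝒜 p →ₗ[k] barCochain 𝒜 q →ₗ[k] barCochain 𝒜 (p + q) :=
  LinearMap.mk₂ k (fun f g => ⟨formMul 𝒜 p q f g, formMul_mem 𝒜 f.2 g.2⟩)
    (fun _ _ _ => Subtype.ext (MultilinearMap.ext fun _ => by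
      simp [formMul_apply]; ring))
    (fun _ _ _ => Subtype.ext (MultilinearMap.ext fun _ => by
      simp [formMul_apply]; ring))
    (fun _ _ _ => Subtype.ext (MultilinearMap.ext fun _ => by
      simp [formMul_apply]; ring))
    (fun _ _ _ => Subtype.ext (MultilinearMap.ext fun _ => by
      simp [formMul_apply]; ring))

/-- The product of `B^# A`. -/
def barMul : BarDual 𝒜 →ₗ[k] BarDual 𝒜 →ₗ[k] BarDual 𝒜 :=
  DirectSum.toModule k ℕ _ fun p =>
    (DirectSum.toModule k ℕ _ fun q =>
      ((cochainMul 𝒜 p q).compr₂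
        (DirectSum.lof k ℕ (fun p => barCochain 𝒜 p) (p + q))).flip).flip

/-- The unit of `B^# A`: the functional `1` on `𝔪^{⊗ 0} = k`. -/
def barOne : BarDual 𝒜 :=
  DirectSum.lof k ℕ (fun p => barCochain 𝒜 p) 0
    ⟨MultilinearMap.constOfIsEmpty k _ 1, 0, fun _ _ _ h => absurd h (by simp)⟩

/-- The part of `B^# A` of bidegree `(p, s)`: the functionals that vanish on every
`[a_1 | ⋯ | a_q]` of tensor length `q` and Adams degree `t`, unless `q = p` and `t = - s`. -/
def barBigrading (p s : ℤ) : Submodule k (BarDual 𝒜) where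
  carrier := {x | ∀ (q : ℕ) (t : Fin q → ℕ) (a : Fin q → augIdeal 𝒜),
    (∀ i, (a i : A) ∈ 𝒜 (t i)) → ¬ ((q : ℤ) = p ∧ -((∑ i, t i : ℕ) : ℤ) = s) →
      (x q : BarForm 𝒜 q) a = 0}
  zero_mem' := fun _ _ _ _ _ => rfl
  add_mem' := by
    intro x y hx hy q t a ha h
    simp [hx q t a ha h, hy q t a ha h]
  smul_mem' := by
    intro c x hx q t a ha h
    simp [DirectSum.smul_apply, hx q t a ha h]

/-- The Ext-algebra `E = Ext_A^*(k_A, k_A)`, computed as the cohomology of `B^# A`. -/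
abbrev ExtAlg : Type _ :=
  LinearMap.ker (barD 𝒜) ⧸ (LinearMap.range (barD 𝒜)).submoduleOf (LinearMap.ker (barD 𝒜))

/-- The cohomology class of a cocycle. -/
def extClass : LinearMap.ker (barD 𝒜) →ₗ[k] ExtAlg 𝒜 := Submodule.mkQ _

/-- The part `E^p_s` of cohomological degree `p` and Adams degree `s`. -/
def extBigrading (p s : ℤ) : Submodule k (ExtAlg 𝒜) :=
  ((barBigrading 𝒜 p s).submoduleOf (LinearMap.ker (barD 𝒜))).map (extClass 𝒜)

/-- The part `E^p` of cohomological degree `p`. -/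
def extDegree (p : ℤ) : Submodule k (ExtAlg 𝒜) := ⨆ s : ℤ, extBigrading 𝒜 p s

lemma barD_barOne : barD 𝒜 (barOne 𝒜) = 0 := by
  have h : formDifferential 𝒜 0 = 0 := by
    simp [formDifferential]
  rw [barD, barOne, DirectSum.toModule_lof, LinearMap.comp_apply]
  have h2 : ∀ c : barCochain 𝒜 0, (formDifferential 𝒜 0).restrict
      (fun _ hf => formDifferential_mem 𝒜 hf) c = 0 := fun c => Subtype.ext (by simp [h])
  rw [h2, map_zero]

/-- The unit of the Ext-algebra. -/
def extOne : ExtAlg 𝒜 := extClass 𝒜 ⟨barOne 𝒜, LinearMap.mem_ker.2 (barD_barOne 𝒜)⟩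

/-- An `A_∞`-Ext-algebra of `A` (a model of the `A_∞`-algebra `Ext_A^*(k_A, k_A)`): an
`A_∞`-algebra structure on the cohomology of `B^# A` with `m_1 = 0`, together with a
quasi-isomorphism of `A_∞`-algebras to the DG algebra `B^# A` that lifts the identity of the
cohomology. -/
structure AInfinityExt where
  /-- the `A_∞`-structure -/
  str : AInf.AInfinityStructure k (extBigrading 𝒜) (extOne 𝒜)
  m_one : str.m 1 = 0
  /-- the quasi-isomorphism -/
  quasiIso : AInf.MorphismToDG str (barBigrading 𝒜) (barD 𝒜) (barMul 𝒜) (barOne 𝒜)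
  lifts_id : ∀ x : ExtAlg 𝒜, ∃ h : quasiIso.f 1 (fun _ => x) ∈ LinearMap.ker (barD 𝒜),
    extClass 𝒜 ⟨quasiIso.f 1 (fun _ => x), h⟩ = x

/-! ## Relations of an algebra generated in degree `1` -/

/-- The multiplication map `T(A_1) → A` from the tensor algebra on `A_1`. -/
def tensorToAlg : TensorAlgebra k (𝒜 1) →ₐ[k] A := TensorAlgebra.lift k (𝒜 1).subtype

/-- `R = ⨁_{n ≥ 2} R_n`, with `R_n ⊆ A_1^{⊗ n}`, is a minimal graded space of relations of `A`:
it generates the kernel of `T(A_1) → A` as a two-sided ideal, and no smaller graded subspace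
does. -/
def IsMinimalRelations (R : ∀ n : ℕ, Submodule k (⨂[k]^n (𝒜 1))) : Prop :=
  let gen : (∀ n : ℕ, Submodule k (⨂[k]^n (𝒜 1))) → TwoSidedIdeal (TensorAlgebra k (𝒜 1)) :=
    fun S => TwoSidedIdeal.span {x | ∃ n, 2 ≤ n ∧ ∃ r ∈ S n, TensorPower.toTensorAlgebra r = x}
  gen R = TwoSidedIdeal.ker (tensorToAlg 𝒜) ∧
    ∀ S : ∀ n : ℕ, Submodule k (⨂[k]^n (𝒜 1)), (∀ n, S n ≤ R n) →
      gen S = TwoSidedIdeal.ker (tensorToAlg 𝒜) → ∀ n, 2 ≤ n → S n = R n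

/-- The image of `A_1 ⊗ A_n` in the tensor algebra on `A_1`, if `A_n` is embedded into
`A_1^{⊗ n}` by `θ`. -/
def genTensor {n : ℕ} (θ : 𝒜 n →ₗ[k] ⨂[k]^n (𝒜 1)) : Submodule k (TensorAlgebra k (𝒜 1)) :=
  LinearMap.range (TensorAlgebra.ι k (M := 𝒜 1)) *
    LinearMap.range (TensorPower.toTensorAlgebra ∘ₗ θ)

/-- A compatible choice of embeddings `A_n ⊆ A_1^{⊗ n}`: each `θ n` splits the multiplication map
`A_1^{⊗ n} → A_n`, and the image of `θ (n + 1)` lies in `A_1 ⊗ A_n ⊆ A_1^{⊗ (n + 1)}`, so that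
`θ (n + 1)` is the composite of a splitting `A_{n+1} → A_1 ⊗ A_n` of the multiplication map and of
`id ⊗ θ n`. -/
structure IsTensorEmbedding (θ : ∀ n : ℕ, 𝒜 n →ₗ[k] ⨂[k]^n (𝒜 1)) : Prop where
  split : ∀ (n : ℕ) (a : 𝒜 n), tensorToAlg 𝒜 (TensorPower.toTensorAlgebra (θ n a)) = a
  recursive : ∀ (n : ℕ) (a : 𝒜 (n + 1)),
    TensorPower.toTensorAlgebra (θ (n + 1) a) ∈ genTensor 𝒜 (θ n)

/-- The product `(a_0, …, a_n) ↦ a_0 ⋯ a_n` of elements of `A_1`, with values in `𝔪`. -/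
def tailProduct (n : ℕ) : MultilinearMap k (fun _ : Fin (n + 1) => 𝒜 1) (augIdeal 𝒜) :=
  ((MultilinearMap.mkPiAlgebraFin k (n + 1) A).compLinearMap
    (fun _ => (𝒜 1).subtype)).codRestrict (augIdeal 𝒜) (fun a => by
      simp only [MultilinearMap.compLinearMap_apply, MultilinearMap.mkPiAlgebraFin_apply,
        Submodule.subtype_apply, List.ofFn_succ, List.prod_cons]
      exact mul_mem_augIdeal 𝒜 (mem_augIdeal_of_mem 𝒜 one_ne_zero (a 0).2))

/-- The bilinear form `(u, w) ↦ z [u | w]` given by a functional `z` on `𝔪 ⊗ 𝔪`. -/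
def formTwo (z : BarForm 𝒜 2) : augIdeal 𝒜 →ₗ[k] augIdeal 𝒜 →ₗ[k] k :=
  have e₀ : ∀ u w t : augIdeal 𝒜, Function.update ![u, w] 0 t = ![t, w] := fun u w t => by
    ext i; fin_cases i <;> rfl
  have e₁ : ∀ u w t : augIdeal 𝒜, Function.update ![u, w] 1 t = ![u, t] := fun u w t => by
    ext i; fin_cases i <;> rfl
  LinearMap.mk₂ k (fun u w => z ![u, w])
    (fun u v w => by have h := z.map_update_add ![u, w] 0 u v; rwa [e₀, e₀, e₀] at h)
    (fun c u w => by have h := z.map_update_smul ![u, w] 0 c u; rwa [e₀, e₀] at h)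
    (fun u v w => by have h := z.map_update_add ![u, v] 1 v w; rwa [e₁, e₁, e₁] at h)
    (fun c u w => by have h := z.map_update_smul ![u, w] 1 c w; rwa [e₁, e₁] at h)

/-- The multilinear form `(a_0, …, a_{n+1}) ↦ z [a_0 | a_1 a_2 ⋯ a_{n+1}]` on `A_1` given by a
functional `z` on `𝔪 ⊗ 𝔪`. -/
def headTailForm (n : ℕ) (z : BarForm 𝒜 2) : MultilinearMap k (fun _ : Fin (n + 2) => 𝒜 1) k :=
  LinearMap.uncurryLeft (M := fun _ : Fin (n + 2) => 𝒜 1)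
    { toFun := fun a =>
        (formTwo 𝒜 z ⟨a, mem_augIdeal_of_mem 𝒜 one_ne_zero a.2⟩).compMultilinearMap
          (tailProduct 𝒜 n)
      map_add' := fun a b => by
        ext c
        exact LinearMap.congr_fun ((formTwo 𝒜 z).map_add
          ⟨a, mem_augIdeal_of_mem 𝒜 one_ne_zero a.2⟩
          ⟨b, mem_augIdeal_of_mem 𝒜 one_ne_zero b.2⟩) (tailProduct 𝒜 n c)
      map_smul' := fun c a => by
        ext d
        exact LinearMap.congr_fun ((formTwo 𝒜 z).map_smul c
          ⟨a, mem_augIdeal_of_mem 𝒜 one_ne_zero a.2⟩) (tailProduct 𝒜 n d) }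

lemma headTailForm_apply (n : ℕ) (z : BarForm 𝒜 2) (a : Fin (n + 2) → 𝒜 1) :
    headTailForm 𝒜 n z a =
      z ![⟨a 0, mem_augIdeal_of_mem 𝒜 one_ne_zero (a 0).2⟩,
        tailProduct 𝒜 n (fun i => a i.succ)] := rfl

/-- The restriction of a functional `z` on `𝔪 ⊗ 𝔪` along
`A_1^{⊗ (n + 2)} = A_1 ⊗ A_1^{⊗ (n + 1)} → A_1 ⊗ A_{n + 1} ⊆ 𝔪 ⊗ 𝔪`. -/
def restrictTwo (n : ℕ) (z : BarForm 𝒜 2) : Module.Dual k (⨂[k]^(n + 2) (𝒜 1)) :=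
  PiTensorProduct.lift (headTailForm 𝒜 n z)

/-- The identification `(A_1^#)^{⊗ n} = (A_1^{⊗ n})^#`, evaluated on `β_1 ⊗ ⋯ ⊗ β_n`. Since here
`A_1^# = E^1` sits in degree `1` and is dual to the part `S A_1` of degree `-1` of the bar
construction, the Koszul sign rule gives
`(β_1 ⊗ ⋯ ⊗ β_n) (a_1 ⊗ ⋯ ⊗ a_n) = (-1)^{n(n-1)/2} β_1(a_1) ⋯ β_n(a_n)`,
which is the value of the product `β_1 ⋯ β_n` of `B^# A` on `[a_1 | ⋯ | a_n]`. -/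
def koszulTensor {n : ℕ} (β : Fin n → Module.Dual k (𝒜 1)) :
    Module.Dual k (⨂[k]^n (𝒜 1)) :=
  (-1 : k) ^ (n * (n - 1) / 2) •
    PiTensorProduct.lift ((MultilinearMap.mkPiAlgebra k (Fin n) k).compLinearMap β)

end Bar

end

/-!
The `A_∞`-structure is obtained by homotopy transfer from the DG algebra `B^# A` to its cohomology
`E`, along a homotopy `Q` that is chosen so that the operations on `E^1` can be computed.

*Transfer.* Let `Q` be a homotopy of degree `-1` on a DG algebra `W` that satisfies the side
conditions, so that `1 - d Q - Q d` is the projection onto a copy `i : V → W` of the cohomology,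
with inverse induced by `P : W → V`. The twisting function `τ`, defined by the fixed-point equation
`τ = i + Q (ετ * τ)` (`AInf.Contraction.tau`), and the operations `β = -P (ετ * τ)`
(`AInf.Contraction.beta`) are, up to the signs of the desuspension, the components of an
`A_∞`-morphism `V → W` and of an `A_∞`-structure on `V`. Here `*` is the convolution product of
functions on lists (words in `V`), and `ε` the sign involution. Instead of summing over trees, one
shows that the curvature `d τ - ετ * τ - τ ∘ b` vanishes, where `b` is the coderivation with
components `β`: it is killed by `P` and by `Q`, and the Bianchi identity expresses its differential,
up to a term killed by `Q`, by its values on shorter words (`AInf.Contraction.curvature_eq_zero`).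

*The first two Ext-groups.* A one-cocycle vanishes on products, hence is a linear form on `A_1`
(`DualBar.equivOne`). A form `z` on `𝔪 ⊗ 𝔪` is pulled back to a linear form on `T(A_1)` by
`v ⊗ t ↦ z [v | t]` (`DualBar.pullback`). If `z` is a cocycle whose pullback vanishes on the
relations, then the pullback vanishes on the whole kernel of `T(A_1) → A` and descends to a form on
`𝔪` with coboundary `±z`; this is injectivity of `E^2_{-n} → R_n^#`. For surjectivity, minimality of
`R` and the graded Nakayama lemma show that `R` meets `A_1 I + I A_1` trivially, where `I` is the
ideal of relations (`TensorAlgebra.eq_zero_of_decomposable`), so that a linear form on `R_n` extends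
to a form `φ` on `T(A_1)` that vanishes on `A_1 I + I A_1`. Then `[a | b] ↦ φ (a ⊗ b - a b)` is a
cocycle that restricts to the given form (`DualBar.Presentation.exists_cocycle`).

*The choice of the homotopy.* On `(𝔪 ⊗ 𝔪)^#` the homotopy is dual to the splittings
`A_n → A_1 ⊗ A_{n-1}` that underlie `θ`, and on `(𝔪^{⊗ 3})^#` it is a generalized inverse of the
differential with values in the forms that vanish on `R`; the latter is possible because every form
on `𝔪 ⊗ 𝔪` agrees on `R` with a cocycle (`DualBar.Presentation.exists_homotopy`). The first property
implies, by induction on `n`, that `τ` on classes of `β_1, …, β_n ∈ A_1^#` is the product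
`± β_1 ⋯ β_n`, evaluated on `A_n ⊆ A_1^{⊗ n}` (`DualBar.Presentation.tau_classOne_apply`). The
second implies that the projection to `E^2` does not change restrictions to `R`, so that `m_n`
restricts to the product `± β_1 ⋯ β_n` on `R_n` (`DualBar.Presentation.aInfinityExt_m`).
-/

noncomputable section

/-! ### Functions on lists -/

namespace ListCalculus

variable {V W : Type*}

section SplitSum

variable [AddCommGroup W]

/-- The sum of `Φ u v` over all decompositions `l = u ++ v`: the convolution attached to the
deconcatenation coproduct. -/
def splitSum : (List V → List V → W) → List V → W
  | Φ, [] => Φ [] []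
  | Φ, x :: l => Φ [] (x :: l) + splitSum (fun u v => Φ (x :: u) v) l

lemma splitSum_congr {Φ Ψ : List V → List V → W} {l : List V}
    (h : ∀ u v, u ++ v = l → Φ u v = Ψ u v) : splitSum Φ l = splitSum Ψ l := by
  induction l generalizing Φ Ψ with
  | nil => exact h [] [] rfl
  | cons x l ih =>
    simp only [splitSum]
    rw [h [] (x :: l) rfl, ih fun u v huv => h (x :: u) v (by simp [huv])]

lemma splitSum_zero (l : List V) : splitSum (fun _ _ => (0 : W)) l = 0 := by
  induction l with
  | nil => rfl
  | cons x l ih => simp only [splitSum, ih, add_zero]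

lemma splitSum_eq_zero {Φ : List V → List V → W} {l : List V}
    (h : ∀ u v, u ++ v = l → Φ u v = 0) : splitSum Φ l = 0 :=
  (splitSum_congr h).trans (splitSum_zero l)

lemma splitSum_add (Φ Ψ : List V → List V → W) (l : List V) :
    splitSum (fun u v => Φ u v + Ψ u v) l = splitSum Φ l + splitSum Ψ l := by
  induction l generalizing Φ Ψ with
  | nil => rfl
  | cons x l ih => simp only [splitSum, ih]; abel

lemma map_splitSum {W' : Type*} [AddCommGroup W'] (g : W →+ W') (Φ : List V → List V → W)
    (l : List V) : g (splitSum Φ l) = splitSum (fun u v => g (Φ u v)) l := by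
  induction l generalizing Φ with
  | nil => rfl
  | cons x l ih => simp only [splitSum, map_add, ih]

lemma splitSum_neg (Φ : List V → List V → W) (l : List V) :
    splitSum (fun u v => -Φ u v) l = -splitSum Φ l :=
  (map_splitSum (negAddMonoidHom : W →+ W) Φ l).symm

lemma splitSum_sub (Φ Ψ : List V → List V → W) (l : List V) :
    splitSum (fun u v => Φ u v - Ψ u v) l = splitSum Φ l - splitSum Ψ l := by
  simp only [sub_eq_add_neg, splitSum_add, splitSum_neg]

/-- Coassociativity of deconcatenation. -/
lemma splitSum_splitSum (Ψ : List V → List V → List V → W) (l : List V) :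
    splitSum (fun u w => splitSum (fun v₁ v₂ => Ψ u v₁ v₂) w) l =
      splitSum (fun w v => splitSum (fun u₁ u₂ => Ψ u₁ u₂ v) w) l := by
  induction l generalizing Ψ with
  | nil => rfl
  | cons x l ih =>
    simp only [splitSum]
    rw [ih, splitSum_add, add_assoc]

lemma splitSum_eq_last {Φ : List V → List V → W} {l : List V}
    (h : ∀ u v, v ≠ [] → Φ u v = 0) : splitSum Φ l = Φ l [] := by
  induction l generalizing Φ with
  | nil => rfl
  | cons x l ih =>
    simp only [splitSum]
    rw [h _ _ (List.cons_ne_nil _ _), zero_add, ih fun u v => h _ v]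

lemma splitSum_map {V' : Type*} (g : V' → V) (Φ : List V → List V → W) (l : List V') :
    splitSum Φ (l.map g) = splitSum (fun u v => Φ (u.map g) (v.map g)) l := by
  induction l generalizing Φ with
  | nil => rfl
  | cons x l ih => simp only [splitSum, List.map_cons, ih, List.map_nil]

lemma splitSum_eq_sum (Φ : List V → List V → W) (l : List V) :
    splitSum Φ l = ∑ i ∈ Finset.range (l.length + 1), Φ (l.take i) (l.drop i) := by
  induction l generalizing Φ with
  | nil => simp [splitSum]
  | cons x l ih =>
    rw [splitSum, ih, List.length_cons, Finset.sum_range_succ' _ (l.length + 1), add_comm]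
    rfl

end SplitSum

/-- A function of lists that is linear in every entry. -/
structure IsMultilinear (k : Type*) [Semiring k] [AddCommGroup V] [Module k V] [AddCommGroup W]
    [Module k W] (F : List V → W) : Prop where
  map_add : ∀ u v x y, F (u ++ (x + y) :: v) = F (u ++ x :: v) + F (u ++ y :: v)
  map_smul : ∀ u v (c : k) x, F (u ++ (c • x) :: v) = c • F (u ++ x :: v)

section Multilinear

variable {k : Type*} [CommRing k] [AddCommGroup V] [Module k V] [AddCommGroup W] [Module k W]

lemma IsMultilinear.comp {W' : Type*} [AddCommGroup W'] [Module k W'] {F : List V → W}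
    (hF : IsMultilinear k F) (g : W →ₗ[k] W') : IsMultilinear k (fun l => g (F l)) :=
  ⟨fun u v x y => by rw [hF.map_add, _root_.map_add],
    fun u v c x => by rw [hF.map_smul, _root_.map_smul]⟩

lemma IsMultilinear.splitSum {Φ : List V → List V → W}
    (h₁ : ∀ v, IsMultilinear k (fun u => Φ u v)) (h₂ : ∀ u, IsMultilinear k (fun v => Φ u v)) :
    IsMultilinear k (fun l => ListCalculus.splitSum Φ l) := by
  constructor
  · intro u
    induction u generalizing Φ with
    | nil =>
      intro v x y
      simp only [List.nil_append, ListCalculus.splitSum]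
      have e : (fun u v => Φ ((x + y) :: u) v) = fun u v => Φ (x :: u) v + Φ (y :: u) v := by
        funext u v
        exact (h₁ v).map_add [] u x y
      have h := (h₂ []).map_add [] v x y
      simp only [List.nil_append] at h
      rw [e, splitSum_add, h]
      abel
    | cons a u ih =>
      intro v x y
      simp only [List.cons_append, ListCalculus.splitSum]
      rw [ih (fun v => ⟨fun p q => (h₁ v).map_add (a :: p) q,
          fun p q => (h₁ v).map_smul (a :: p) q⟩)
        (fun u => h₂ _)]
      have := (h₂ []).map_add (a :: u) v x y
      simp only [List.cons_append] at this
      rw [this]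
      abel
  · intro u
    induction u generalizing Φ with
    | nil =>
      intro v c x
      simp only [List.nil_append, ListCalculus.splitSum]
      have e : (fun u v => Φ ((c • x) :: u) v) = fun u v => c • Φ (x :: u) v := by
        funext u v
        exact (h₁ v).map_smul [] u c x
      have h := (h₂ []).map_smul [] v c x
      simp only [List.nil_append] at h
      rw [e, smul_add, h]
      exact congrArg _ (map_splitSum (DistribSMul.toAddMonoidHom W c) _ _).symm
    | cons a u ih =>
      intro v c x
      simp only [List.cons_append, ListCalculus.splitSum]
      rw [ih (fun v => ⟨fun p q => (h₁ v).map_add (a :: p) q,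
          fun p q => (h₁ v).map_smul (a :: p) q⟩)
        (fun u => h₂ _)]
      have := (h₂ []).map_smul (a :: u) v c x
      simp only [List.cons_append] at this
      rw [this, smul_add]

/-- The multilinear map in `n` variables given by a multilinear function of lists. -/
def IsMultilinear.toMultilinearMap {F : List V → W} (hF : IsMultilinear k F) (n : ℕ) :
    MultilinearMap k (fun _ : Fin n => V) W :=
  MultilinearMap.mk' (fun x => F (List.ofFn x))
    (fun x i a b => by
      have e : ∀ c : V, List.ofFn (Function.update x i c) =
          (List.ofFn x).take i ++ c :: (List.ofFn x).drop (i + 1) := fun c => by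
        rw [← List.set_eq_take_append_cons_drop.trans (if_pos (by simp))]
        refine List.ext_getElem (by simp) fun j h₁ h₂ => ?_
        simp [List.getElem_set, Function.update_apply, Fin.ext_iff, eq_comm]
      rw [e, e, e, hF.map_add])
    (fun x i c a => by
      have e : ∀ c : V, List.ofFn (Function.update x i c) =
          (List.ofFn x).take i ++ c :: (List.ofFn x).drop (i + 1) := fun c => by
        rw [← List.set_eq_take_append_cons_drop.trans (if_pos (by simp))]
        refine List.ext_getElem (by simp) fun j h₁ h₂ => ?_
        simp [List.getElem_set, Function.update_apply, Fin.ext_iff, eq_comm]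
      rw [e, e, hF.map_smul])

lemma IsMultilinear.toMultilinearMap_apply {F : List V → W} (hF : IsMultilinear k F) (n : ℕ)
    (x : Fin n → V) : hF.toMultilinearMap n x = F (List.ofFn x) := rfl

end Multilinear

section Coderivation

variable [AddCommGroup W]

/-- The function `F ∘ b` of lists, where `b` is the coderivation of the tensor coalgebra with
components `β`:
the sum of `F (σ l₁ ++ β l₂ :: l₃)` over all decompositions `l = l₁ ++ l₂ ++ l₃` in which `l₂` has
at least two entries. The Koszul sign of moving `β`, which is odd, past `l₁` is produced by
applying the sign involution `σ` to the entries of `l₁`. -/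
def coder (σ : V → V) (β : List V → V) : (List V → W) → List V → W
  | _, [] => 0
  | F, x :: l => coder σ β (fun m => F (σ x :: m)) l +
      splitSum (fun u v => if u = [] then 0 else F (β (x :: u) :: v)) l

variable (σ : V → V) (β : List V → V)

lemma coder_add (F G : List V → W) (l : List V) :
    coder σ β (fun m => F m + G m) l = coder σ β F l + coder σ β G l := by
  induction l generalizing F G with
  | nil => simp [coder]
  | cons x l ih =>
    have e : (fun u v => if u = [] then (0 : W) else F (β (x :: u) :: v) + G (β (x :: u) :: v)) =
        fun u v => (if u = [] then 0 else F (β (x :: u) :: v)) +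
          (if u = [] then 0 else G (β (x :: u) :: v)) := by
      funext u v
      split_ifs <;> simp
    simp only [coder, ih, e, splitSum_add]
    abel

lemma map_coder {W' : Type*} [AddCommGroup W'] (g : W →+ W') (F : List V → W) (l : List V) :
    g (coder σ β F l) = coder σ β (fun m => g (F m)) l := by
  induction l generalizing F with
  | nil => simp [coder]
  | cons x l ih =>
    simp only [coder, map_add, ih, map_splitSum]
    congr 2
    funext u v
    split_ifs <;> simp

lemma coder_eq_zero {F : List V → W} {l : List V}
    (h : ∀ m, m.length < l.length → m ≠ [] → F m = 0) : coder σ β F l = 0 := by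
  induction l generalizing F with
  | nil => rfl
  | cons x l ih =>
    rw [coder, ih fun m hm _ => h _ (by simpa using hm) (List.cons_ne_nil _ _), zero_add]
    refine splitSum_eq_zero fun u v huv => ?_
    split_ifs with hu
    · rfl
    · refine h _ ?_ (List.cons_ne_nil _ _)
      have := List.length_pos_iff.2 hu
      simp only [List.length_cons, ← huv, List.length_append]
      omega

/-- A function supported on lists of length one picks out the component `β`. -/
lemma coder_of_forall_ne {g : V → W} {F : List V → W} (hF : ∀ x, F [x] = g x)
    (hF' : ∀ x y l, F (x :: y :: l) = 0) (hβ : ∀ x, g (β [x]) = 0)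
    (hβ' : g (β []) = 0) (l : List V) : coder σ β F l = g (β l) := by
  cases l with
  | nil => rw [hβ', coder]
  | cons x l =>
    have h₁ : coder σ β (fun m => F (σ x :: m)) l = 0 :=
      coder_eq_zero σ β fun m _ hm => by
        obtain ⟨y, m, rfl⟩ := List.exists_cons_of_ne_nil hm
        exact hF' _ _ _
    have h₂ : splitSum (fun u v => if u = [] then (0 : W) else F (β (x :: u) :: v)) l =
        if l = [] then 0 else F [β (x :: l)] := by
      refine splitSum_eq_last (Φ := fun u v => if u = [] then (0 : W) else F (β (x :: u) :: v))
        fun u v hv => ?_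
      obtain ⟨y, v, rfl⟩ := List.exists_cons_of_ne_nil hv
      simp only [hF', ite_self]
    rw [coder, h₁, h₂, zero_add, hF]
    split_ifs with h
    · rw [h, hβ]
    · rfl

variable {k : Type*} [CommRing k] [Module k W]

/-- The coderivation property, for the convolution product of two functions of lists. -/
lemma coder_conv (μ : W →ₗ[k] W →ₗ[k] W) (F G : List V → W) (l : List V) :
    coder σ β (splitSum fun u v => μ (F u) (G v)) l =
      splitSum (fun u v => μ (F (u.map σ)) (coder σ β G v)) l +
        splitSum (fun u v => μ (coder σ β F u) (G v)) l := by
  induction l generalizing F with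
  | nil => simp [coder, splitSum]
  | cons x l ih =>
    have e₁ : coder σ β (fun m => splitSum (fun u v => μ (F u) (G v)) (σ x :: m)) l =
        μ (F []) (coder σ β (fun m => G (σ x :: m)) l) +
          (splitSum (fun u v => μ (F (σ x :: u.map σ)) (coder σ β G v)) l +
        splitSum (fun u v => μ (coder σ β (fun m => F (σ x :: m)) u) (G v)) l) := by
      rw [← ih fun m => F (σ x :: m)]
      simp only [splitSum]
      rw [coder_add]
      congr 1
      exact (map_coder σ β (μ (F [])).toAddMonoidHom (fun m => G (σ x :: m)) l).symm
    have e₂ : splitSum (fun u v => if u = [] then 0 else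
        splitSum (fun u v => μ (F u) (G v)) (β (x :: u) :: v)) l =
        μ (F []) (splitSum (fun u v => if u = [] then 0 else G (β (x :: u) :: v)) l) +
        splitSum (fun w v => μ (splitSum (fun u v =>
          if u = [] then 0 else F (β (x :: u) :: v)) w) (G v)) l := by
      have : (fun w v => μ (splitSum (fun u v =>
          if u = [] then 0 else F (β (x :: u) :: v)) w) (G v)) = fun w v => splitSum (fun u v₁ =>
          if u = [] then 0 else μ (F (β (x :: u) :: v₁)) (G v)) w := by
        funext w v
        refine (map_splitSum (μ.flip (G v)).toAddMonoidHom _ _).trans ?_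
        congr 1
        funext u v
        simp only [LinearMap.toAddMonoidHom_coe, LinearMap.flip_apply]
        split_ifs <;> simp
      rw [this, ← splitSum_splitSum (fun u v₁ v => if u = [] then 0 else
        μ (F (β (x :: u) :: v₁)) (G v))]
      refine Eq.trans ?_ (congrArg (· + _) (map_splitSum (μ (F [])).toAddMonoidHom _ _).symm)
      rw [← splitSum_add]
      congr 1
      funext u v
      simp only [LinearMap.toAddMonoidHom_coe]
      split_ifs
      · simp [splitSum_zero]
      · simp only [splitSum]
    rw [coder, e₁, e₂]
    simp only [splitSum, coder, map_add, LinearMap.add_apply, splitSum_add, map_zero,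
      LinearMap.zero_apply, List.map_cons, List.map_nil, zero_add]
    abel

end Coderivation

end ListCalculus

/-! ### Transfer of a DG algebra structure along a contraction -/

namespace AInf

open ListCalculus

/-- A contraction of a DG algebra `W` onto a vector space `V` satisfying all side conditions. The
linear map `ε` is the sign involution `x ↦ (-1)^{deg x} x` of `W`, by which all Koszul signs are
expressed, and `εV` the corresponding involution of `V`. -/
structure Contraction (k : Type*) [CommRing k] (W V : Type*) [AddCommGroup W] [Module k W]
    [AddCommGroup V] [Module k V] where
  /-- the differential -/
  d : W →ₗ[k] W
  /-- the product -/
  mul : W →ₗ[k] W →ₗ[k] W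
  /-- the unit -/
  one : W
  /-- the sign involution of `W` -/
  ε : W →ₗ[k] W
  /-- the sign involution of `V` -/
  εV : V →ₗ[k] V
  /-- the inclusion -/
  i : V →ₗ[k] W
  /-- the projection -/
  P : W →ₗ[k] V
  /-- the homotopy -/
  Q : W →ₗ[k] W
  d_d : ∀ x, d (d x) = 0
  mul_assoc : ∀ x y z, mul (mul x y) z = mul x (mul y z)
  one_mul : ∀ x, mul one x = x
  mul_one : ∀ x, mul x one = x
  leibniz : ∀ x y, d (mul x y) = mul (d x) y + mul (ε x) (d y)
  ε_ε : ∀ x, ε (ε x) = x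
  ε_mul : ∀ x y, ε (mul x y) = mul (ε x) (ε y)
  ε_d : ∀ x, ε (d x) = -d (ε x)
  ε_Q : ∀ x, ε (Q x) = -Q (ε x)
  ε_one : ε one = one
  ε_i : ∀ v, ε (i v) = i (εV v)
  P_i : ∀ v, P (i v) = v
  i_P : ∀ x, i (P x) = x - d (Q x) - Q (d x)
  Q_i : ∀ v, Q (i v) = 0
  Q_Q : ∀ x, Q (Q x) = 0
  P_Q : ∀ x, P (Q x) = 0
  d_i : ∀ v, d (i v) = 0
  P_d : ∀ x, P (d x) = 0

namespace Contraction

variable {k : Type*} [CommRing k] {W V : Type*} [AddCommGroup W] [Module k W]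
  [AddCommGroup V] [Module k V] (C : Contraction k W V)

/-- The inclusion of `V`, as a function of lists supported on lists of length one. -/
def base : List V → W
  | [x] => C.i x
  | _ => 0

/-- The convolution product of two functions of lists with values in `W`. -/
def conv (F G : List V → W) (l : List V) : W := splitSum (fun u v => C.mul (F u) (G v)) l

/-- The approximations to the twisting function `tau`, exact on lists of length at most `N`. -/
def tauAux : ℕ → List V → W
  | 0, _ => 0
  | N + 1, l => C.base l + C.Q (C.conv (fun u => C.ε (tauAux N u)) (tauAux N) l)

/-- The twisting function `τ` of the transferred structure: its components are, up to sign, the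
components of the `A_∞`-morphism `V → W`. It solves `τ = i + Q (ετ * τ)`. -/
def tau (l : List V) : W := C.tauAux l.length l

lemma tauAux_nil (N : ℕ) : C.tauAux N [] = 0 := by
  induction N with
  | zero => rfl
  | succ N ih => simp [tauAux, base, conv, splitSum, ih]

lemma conv_congr {F F' G G' : List V → W} {l : List V} (hF : F [] = 0) (hF' : F' [] = 0)
    (hG : G [] = 0) (hG' : G' [] = 0) (h : ∀ m, m.length < l.length → F m = F' m)
    (h' : ∀ m, m.length < l.length → G m = G' m) : C.conv F G l = C.conv F' G' l := by
  refine splitSum_congr fun u v huv => ?_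
  have hl : u.length + v.length = l.length := by rw [← huv, List.length_append]
  rcases u.length.eq_zero_or_pos with hu | hu
  · rw [List.length_eq_zero_iff.1 hu, hF, hF', map_zero, LinearMap.zero_apply, LinearMap.zero_apply]
  rcases v.length.eq_zero_or_pos with hv | hv
  · rw [List.length_eq_zero_iff.1 hv, hG, hG', map_zero, map_zero]
  rw [h u (by omega), h' v (by omega)]

lemma tauAux_eq (N M : ℕ) (l : List V) (hN : l.length ≤ N) (hM : l.length ≤ M) :
    C.tauAux N l = C.tauAux M l := by
  induction N generalizing M l with
  | zero =>
    obtain rfl : l = [] := List.length_eq_zero_iff.1 (by omega)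
    rw [tauAux_nil, tauAux_nil]
  | succ N ih =>
    cases M with
    | zero =>
      obtain rfl : l = [] := List.length_eq_zero_iff.1 (by omega)
      rw [tauAux_nil, tauAux_nil]
    | succ M =>
      rw [tauAux, tauAux]
      congr 2
      apply C.conv_congr
      · rw [tauAux_nil, map_zero]
      · rw [tauAux_nil, map_zero]
      · rw [tauAux_nil]
      · rw [tauAux_nil]
      · intro m hm
        rw [ih M m (by omega) (by omega)]
      · intro m hm
        rw [ih M m (by omega) (by omega)]

lemma tau_nil : C.tau [] = 0 := rfl

/-- The defect `ετ * τ` whose image under `Q` and `-P` gives the next components of `τ` and of the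
transferred operations. -/
def defect (l : List V) : W := C.conv (fun u => C.ε (C.tau u)) C.tau l

lemma tau_eq (l : List V) : C.tau l = C.base l + C.Q (C.defect l) := by
  cases l with
  | nil => simp [tau_nil, base, defect, conv, splitSum]
  | cons x l =>
    rw [tau, List.length_cons, tauAux, defect]
    congr 2
    apply C.conv_congr
    · rw [tauAux_nil, map_zero]
    · rw [tau_nil, map_zero]
    · rw [tauAux_nil]
    · rw [tau_nil]
    · intro m hm
      rw [tau, C.tauAux_eq l.length m.length m (by simpa using Nat.lt_succ_iff.1 hm) le_rfl]
    · intro m hm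
      rw [tau, C.tauAux_eq l.length m.length m (by simpa using Nat.lt_succ_iff.1 hm) le_rfl]

lemma defect_singleton (x : V) : C.defect [x] = 0 := by
  simp [defect, conv, splitSum, tau_nil]

lemma tau_singleton (x : V) : C.tau [x] = C.i x := by
  rw [tau_eq, defect_singleton, map_zero, add_zero, base]

lemma tau_cons_cons (x y : V) (l : List V) :
    C.tau (x :: y :: l) = C.Q (C.defect (x :: y :: l)) := by
  rw [tau_eq, base, zero_add]
  simp

/-- The transferred operations on the suspension of `V`, as a function of lists. -/
def beta (l : List V) : V := -C.P (C.defect l)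

lemma beta_nil : C.beta [] = 0 := by simp [beta, defect, conv, splitSum, tau_nil]

lemma beta_singleton (x : V) : C.beta [x] = 0 := by rw [beta, defect_singleton, map_zero, neg_zero]

lemma Q_tau (l : List V) : C.Q (C.tau l) = 0 := by
  match l with
  | [] => rw [tau_nil, map_zero]
  | [x] => rw [tau_singleton, Q_i]
  | x :: y :: l => rw [tau_cons_cons, Q_Q]

lemma P_tau (x y : V) (l : List V) : C.P (C.tau (x :: y :: l)) = 0 := by
  rw [tau_cons_cons, P_Q]

/-- The sign involution of the suspension of `V`. -/
def σ : V →ₗ[k] V := -C.εV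

lemma εV_εV (v : V) : C.εV (C.εV v) = v := by
  rw [← C.P_i (C.εV (C.εV v)), ← C.ε_i, ← C.ε_i, C.ε_ε, C.P_i]

lemma σ_σ (v : V) : C.σ (C.σ v) = v := by simp [σ, εV_εV]

lemma map_σ_map_σ (l : List V) : (l.map C.σ).map C.σ = l := by
  rw [List.map_map]
  convert List.map_id l
  funext v
  exact C.σ_σ v

lemma ε_tau (l : List V) : C.ε (C.tau l) = -C.tau (l.map C.σ) := by
  induction hn : l.length using Nat.strong_induction_on generalizing l with
  | _ n ih =>
    subst hn
    match l with
    | [] => simp [tau_nil]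
    | [x] =>
      rw [List.map_cons, List.map_nil, tau_singleton, tau_singleton, ε_i, σ]
      simp
    | x :: y :: l =>
      rw [List.map_cons, List.map_cons, tau_cons_cons, tau_cons_cons, ε_Q]
      congr 2
      rw [← List.map_cons, ← List.map_cons]
      have h : C.ε (C.defect (x :: y :: l)) =
          C.conv (fun u => C.ε (C.ε (C.tau u))) (fun u => C.ε (C.tau u)) (x :: y :: l) :=
        (map_splitSum C.ε.toAddMonoidHom _ _).trans (splitSum_congr fun _ _ _ => C.ε_mul _ _)
      rw [h, C.conv_congr (F' := fun u => -C.ε (C.tau (u.map C.σ)))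
        (G' := fun u => -C.tau (u.map C.σ)) (by simp [tau_nil]) (by simp [tau_nil])
        (by simp [tau_nil]) (by simp [tau_nil])
        (fun m hm => by rw [ih _ hm m rfl, map_neg]) (fun m hm => ih _ hm m rfl), defect, conv,
        conv, splitSum_map]
      simp

/-- The multiplicative form of the differential of the convolution algebra. -/
lemma d_conv (F G : List V → W) (l : List V) :
    C.d (C.conv F G l) =
      C.conv (fun u => C.d (F u)) G l + C.conv (fun u => C.ε (F u)) (fun u => C.d (G u)) l := by
  rw [conv, conv, conv, ← splitSum_add]
  exact (map_splitSum C.d.toAddMonoidHom _ _).trans (splitSum_congr fun _ _ _ => C.leibniz _ _)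

lemma ε_conv (F G : List V → W) (l : List V) :
    C.ε (C.conv F G l) = C.conv (fun u => C.ε (F u)) (fun u => C.ε (G u)) l :=
  (map_splitSum C.ε.toAddMonoidHom _ _).trans (splitSum_congr fun _ _ _ => C.ε_mul _ _)

lemma conv_conv (F G H : List V → W) (l : List V) :
    C.conv (C.conv F G) H l = C.conv F (C.conv G H) l := by
  have h₁ : ∀ u v, C.mul (C.conv F G u) (H v) =
      splitSum (fun u₁ u₂ => C.mul (F u₁) (C.mul (G u₂) (H v))) u := fun u v =>
    (map_splitSum (C.mul.flip (H v)).toAddMonoidHom _ _).trans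
      (splitSum_congr fun _ _ _ => C.mul_assoc _ _ _)
  have h₂ : ∀ u v, C.mul (F u) (C.conv G H v) =
      splitSum (fun v₁ v₂ => C.mul (F u) (C.mul (G v₁) (H v₂))) v := fun u v =>
    map_splitSum (C.mul (F u)).toAddMonoidHom _ _
  rw [conv, conv]
  simp only [h₁, h₂]
  exact (splitSum_splitSum (fun u v w => C.mul (F u) (C.mul (G v) (H w))) l).symm

lemma conv_add_left (F F' G : List V → W) (l : List V) :
    C.conv (fun u => F u + F' u) G l = C.conv F G l + C.conv F' G l := by
  simp only [conv, map_add, LinearMap.add_apply, splitSum_add]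

lemma conv_add_right (F G G' : List V → W) (l : List V) :
    C.conv F (fun u => G u + G' u) l = C.conv F G l + C.conv F G' l := by
  simp only [conv, map_add, splitSum_add]

lemma conv_neg_left (F G : List V → W) (l : List V) :
    C.conv (fun u => -F u) G l = -C.conv F G l := by
  simp only [conv, map_neg, LinearMap.neg_apply, splitSum_neg]

/-- The operator `F ↦ F ∘ b`, for the coderivation `b` with components `beta`. -/
def bar {U : Type*} [AddCommGroup U] (F : List V → U) (l : List V) : U := coder C.σ C.beta F l

/-- The failure of `τ` to be a twisting function, i.e. to satisfy
`τ ∘ b = d ∘ τ - ετ * τ`. -/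
def curvature (l : List V) : W := C.d (C.tau l) - C.defect l - C.bar C.tau l

lemma bar_conv (F G : List V → W) (l : List V) :
    C.bar (C.conv F G) l =
      C.conv (fun u => F (u.map C.σ)) (C.bar G) l + C.conv (C.bar F) G l :=
  coder_conv _ _ _ _ _ _

lemma map_bar {U U' : Type*} [AddCommGroup U] [AddCommGroup U'] (g : U →+ U') (F : List V → U)
    (l : List V) : g (C.bar F l) = C.bar (fun m => g (F m)) l :=
  map_coder _ _ g F l

lemma d_defect (l : List V) :
    C.d (C.defect l) = C.conv C.tau (fun u => C.d (C.tau u)) l -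
      C.conv (fun u => C.ε (C.d (C.tau u))) C.tau l := by
  have h : C.defect l = C.conv (fun u => C.ε (C.tau u)) C.tau l := rfl
  rw [h, d_conv]
  simp only [ε_ε, ε_d, conv_neg_left]
  abel

lemma bar_defect (l : List V) :
    C.bar C.defect l = C.conv (fun u => C.ε (C.bar C.tau u)) C.tau l -
      C.conv C.tau (C.bar C.tau) l := by
  have h : C.defect = C.conv (fun u => C.ε (C.tau u)) C.tau := rfl
  have h₁ : (fun u => C.ε (C.bar C.tau u)) = C.bar (fun u => C.ε (C.tau u)) :=
    funext fun u => C.map_bar C.ε.toAddMonoidHom C.tau u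
  rw [h, bar_conv, h₁]
  simp only [ε_tau, map_σ_map_σ, conv_neg_left]
  abel

/-- The Bianchi identity. -/
lemma d_curvature (l : List V) :
    C.d (C.curvature l) = C.conv (fun u => C.ε (C.curvature u)) C.tau l -
      C.conv C.tau C.curvature l - C.bar C.curvature l - C.bar (C.bar C.tau) l := by
  have hc : ∀ u, C.d (C.tau u) = C.curvature u + C.defect u + C.bar C.tau u := fun u => by
    rw [curvature]; abel
  have h₁ : C.d (C.bar C.tau l) = C.bar C.curvature l + C.bar C.defect l +
      C.bar (C.bar C.tau) l := by
    refine (C.map_bar C.d.toAddMonoidHom C.tau l).trans ?_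
    simp only [LinearMap.toAddMonoidHom_coe, hc]
    rw [bar, coder_add, coder_add]
    rfl
  have h₂ : C.conv (fun u => C.ε (C.defect u)) C.tau l = C.conv C.tau C.defect l := by
    have e₁ : (fun u => C.ε (C.defect u)) = C.conv C.tau (fun u => C.ε (C.tau u)) := by
      funext u
      refine (C.ε_conv _ _ u).trans ?_
      simp only [ε_ε]
    rw [e₁, conv_conv]
    rfl
  have h₃ : C.d (C.defect l) = C.conv C.tau C.curvature l + C.conv C.tau (C.bar C.tau) l -
      C.conv (fun u => C.ε (C.curvature u)) C.tau l -
      C.conv (fun u => C.ε (C.bar C.tau u)) C.tau l := by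
    rw [d_defect]
    simp only [hc, map_add, conv_add_left, conv_add_right, h₂]
    abel
  rw [curvature, map_sub, map_sub, d_d, h₁, h₃, bar_defect]
  abel

lemma P_bar_tau (l : List V) : C.P (C.bar C.tau l) = C.beta l := by
  refine (C.map_bar C.P.toAddMonoidHom C.tau l).trans ?_
  refine coder_of_forall_ne (g := fun x => x) _ _ (fun x => ?_) (fun x y l => ?_)
    (fun x => C.beta_singleton x) C.beta_nil l
  · rw [LinearMap.toAddMonoidHom_coe, tau_singleton, P_i]
  · rw [LinearMap.toAddMonoidHom_coe, P_tau]

lemma P_curvature (l : List V) : C.P (C.curvature l) = 0 := by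
  rw [curvature, map_sub, map_sub, P_d, P_bar_tau, beta]
  abel

lemma Q_bar_tau (l : List V) : C.Q (C.bar C.tau l) = 0 := by
  refine (C.map_bar C.Q.toAddMonoidHom C.tau l).trans (coder_eq_zero _ _ fun m _ _ => ?_)
  exact C.Q_tau m

lemma Q_d_tau (l : List V) : C.Q (C.d (C.tau l)) = C.Q (C.defect l) := by
  have h := C.i_P (C.defect l)
  match l with
  | [] => simp [tau_nil, defect, conv, splitSum]
  | [x] => rw [tau_singleton, d_i, defect_singleton]
  | x :: y :: l =>
    rw [tau_cons_cons]
    have h' := congrArg C.Q h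
    rw [Q_i, map_sub, map_sub, Q_Q, sub_zero, eq_comm, sub_eq_zero] at h'
    exact h'.symm

lemma Q_curvature (l : List V) : C.Q (C.curvature l) = 0 := by
  rw [curvature, map_sub, map_sub, Q_bar_tau, Q_d_tau, sub_self, sub_zero]

/-- The curvature vanishes: it lies in the image of `Q ∘ d`, and by the Bianchi identity `Q (d X)`
is determined by the values of `X` on shorter lists. -/
lemma curvature_eq_zero (l : List V) : C.curvature l = 0 := by
  induction hn : l.length using Nat.strong_induction_on generalizing l with
  | _ n ih =>
    subst hn
    -- as `P X = 0` and `Q X = 0`, the contraction gives `X = Q (d X)` for the curvature `X`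
    have h := C.i_P (C.curvature l)
    rw [P_curvature, map_zero, Q_curvature, map_zero, sub_zero, eq_comm, sub_eq_zero] at h
    have hnil : C.curvature [] = 0 := by
      simp [curvature, tau_nil, defect, conv, splitSum, bar, coder]
    -- since `τ [] = 0`, the Bianchi identity involves `X` only on lists shorter than `l`
    have h₁ : C.conv (fun u => C.ε (C.curvature u)) C.tau l = 0 := by
      rw [C.conv_congr (F' := fun _ => 0) (G' := C.tau) (by simp [hnil]) rfl C.tau_nil C.tau_nil
        (fun m hm => by rw [ih _ hm m rfl, map_zero]) (fun _ _ => rfl)]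
      simp [conv, splitSum_zero]
    have h₂ : C.conv C.tau C.curvature l = 0 := by
      rw [C.conv_congr (F' := C.tau) (G' := fun _ => 0) C.tau_nil C.tau_nil (by simp [hnil]) rfl
        (fun _ _ => rfl) (fun m hm => ih _ hm m rfl)]
      simp [conv, splitSum_zero]
    have h₃ : C.bar C.curvature l = 0 := coder_eq_zero _ _ fun m hm _ => ih _ hm m rfl
    have h₄ : C.Q (C.bar (C.bar C.tau) l) = 0 := by
      refine (C.map_bar C.Q.toAddMonoidHom _ l).trans (coder_eq_zero _ _ fun m _ _ => ?_)
      exact C.Q_bar_tau m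
    rw [h, d_curvature, h₁, h₂, h₃, sub_zero, sub_zero, zero_sub, map_neg, h₄, neg_zero]

/-- The identities of an `A_∞`-morphism, in suspended form. -/
lemma bar_tau (l : List V) : C.bar C.tau l = C.d (C.tau l) - C.defect l :=
  (sub_eq_zero.1 (C.curvature_eq_zero l)).symm

/-- The Stasheff identities, in suspended form. -/
lemma bar_beta (l : List V) : C.bar C.beta l = 0 := by
  have hc : C.curvature = fun _ => 0 := funext C.curvature_eq_zero
  have h := C.d_curvature l
  rw [hc] at h
  have h₃ : C.bar (fun _ => (0 : W)) l = 0 := coder_eq_zero _ _ fun _ _ _ => rfl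
  have h' : C.bar (C.bar C.tau) l = 0 := by
    simpa [conv, splitSum_zero, h₃] using h
  have h'' := (C.map_bar C.P.toAddMonoidHom (C.bar C.tau) l).symm.trans
    (by rw [h', map_zero])
  simpa only [LinearMap.toAddMonoidHom_coe, P_bar_tau] using h''

/-! ### Units -/

lemma P_tau_of_two_le (l : List V) (hl : 2 ≤ l.length) : C.P (C.tau l) = 0 := by
  match l, hl with
  | x :: y :: l, _ => exact C.P_tau x y l

/-- If the unit is an entry of `l`, then only the decompositions that split off the unit at one end
of `l` contribute to the defect. -/
lemma map_defect_eq_zero_of_unit {U : Type*} [AddCommGroup U] [Module k U] (g : W →ₗ[k] U) {e : V}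
    (he : C.i e = C.one) {l : List V} (hl : e ∈ l)
    (hτ : ∀ m, e ∈ m → 2 ≤ m.length → m.length < l.length → C.tau m = 0)
    (hg : ∀ m, m.length + 1 = l.length → g (C.tau m) = 0) : g (C.defect l) = 0 := by
  refine (map_splitSum g.toAddMonoidHom _ _).trans (splitSum_eq_zero fun u v huv => ?_)
  rw [LinearMap.toAddMonoidHom_coe]
  beta_reduce
  rw [← huv, List.mem_append] at hl
  have hlen : u.length + v.length = l.length := by
    rw [← huv, List.length_append]
  rcases u.length.eq_zero_or_pos with hu | hu
  · simp [List.length_eq_zero_iff.1 hu, tau_nil]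
  rcases v.length.eq_zero_or_pos with hv | hv
  · simp [List.length_eq_zero_iff.1 hv, tau_nil]
  rcases hl with hl | hl
  · rcases Nat.lt_or_ge 1 u.length with hu' | hu'
    · rw [hτ u hl hu' (by omega)]; simp
    · obtain ⟨a, rfl⟩ := List.length_eq_one_iff.1 (le_antisymm hu' hu)
      obtain rfl := List.mem_singleton.1 hl
      rw [tau_singleton, he, ε_one, one_mul, hg _ (by simpa [add_comm] using hlen)]
  · rcases Nat.lt_or_ge 1 v.length with hv' | hv'
    · rw [hτ v hl hv' (by omega)]; simp
    · obtain ⟨a, rfl⟩ := List.length_eq_one_iff.1 (le_antisymm hv' hv)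
      obtain rfl := List.mem_singleton.1 hl
      rw [tau_singleton, he, mul_one, ε_tau, map_neg, hg _ (by simpa using hlen), neg_zero]

lemma tau_eq_zero_of_unit {e : V} (he : C.i e = C.one) (l : List V) (hl : e ∈ l)
    (hl' : 2 ≤ l.length) : C.tau l = 0 := by
  induction hn : l.length using Nat.strong_induction_on generalizing l with
  | _ n ih =>
    subst hn
    match l, hl' with
    | x :: y :: l, _ =>
      rw [tau_cons_cons]
      exact C.map_defect_eq_zero_of_unit C.Q he hl (fun m h₁ h₂ h₃ => ih _ h₃ m h₁ h₂ rfl)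
        fun m _ => C.Q_tau m

lemma beta_eq_zero_of_unit {e : V} (he : C.i e = C.one) (l : List V) (hl : e ∈ l)
    (hl' : 3 ≤ l.length) : C.beta l = 0 := by
  rw [beta, C.map_defect_eq_zero_of_unit C.P he hl
    (fun m h₁ h₂ _ => C.tau_eq_zero_of_unit he m h₁ h₂)
    fun m hm => C.P_tau_of_two_le m (by omega), neg_zero]

lemma beta_pair (x y : V) : C.beta [x, y] = -C.P (C.mul (C.ε (C.i x)) (C.i y)) := by
  simp [beta, defect, conv, splitSum, tau_nil, tau_singleton]

lemma beta_unit_left {e : V} (he : C.i e = C.one) (x : V) : C.beta [e, x] = -x := by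
  rw [beta_pair, he, ε_one, one_mul, P_i]

lemma beta_unit_right {e : V} (he : C.i e = C.one) (x : V) : C.beta [x, e] = -C.εV x := by
  rw [beta_pair, he, mul_one, ε_i, P_i]

/-! ### Multilinearity -/

lemma isMultilinear_base : IsMultilinear k C.base := by
  constructor
  · intro u v x y
    match u, v with
    | [], [] => simp [base]
    | [], a :: v => simp [base]
    | [a], v => simp [base]
    | a :: b :: u, v => simp [base]
  · intro u v c x
    match u, v with
    | [], [] => simp [base]
    | [], a :: v => simp [base]
    | [a], v => simp [base]
    | a :: b :: u, v => simp [base]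

lemma isMultilinear_conv {F G : List V → W} (hF : IsMultilinear k F) (hG : IsMultilinear k G) :
    IsMultilinear k (C.conv F G) :=
  IsMultilinear.splitSum (Φ := fun u v => C.mul (F u) (G v))
    (fun v => hF.comp (C.mul.flip (G v))) (fun u => hG.comp (C.mul (F u)))

lemma isMultilinear_tauAux (N : ℕ) : IsMultilinear k (C.tauAux N) := by
  induction N with
  | zero => exact ⟨fun _ _ _ _ => (add_zero _).symm, fun _ _ _ _ => (smul_zero _).symm⟩
  | succ N ih =>
    have h := (C.isMultilinear_conv (ih.comp C.ε) ih).comp C.Q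
    have h' := C.isMultilinear_base
    constructor
    · intro u v x y
      simp only [tauAux, h.map_add, h'.map_add]
      abel
    · intro u v c x
      simp only [tauAux, h.map_smul, h'.map_smul, smul_add]

lemma isMultilinear_tau : IsMultilinear k C.tau := by
  have h : ∀ (u v : List V) (x : V), C.tau (u ++ x :: v) =
      C.tauAux (u.length + (v.length + 1)) (u ++ x :: v) := fun u v x =>
    C.tauAux_eq _ _ _ le_rfl (by simp)
  constructor
  · intro u v x y
    rw [h, h, h, (C.isMultilinear_tauAux _).map_add]
  · intro u v c x
    rw [h, h, (C.isMultilinear_tauAux _).map_smul]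

lemma isMultilinear_defect : IsMultilinear k C.defect :=
  C.isMultilinear_conv (C.isMultilinear_tau.comp C.ε) C.isMultilinear_tau

lemma isMultilinear_beta : IsMultilinear k C.beta :=
  C.isMultilinear_defect.comp (-C.P)

end Contraction

end AInf

/-! ### Desuspension -/

namespace AInf

open ListCalculus

section Seq

variable {V W : Type*}

/-- The list `x 0, …, x (n - 1)`. -/
def seq (n : ℕ) (x : ℕ → V) : List V := List.ofFn (fun i : Fin n => x i)

lemma seq_zero (x : ℕ → V) : seq 0 x = [] := rfl

lemma seq_succ (n : ℕ) (x : ℕ → V) : seq (n + 1) x = x 0 :: seq n (fun j => x (j + 1)) := by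
  simp [seq, List.ofFn_succ]

lemma length_seq (n : ℕ) (x : ℕ → V) : (seq n x).length = n := List.length_ofFn

lemma seq_eq_nil (n : ℕ) (x : ℕ → V) : seq n x = [] ↔ n = 0 := by
  rw [← List.length_eq_zero_iff, length_seq]

lemma splitSum_seq [AddCommGroup W] (Φ : List V → List V → W) (n : ℕ) (x : ℕ → V) :
    splitSum Φ (seq n x) =
      ∑ i ∈ Finset.range (n + 1), Φ (seq i x) (seq (n - i) (fun j => x (i + j))) := by
  induction n generalizing Φ x with
  | zero => simp [seq_zero, splitSum]
  | succ n ih =>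
    rw [seq_succ, splitSum, ih, Finset.sum_range_succ' _ (n + 1), add_comm, ← seq_succ]
    congr 1
    · refine Finset.sum_congr rfl fun i _ => ?_
      rw [seq_succ, Nat.add_sub_add_right]
      congr 2
      funext j
      congr 1
      omega
    · simp [seq_zero]

lemma coder_seq [AddCommGroup W] (σ : V → V) (β : List V → V) (F : List V → W) (n : ℕ)
    (x : ℕ → V) :
    coder σ β F (seq n x) = ∑ r ∈ Finset.range n, ∑ s ∈ Finset.Icc 1 (n - r),
      if s = 1 then 0 else
        F (seq (r + 1 + (n - r - s)) (graft (fun l => if l < r then σ (x l) else x l) r s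
          (β (seq s (fun j => x (r + j)))))) := by
  induction n generalizing F x with
  | zero => simp [seq_zero, coder]
  | succ n ih =>
    rw [seq_succ, coder, ih, Finset.sum_range_succ' _ n]
    congr 1
    · refine Finset.sum_congr rfl fun r _ => ?_
      rw [Nat.add_sub_add_right]
      refine Finset.sum_congr rfl fun s hs => ?_
      obtain ⟨hs, -⟩ := Finset.mem_Icc.1 hs
      have e : r + 1 + 1 + (n - r - s) = r + 1 + (n - r - s) + 1 := by omega
      have e₀ : ∀ y, graft (fun l => if l < r + 1 then σ (x l) else x l) (r + 1) s y 0 =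
          σ (x 0) := fun y => by simp [graft]
      have e₁ : ∀ y, (fun j => graft (fun l => if l < r + 1 then σ (x l) else x l) (r + 1) s y
          (j + 1)) = graft (fun l => if l < r then σ (x (l + 1)) else x (l + 1)) r s y :=
        fun y => by
        funext j
        simp only [graft, Nat.add_lt_add_iff_right, Nat.add_right_cancel_iff]
        have e₂ : ¬ j < r → j ≠ r → j + 1 + s - 1 = j + s - 1 + 1 ∧ ¬ j + s - 1 < r := by omega
        by_cases h₁ : j < r
        · simp [h₁]
        · by_cases h₂ : j = r
          · simp [h₂]
          · obtain ⟨h₃, h₄⟩ := e₂ h₁ h₂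
            simp [h₁, h₂, h₃, h₄]
      have e' : (fun j => x (r + j + 1)) = fun j => x (r + 1 + j) := by
        funext j; congr 1; omega
      rw [e, seq_succ, e₀, e₁, e']
    · rw [splitSum_seq, Nat.sub_zero]
      refine Finset.sum_nbij' (· + 1) (· - 1) (by simp) (by simp) (by simp)
        (by simp +contextual) fun i _ => ?_
      have e : 0 + 1 + (n + 1 - (i + 1)) = (n - i) + 1 := by omega
      have e₁ : ∀ y, (fun j => graft (fun l => if l < 0 then σ (x l) else x l) 0 (i + 1) y
          (j + 1)) = fun j => x (i + j + 1) := fun y => by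
        funext j
        simp only [graft, Nat.not_lt_zero, if_false, Nat.add_one_ne_zero]
        congr 1
        omega
      simp only [seq_eq_nil, Nat.add_eq_right, zero_add]
      rw [Nat.add_comm 1, Nat.add_sub_add_right, seq_succ (n - i), e₁, seq_succ i]
      rfl

end Seq

section Signs

/-- The exponent `∑ (n - 1 - l) p l` of the sign that relates operations to their suspensions. -/
def weight (n : ℕ) (p : ℕ → ℤ) : ℤ := ∑ l ∈ Finset.range n, (n - 1 - l) * p l

lemma weight_succ (n : ℕ) (p : ℕ → ℤ) :
    weight (n + 1) p = weight n p + ∑ l ∈ Finset.range n, p l := by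
  rw [weight, weight, Finset.sum_range_succ, ← Finset.sum_add_distrib]
  push_cast
  rw [show ((n : ℤ) + 1 - 1 - n) * p n = 0 by ring, add_zero]
  exact Finset.sum_congr rfl fun l _ => by ring

lemma weight_congr {n : ℕ} {p q : ℕ → ℤ} (h : ∀ i < n, p i = q i) : weight n p = weight n q :=
  Finset.sum_congr rfl fun l hl => by rw [h l (Finset.mem_range.1 hl)]

lemma weight_add (r s : ℕ) (p : ℕ → ℤ) :
    weight (r + s) p =
      weight r p + s * ∑ l ∈ Finset.range r, p l + weight s (fun j => p (r + j)) := by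
  induction s with
  | zero => simp [weight]
  | succ s ih =>
    rw [← add_assoc, weight_succ, ih, weight_succ, Finset.sum_range_add]
    push_cast
    ring

lemma weight_graft (r s t : ℕ) (p : ℕ → ℤ) (q : ℤ) :
    weight (r + 1 + t) (graft p r s q) =
      weight r p + (1 + t) * ∑ l ∈ Finset.range r, p l + t * q +
        weight t (fun j => p (r + s + j)) := by
  have h₁ : ∀ i < r, graft p r s q i = p i := fun i hi => by simp [graft, hi]
  have h₂ : (fun j => (fun j => graft p r s q (r + j)) (1 + j)) = fun j => p (r + s + j) := by
    funext j
    have e₁ : ¬ r + (1 + j) < r := by omega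
    have e₂ : ¬ r + (1 + j) = r := by omega
    simp only [graft, e₁, e₂, if_false]
    congr 1
    omega
  rw [add_assoc, weight_add, weight_congr h₁, weight_add 1 t, h₂,
    Finset.sum_congr rfl fun i hi => h₁ i (Finset.mem_range.1 hi)]
  simp [weight, graft]
  ring

lemma negOnePow_eq_of_sub_eq {a b c : ℤ} (h : a - b = 2 * c) : a.negOnePow = b.negOnePow :=
  (Int.negOnePow_eq_iff _ _).2 ⟨c, by rw [h]; ring⟩

variable {k : Type*} [CommRing k] {V W : Type*} [AddCommGroup V] [Module k V] [AddCommGroup W]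
  [Module k W]

lemma map_units_smul' (g : V →ₗ[k] W) (c : ℤˣ) (x : V) : g (c • x) = c • g x := by
  rcases Int.units_eq_one_or c with rfl | rfl <;> simp

lemma units_smul_apply (g : V →ₗ[k] W) (c : ℤˣ) (x : V) : (c • g) x = c • g x := by
  rcases Int.units_eq_one_or c with rfl | rfl <;> simp

lemma _root_.ListCalculus.IsMultilinear.cons {F : List V → W} (hF : IsMultilinear k F) (x : V) :
    IsMultilinear k (fun l => F (x :: l)) :=
  ⟨fun u v => hF.map_add (x :: u) v, fun u v => hF.map_smul (x :: u) v⟩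

lemma map_seq_negOnePow {F : List V → W} (hF : IsMultilinear k F) (n : ℕ) (c : ℕ → ℤ)
    (x : ℕ → V) : F (seq n (fun l => (c l).negOnePow • x l)) =
      (∑ l ∈ Finset.range n, c l).negOnePow • F (seq n x) := by
  induction n generalizing F c x with
  | zero => simp [seq_zero]
  | succ n ih =>
    have h : ∀ (e : ℤˣ) y l, F (e • y :: l) = e • F (y :: l) := fun e y l => by
      rcases Int.units_eq_one_or e with rfl | rfl
      · rw [one_smul, one_smul]
      · have := hF.map_smul [] l (-1) y
        simpa using this
    rw [seq_succ, seq_succ, h, ih (hF.cons _), Finset.sum_range_succ', Int.negOnePow_add, smul_smul,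
      mul_comm]

lemma map_graft_negOnePow {F : List V → W} (hF : IsMultilinear k F) (r s t : ℕ) (c : ℕ → ℤ)
    (e : ℤ) (x : ℕ → V) (y : V) :
    F (seq (r + 1 + t) (graft (fun l => if l < r then (c l).negOnePow • x l else x l) r s
      (e.negOnePow • y))) =
      (∑ l ∈ Finset.range r, c l + e).negOnePow • F (seq (r + 1 + t) (graft x r s y)) := by
  have h : graft (fun l => if l < r then (c l).negOnePow • x l else x l) r s (e.negOnePow • y) =
      fun l => (if l < r then c l else if l = r then e else 0).negOnePow • graft x r s y l := by
    funext l
    rcases lt_trichotomy l r with h | h | h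
    · simp [graft, h]
    · simp [graft, h]
    · have h₁ : ¬ l < r := by omega
      have h₂ : ¬ l = r := by omega
      have h₃ : ¬ l + s - 1 < r := by omega
      simp [graft, h₁, h₂, h₃]
  rw [h, map_seq_negOnePow hF, Finset.sum_range_add, Finset.sum_range_succ]
  have h₁ : ∑ l ∈ Finset.range r, (if l < r then c l else if l = r then e else 0) =
      ∑ l ∈ Finset.range r, c l :=
    Finset.sum_congr rfl fun l hl => if_pos (Finset.mem_range.1 hl)
  have h₂ : ∑ l ∈ Finset.range t,
      (if r + 1 + l < r then c (r + 1 + l) else if r + 1 + l = r then e else 0) = 0 :=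
    Finset.sum_eq_zero fun l _ => by rw [if_neg (by omega), if_neg (by omega)]
  rw [h₁, h₂]
  simp

lemma graft_mem {𝒱 : ℤ → ℤ → Submodule k V} {r s : ℕ} {p a : ℕ → ℤ} {x : ℕ → V}
    (hx : ∀ i, x i ∈ 𝒱 (p i) (a i)) {q b : ℤ} {y : V} (hy : y ∈ 𝒱 q b) (i : ℕ) :
    graft x r s y i ∈ 𝒱 (graft p r s q i) (graft a r s b i) := by
  simp only [graft]
  split_ifs
  · exact hx i
  · exact hy
  · exact hx _

lemma negOnePow_smul_mem {S : Submodule k V} {x : V} (hx : x ∈ S) (e : ℤ) :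
    e.negOnePow • x ∈ S := by
  rcases Int.units_eq_one_or e.negOnePow with h | h <;> simpa [h] using hx

lemma map_seq_eq_zero {F : List V → W} (hF : IsMultilinear k F) {n : ℕ} {x : ℕ → V} {i : ℕ}
    (hi : i < n) (hx : x i = 0) : F (seq n x) = 0 := by
  induction n generalizing F x i with
  | zero => omega
  | succ n ih =>
    rw [seq_succ]
    cases i with
    | zero => simpa [hx] using hF.map_smul [] (seq n fun j => x (j + 1)) 0 0
    | succ i => exact ih (hF.cons _) (Nat.lt_of_succ_lt_succ hi) hx

end Signs

namespace Contraction

variable {k : Type*} [CommRing k] {W V : Type*} [AddCommGroup W] [Module k W]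
  [AddCommGroup V] [Module k V] (C : Contraction k W V)

/-- The maps of a contraction preserve given bigradings of `W` and `V`, up to the shift by `-1` of
the homotopy, and the sign involutions are the ones given by the first degree. -/
structure IsBigraded (𝒲 : ℤ → ℤ → Submodule k W) (𝒱 : ℤ → ℤ → Submodule k V) : Prop where
  mul_mem : ∀ {p s q t x y}, x ∈ 𝒲 p s → y ∈ 𝒲 q t → C.mul x y ∈ 𝒲 (p + q) (s + t)
  Q_mem : ∀ {p s x}, x ∈ 𝒲 p s → C.Q x ∈ 𝒲 (p - 1) s
  i_mem : ∀ {p s v}, v ∈ 𝒱 p s → C.i v ∈ 𝒲 p s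
  P_mem : ∀ {p s x}, x ∈ 𝒲 p s → C.P x ∈ 𝒱 p s
  ε_eq : ∀ {p s x}, x ∈ 𝒲 p s → C.ε x = p.negOnePow • x
  εV_eq : ∀ {p s v}, v ∈ 𝒱 p s → C.εV v = p.negOnePow • v

variable {C} {𝒲 : ℤ → ℤ → Submodule k W} {𝒱 : ℤ → ℤ → Submodule k V} (hC : C.IsBigraded 𝒲 𝒱)

include hC

lemma ε_mem {p s : ℤ} {x : W} (hx : x ∈ 𝒲 p s) : C.ε x ∈ 𝒲 p s := by
  rw [hC.ε_eq hx]
  exact negOnePow_smul_mem hx p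

lemma defect_mem_of_tau_mem (n : ℕ) (p a : ℕ → ℤ) (x : ℕ → V) (hx : ∀ i, x i ∈ 𝒱 (p i) (a i))
    (h : ∀ m < n, ∀ (p a : ℕ → ℤ) (x : ℕ → V), (∀ i, x i ∈ 𝒱 (p i) (a i)) →
      C.tau (seq m x) ∈ 𝒲 (∑ i ∈ Finset.range m, p i + 1 - m) (∑ i ∈ Finset.range m, a i)) :
    C.defect (seq n x) ∈ 𝒲 (∑ i ∈ Finset.range n, p i + 2 - n) (∑ i ∈ Finset.range n, a i) := by
  rw [defect, conv, splitSum_seq]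
  refine Submodule.sum_mem _ fun i hi => ?_
  have hi : i ≤ n := by simpa [Nat.lt_succ_iff] using hi
  rcases i.eq_zero_or_pos with rfl | hi₀
  · simp [seq_zero, tau_nil]
  rcases hi.eq_or_lt with rfl | hi'
  · simp [seq_zero, tau_nil]
  have h₁ := hC.mul_mem (ε_mem hC (h i hi' p a x hx))
    (h (n - i) (by omega) (fun j => p (i + j)) (fun j => a (i + j)) (fun j => x (i + j))
      fun j => hx _)
  rw [← Finset.sum_range_add, Nat.add_sub_cancel' hi] at h₁
  convert h₁ using 2
  rw [← Nat.add_sub_cancel' hi, Finset.sum_range_add, Nat.add_sub_cancel' hi]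
  push_cast [Nat.cast_sub hi]
  ring

lemma tau_mem (n : ℕ) (p a : ℕ → ℤ) (x : ℕ → V) (hx : ∀ i, x i ∈ 𝒱 (p i) (a i)) :
    C.tau (seq n x) ∈ 𝒲 (∑ i ∈ Finset.range n, p i + 1 - n) (∑ i ∈ Finset.range n, a i) := by
  induction n using Nat.strong_induction_on generalizing p a x with
  | _ n ih =>
    match n with
    | 0 => rw [seq_zero, tau_nil]; exact zero_mem _
    | 1 =>
      rw [seq_succ, seq_zero, tau_singleton]
      simpa using hC.i_mem (hx 0)
    | n + 2 =>
      have h := hC.Q_mem (defect_mem_of_tau_mem hC (n + 2) p a x hx ih)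
      rw [seq_succ, seq_succ] at h ⊢
      rw [tau_cons_cons]
      convert h using 2
      ring

lemma beta_mem (n : ℕ) (p a : ℕ → ℤ) (x : ℕ → V) (hx : ∀ i, x i ∈ 𝒱 (p i) (a i)) :
    C.beta (seq n x) ∈ 𝒱 (∑ i ∈ Finset.range n, p i + 2 - n) (∑ i ∈ Finset.range n, a i) :=
  Submodule.neg_mem _ (hC.P_mem (defect_mem_of_tau_mem hC n p a x hx fun m _ => tau_mem hC m))

omit hC

variable (C) in
/-- The multilinear map `(x 0, …, x (n - 1)) ↦ ± F [x 0, …, x (n - 1)]`, with the sign of the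
desuspension: `(-1)^{n + 1 + ∑ (n - 1 - l) p l}` on elements of degrees `p l`. -/
def desuspend {U : Type*} [AddCommGroup U] [Module k U] {F : List V → U} (hF : IsMultilinear k F)
    (n : ℕ) : MultilinearMap k (fun _ : Fin n => V) U :=
  (-1 : k) ^ (n + 1) •
    (hF.toMultilinearMap n).compLinearMap (fun l : Fin n => C.εV ^ (n - 1 - (l : ℕ)))

include hC

lemma εV_pow_eq {p s : ℤ} {v : V} (hv : v ∈ 𝒱 p s) (j : ℕ) :
    (C.εV ^ j) v = ((j : ℤ) * p).negOnePow • v := by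
  induction j with
  | zero => simp
  | succ j ih =>
    rw [pow_succ', Module.End.mul_apply, ih, map_units_smul', hC.εV_eq hv, smul_smul,
      ← Int.negOnePow_add]
    congr 2
    push_cast
    ring

lemma desuspend_apply {U : Type*} [AddCommGroup U] [Module k U] {F : List V → U}
    (hF : IsMultilinear k F) (n : ℕ) (p a : ℕ → ℤ) (x : ℕ → V) (hx : ∀ i, x i ∈ 𝒱 (p i) (a i)) :
    C.desuspend hF n (fun i => x i) = (n + 1 + weight n p).negOnePow • F (seq n x) := by
  have h : List.ofFn (fun l : Fin n => (C.εV ^ (n - 1 - (l : ℕ))) (x l)) =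
      seq n (fun l => (((n - 1 - l : ℕ) : ℤ) * p l).negOnePow • x l) := by
    rw [seq]
    congr 1
    funext l
    exact εV_pow_eq hC (hx l) _
  have hw : ∑ l ∈ Finset.range n, ((n - 1 - l : ℕ) : ℤ) * p l = weight n p :=
    Finset.sum_congr rfl fun l hl => by
      have := Finset.mem_range.1 hl
      rw [Nat.cast_sub (by omega), Nat.cast_sub (by omega), Nat.cast_one]
  rw [desuspend, smul_apply, MultilinearMap.compLinearMap_apply,
    IsMultilinear.toMultilinearMap_apply, h, map_seq_negOnePow hF, hw, Int.negOnePow_add,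
    mul_smul]
  generalize (weight n p).negOnePow • F (seq n x) = y
  have := Int.cast_negOnePow_natCast k (n + 1)
  rw [← this]
  rw [Units.smul_def, ← Int.cast_smul_eq_zsmul k]
  push_cast
  rfl

/-- The left-hand sides of the Stasheff and morphism identities, in terms of suspensions. -/
lemma sum_desuspend {U : Type*} [AddCommGroup U] [Module k U] {F : List V → U}
    (hF : IsMultilinear k F) (n : ℕ) (p a : ℕ → ℤ) (x : ℕ → V) (hx : ∀ i, x i ∈ 𝒱 (p i) (a i)) :
    ∑ r ∈ Finset.range n, ∑ s ∈ Finset.Icc 1 (n - r),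
      Int.negOnePow ((r : ℤ) + s * (n - r - s : ℕ) + s * ∑ l ∈ Finset.range r, p l) •
        C.desuspend hF (r + 1 + (n - r - s))
          (fun i => graft x r s (C.desuspend C.isMultilinear_beta s (fun j => x (r + j))) i) =
    (n + 1 + weight n p).negOnePow • C.bar F (seq n x) := by
  rw [bar, coder_seq, Finset.smul_sum]
  refine Finset.sum_congr rfl fun r hr => ?_
  rw [Finset.smul_sum]
  refine Finset.sum_congr rfl fun s hs => ?_
  obtain ⟨hs₁, hs₂⟩ := Finset.mem_Icc.1 hs
  have hr := Finset.mem_range.1 hr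
  obtain ⟨t, ht⟩ : ∃ t, n - r - s = t := ⟨_, rfl⟩
  obtain rfl : n = r + (s + t) := by omega
  rw [ht]
  have hx' : ∀ j, (fun j => x (r + j)) j ∈ 𝒱 (p (r + j)) (a (r + j)) := fun j => hx _
  have hβ := beta_mem hC s _ _ _ hx'
  have hm := desuspend_apply hC C.isMultilinear_beta s _ _ _ hx'
  rw [hm, desuspend_apply hC hF (r + 1 + t) _ _ _
    (fun i => graft_mem hx (negOnePow_smul_mem hβ _) i),
    weight_graft]
  -- the signs of `σ` on the first `r` entries and of the inner operation are moved outside of `F`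
  have hσ : (fun l => if l < r then C.σ (x l) else x l) =
      fun l => if l < r then (p l - 1).negOnePow • x l else x l := by
    funext l
    congr 1
    rw [σ, LinearMap.neg_apply, hC.εV_eq (hx l), Int.negOnePow_sub]
    simp
  have e₁ := map_graft_negOnePow hF r s t (fun _ => 0) ((s : ℤ) + 1 + weight s fun j => p (r + j)) x
    (C.beta (seq s fun j => x (r + j)))
  have e₂ := map_graft_negOnePow hF r s t (fun l => p l - 1) 0 x
    (C.beta (seq s fun j => x (r + j)))
  simp only [Int.negOnePow_zero, one_smul, ite_self] at e₁ e₂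
  rw [e₁, hσ, e₂]
  split_ifs with h
  -- the terms with inner operation `m_1 = 0`, which do not occur in the coderivation
  · subst h
    have h0 : F (seq (r + 1 + t) (graft x r 1 (C.beta (seq 1 fun j => x (r + j))))) = 0 :=
      map_seq_eq_zero hF (i := r) (by omega) (by simp [graft, seq_succ, seq_zero, beta_singleton])
    rw [h0]
    simp
  · rw [smul_smul, smul_smul, smul_smul, ← Int.negOnePow_add, ← Int.negOnePow_add,
      ← Int.negOnePow_add]
    congr 1
    rw [weight_add r (s + t), weight_add s t, Finset.sum_sub_distrib]
    refine negOnePow_eq_of_sub_eq (c := r + t + 1) ?_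
    push_cast
    simp only [Finset.sum_const_zero, Finset.sum_const, Finset.card_range, add_assoc]
    ring

/-- The quadratic terms of the morphism identities, in terms of suspensions. -/
lemma negOnePow_smul_defect (n : ℕ) (p a : ℕ → ℤ) (x : ℕ → V) (hx : ∀ i, x i ∈ 𝒱 (p i) (a i)) :
    ∑ i ∈ Finset.Ico 1 n,
        Int.negOnePow (((i : ℤ) - 1) + (1 - ((n : ℤ) - i)) * ∑ l ∈ Finset.range i, p l) •
          C.mul (C.desuspend C.isMultilinear_tau i (fun l => x l))
            (C.desuspend C.isMultilinear_tau (n - i) (fun l => x (i + l))) =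
      -((n + 1 + weight n p).negOnePow • C.defect (seq n x)) := by
  have h : C.defect (seq n x) = ∑ i ∈ Finset.Ico 1 n,
      C.mul (C.ε (C.tau (seq i x))) (C.tau (seq (n - i) (fun j => x (i + j)))) := by
    rw [defect, conv, splitSum_seq]
    refine (Finset.sum_subset (fun i hi => ?_) fun i hi hi' => ?_).symm
    · rw [Finset.mem_Ico] at hi
      exact Finset.mem_range.2 (by omega)
    · rw [Finset.mem_range] at hi
      rw [Finset.mem_Ico] at hi'
      have : i = 0 ∨ n - i = 0 := by omega
      rcases this with h | h
      · simp [h, seq_zero, tau_nil]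
      · simp [h, seq_zero, tau_nil]
  -- it remains to compare signs; `τ` of the first `i` entries has degree `∑ p l + 1 - i`
  rw [h, Finset.smul_sum, ← Finset.sum_neg_distrib]
  refine Finset.sum_congr rfl fun i hi => ?_
  obtain ⟨j, rfl⟩ : ∃ j, n = i + j := ⟨n - i, by rw [Finset.mem_Ico] at hi; omega⟩
  rw [Nat.add_sub_cancel_left, desuspend_apply hC _ i p a x hx,
    desuspend_apply hC _ j (fun l => p (i + l)) (fun l => a (i + l)) (fun l => x (i + l))
      (fun l => hx _), hC.ε_eq (tau_mem hC i p a x hx), map_units_smul', map_units_smul',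
    map_units_smul', units_smul_apply, units_smul_apply, smul_smul, smul_smul, smul_smul,
    ← Int.negOnePow_add, ← Int.negOnePow_add, ← Int.negOnePow_add, ← Units.neg_smul,
    ← Int.negOnePow_succ]
  congr 1
  rw [weight_add i j]
  refine negOnePow_eq_of_sub_eq (c := i - 1 - j * ∑ l ∈ Finset.range i, p l) ?_
  push_cast
  ring

end Contraction

namespace Contraction

variable {k : Type*} [Field k] {W V : Type*} [AddCommGroup W] [Module k W]
  [AddCommGroup V] [Module k V] {C : Contraction k W V}
  {𝒲 : ℤ → ℤ → Submodule k W} {𝒱 : ℤ → ℤ → Submodule k V} (hC : C.IsBigraded 𝒲 𝒱)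

lemma exists_extension {n : ℕ} {p a : Fin n → ℤ} {x : Fin n → V}
    (hx : ∀ i, x i ∈ 𝒱 (p i) (a i)) :
    ∃ (p' a' : ℕ → ℤ) (x' : ℕ → V), (∀ i, x' i ∈ 𝒱 (p' i) (a' i)) ∧ (x = fun i : Fin n => x' i) ∧
      (∑ i, p i = ∑ i ∈ Finset.range n, p' i) ∧ (∑ i, a i = ∑ i ∈ Finset.range n, a' i) := by
  refine ⟨fun i => if h : i < n then p ⟨i, h⟩ else 0, fun i => if h : i < n then a ⟨i, h⟩ else 0,
    fun i => if h : i < n then x ⟨i, h⟩ else 0, fun i => ?_, ?_, ?_, ?_⟩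
  · by_cases h : i < n
    · simpa [h] using hx ⟨i, h⟩
    · simp [h]
  · funext i; simp
  · rw [Finset.sum_range]; simp
  · rw [Finset.sum_range]; simp

lemma mem_ofFn_εV_pow {e : V} (he : e ∈ 𝒱 0 0) (hC : C.IsBigraded 𝒲 𝒱) {n : ℕ} {x : Fin n → V}
    (hx : ∃ i, x i = e) :
    e ∈ List.ofFn (fun l : Fin n => (C.εV ^ (n - 1 - (l : ℕ))) (x l)) := by
  obtain ⟨i, hi⟩ := hx
  refine (List.mem_ofFn' _ _).2 ⟨i, ?_⟩
  dsimp only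
  rw [hi, εV_pow_eq hC he]
  simp

/-- The transferred `A_∞`-structure. -/
def aInfinityStructure {e : V} (he : e ∈ 𝒱 0 0) (he' : C.i e = C.one) :
    AInfinityStructure k 𝒱 e where
  m := C.desuspend C.isMultilinear_beta
  m_mem n p a x hx := by
    obtain ⟨p, a, x, hx', rfl, hp, ha⟩ := exists_extension hx
    rw [desuspend_apply hC _ n p a x hx', hp, ha]
    exact negOnePow_smul_mem (beta_mem hC n p a x hx') _
  stasheff n _ p a x hx := by
    rw [sum_desuspend hC C.isMultilinear_beta n p a x hx, bar_beta, smul_zero]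
  unit_mem := he
  unit_mul x := by
    rw [desuspend, smul_apply, MultilinearMap.compLinearMap_apply,
      IsMultilinear.toMultilinearMap_apply]
    have : C.εV e = e := by simpa using hC.εV_eq he
    simp [List.ofFn_succ, this, beta_unit_left _ he', pow_succ]
  mul_unit x := by
    rw [desuspend, smul_apply, MultilinearMap.compLinearMap_apply,
      IsMultilinear.toMultilinearMap_apply]
    simp [List.ofFn_succ, beta_unit_right _ he', εV_εV, pow_succ]
  m_unit n hn x hx := by
    rw [desuspend, smul_apply, MultilinearMap.compLinearMap_apply,
      IsMultilinear.toMultilinearMap_apply]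
    match n, hn with
    | 0, _ => simp [beta_nil]
    | 1, _ => simp [List.ofFn_succ, beta_singleton]
    | n + 3, _ =>
      rw [C.beta_eq_zero_of_unit he' _ (mem_ofFn_εV_pow he hC hx) (by simp), smul_zero]

lemma aInfinityStructure_m_one {e : V} (he : e ∈ 𝒱 0 0) (he' : C.i e = C.one) :
    (aInfinityStructure hC he he').m 1 = 0 := by
  ext x
  change C.desuspend C.isMultilinear_beta 1 x = 0
  rw [desuspend, smul_apply, MultilinearMap.compLinearMap_apply,
      IsMultilinear.toMultilinearMap_apply]
  simp [List.ofFn_succ, beta_singleton]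

/-- The `A_∞`-morphism from the transferred structure to the DG algebra. -/
def morphismToDG {e : V} (he : e ∈ 𝒱 0 0) (he' : C.i e = C.one) :
    MorphismToDG (aInfinityStructure hC he he') 𝒲 C.d C.mul C.one where
  f := C.desuspend C.isMultilinear_tau
  f_mem n p a x hx := by
    obtain ⟨p, a, x, hx', rfl, hp, ha⟩ := exists_extension hx
    rw [desuspend_apply hC _ n p a x hx', hp, ha]
    exact negOnePow_smul_mem (tau_mem hC n p a x hx') _
  morphism n _ p a x hx := by
    refine (sum_desuspend hC C.isMultilinear_tau n p a x hx).trans ?_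
    rw [negOnePow_smul_defect hC n p a x hx, desuspend_apply hC _ n p a x hx, map_units_smul',
      bar_tau, smul_sub, sub_eq_add_neg]
  f_unit := by
    rw [desuspend, smul_apply, MultilinearMap.compLinearMap_apply,
      IsMultilinear.toMultilinearMap_apply]
    simp [List.ofFn_succ, tau_singleton, he']
  f_unit_zero n hn x hx := by
    rw [desuspend, smul_apply, MultilinearMap.compLinearMap_apply,
      IsMultilinear.toMultilinearMap_apply,
      C.tau_eq_zero_of_unit he' _ (mem_ofFn_εV_pow he hC hx) (by simpa using hn), smul_zero]

lemma morphismToDG_f_one {e : V} (he : e ∈ 𝒱 0 0) (he' : C.i e = C.one) (v : V) :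
    (morphismToDG hC he he').f 1 (fun _ => v) = C.i v := by
  change C.desuspend C.isMultilinear_tau 1 _ = _
  rw [desuspend, smul_apply, MultilinearMap.compLinearMap_apply,
      IsMultilinear.toMultilinearMap_apply]
  simp [List.ofFn_succ, tau_singleton]

end Contraction

end AInf

/-! ### The differential of the bar construction, on functions of lists -/

namespace ListCalculus

variable {M W : Type*}

section Delta

variable [AddCommGroup W] (μ : M → M → M)

/-- The function `l ↦ ∑ (-1)^j F [x_0, …, x_j x_{j+1}, …]`, for a product `μ`. -/
def delta : (List M → W) → List M → W
  | _, [] => 0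
  | _, [_] => 0
  | F, x :: y :: l => F (μ x y :: l) - delta (fun m => F (x :: m)) (y :: l)

/-- The first summand of `delta`, for lists with first entry `x`. -/
def headMul (x : M) (F : List M → W) : List M → W
  | [] => 0
  | y :: l => F (μ x y :: l)

lemma delta_cons (F : List M → W) (x : M) (l : List M) :
    delta μ F (x :: l) = headMul μ x F l - delta μ (fun m => F (x :: m)) l := by
  cases l <;> simp [delta, headMul]

lemma map_delta {W' : Type*} [AddCommGroup W'] (g : W →+ W') (F : List M → W) (l : List M) :
    g (delta μ F l) = delta μ (fun m => g (F m)) l := by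
  induction l generalizing F with
  | nil => simp [delta]
  | cons x l ih =>
    rw [delta_cons, delta_cons, map_sub, ih]
    cases l <;> simp [headMul]

lemma delta_add (F G : List M → W) (l : List M) :
    delta μ (fun m => F m + G m) l = delta μ F l + delta μ G l := by
  induction l generalizing F G with
  | nil => simp [delta]
  | cons x l ih =>
    rw [delta_cons, delta_cons, delta_cons, ih]
    cases l <;> simp only [headMul] <;> abel

lemma delta_sub (F G : List M → W) (l : List M) :
    delta μ (fun m => F m - G m) l = delta μ F l - delta μ G l := by
  have h := map_delta μ (negAddMonoidHom : W →+ W) G l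
  simp only [coe_negAddMonoidHom] at h
  simp only [sub_eq_add_neg, delta_add, h]

lemma delta_delta (hμ : ∀ x y z, μ (μ x y) z = μ x (μ y z)) (F : List M → W) (l : List M) :
    delta μ (delta μ F) l = 0 := by
  induction l generalizing F with
  | nil => rfl
  | cons x l ih =>
    have h : (fun m => delta μ F (x :: m)) =
        fun m => headMul μ x F m - delta μ (fun m => F (x :: m)) m :=
      funext fun m => delta_cons μ F x m
    rw [delta_cons, h, delta_sub, ih, sub_zero, sub_eq_zero]
    cases l with
    | nil => rfl
    | cons y l =>
      rw [headMul, delta_cons, delta_cons]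
      congr 1
      cases l with
      | nil => rfl
      | cons z l => simp only [headMul, hμ]

/-- The sum formula for `delta` uses these contracted lists, in which the entries number `j` and
`j + 1` are replaced by their product. -/
def contractList : ℕ → List M → List M
  | 0, x :: y :: l => μ x y :: l
  | j + 1, x :: l => x :: contractList j l
  | _, l => l

lemma length_contractList {j : ℕ} {l : List M} (h : j + 1 < l.length) :
    (contractList μ j l).length + 1 = l.length := by
  induction j generalizing l with
  | zero =>
    match l, h with
    | x :: y :: l, _ => simp [contractList]
  | succ j ih =>
    match l, h with
    | x :: l, h => simpa [contractList] using ih (by simpa using h)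

lemma getD_contractList {j : ℕ} {l : List M} (h : j + 1 < l.length) (i : ℕ) (z : M) :
    (contractList μ j l).getD i z = if i < j then l.getD i z else
      if i = j then μ (l.getD i z) (l.getD (i + 1) z) else l.getD (i + 1) z := by
  induction j generalizing l i with
  | zero =>
    match l, h with
    | x :: y :: l, _ => cases i <;> simp [contractList]
  | succ j ih =>
    match l, h with
    | x :: l, h =>
      cases i with
      | zero => simp [contractList]
      | succ i => simpa [contractList] using ih (by simpa using h) i

lemma delta_eq_sum {R : Type*} [Ring R] (F : List M → R) (l : List M) :
    delta μ F l = ∑ j ∈ Finset.range (l.length - 1), (-1) ^ j * F (contractList μ j l) := by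
  induction l generalizing F with
  | nil => simp [delta]
  | cons x l ih =>
    rw [delta_cons, ih]
    cases l with
    | nil => simp [headMul]
    | cons y l =>
      simp only [List.length_cons, Nat.add_sub_cancel, headMul]
      rw [Finset.sum_range_succ', sub_eq_neg_add, ← Finset.sum_neg_distrib]
      simp [contractList, pow_succ]

lemma forall₂_contractList {N : Type*} {ν : N → N → N} {r : M → N → Prop}
    (hr : ∀ a b s t, r a s → r b t → r (μ a b) (ν s t)) (j : ℕ) {l : List M} {ts : List N}
    (h : List.Forall₂ r l ts) : List.Forall₂ r (contractList μ j l) (contractList ν j ts) := by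
  induction j generalizing l ts with
  | zero =>
    cases h with
    | nil => exact .nil
    | cons h₁ h =>
      cases h with
      | nil => exact .cons h₁ .nil
      | cons h₂ h => exact .cons (hr _ _ _ _ h₁ h₂) h
  | succ j ih =>
    cases h with
    | nil => exact .nil
    | cons h₁ h => exact .cons h₁ (ih h)

lemma sum_contractList (j : ℕ) (ts : List ℕ) : (contractList (· + ·) j ts).sum = ts.sum := by
  induction j generalizing ts with
  | zero =>
    match ts with
    | [] => rfl
    | [_] => rfl
    | s :: t :: ts => simp [contractList, add_assoc]
  | succ j ih =>
    match ts with
    | [] => rfl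
    | s :: ts => simp [contractList, ih]

variable {k : Type*} [CommRing k] [Module k W]

/-- The Leibniz rule for the convolution product of two functions of lists. -/
lemma delta_conv (B : W →ₗ[k] W →ₗ[k] W) (F G : List M → W) (l : List M) :
    delta μ (splitSum fun u v => B (F u) (G v)) l =
      splitSum (fun u v => B (delta μ F u) (G v)) l +
        splitSum (fun u v => B ((-1 : k) ^ u.length • F u) (delta μ G v)) l := by
  induction l generalizing F with
  | nil => simp [delta, splitSum]
  | cons x l ih =>
    have h₁ : delta μ (fun m => splitSum (fun u v => B (F u) (G v)) (x :: m)) l =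
        B (F []) (delta μ (fun m => G (x :: m)) l) +
          (splitSum (fun u v => B (delta μ (fun m => F (x :: m)) u) (G v)) l +
        splitSum (fun u v => B ((-1 : k) ^ u.length • F (x :: u)) (delta μ G v)) l) := by
      rw [← ih fun m => F (x :: m)]
      simp only [splitSum]
      rw [delta_add]
      congr 1
      exact (map_delta μ (B (F [])).toAddMonoidHom (fun m => G (x :: m)) l).symm
    have h₂ : headMul μ x (splitSum fun u v => B (F u) (G v)) l =
        B (F []) (headMul μ x G l) + splitSum (fun u v => B (headMul μ x F u) (G v)) l := by
      cases l with
      | nil => simp [headMul, splitSum]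
      | cons y l => simp [headMul, splitSum]
    have h₃ : splitSum (fun u v => B ((-1 : k) ^ (x :: u).length • F (x :: u)) (delta μ G v)) l =
        -splitSum (fun u v => B ((-1 : k) ^ u.length • F (x :: u)) (delta μ G v)) l := by
      rw [← splitSum_neg]
      simp [pow_succ]
    rw [delta_cons, h₁, h₂, splitSum, splitSum, h₃]
    simp only [delta_cons, map_sub, LinearMap.sub_apply, splitSum_sub]
    simp [delta]
    abel

end Delta

end ListCalculus

/-! ### The dual bar construction as a DG algebra -/

namespace DualBar

open ListCalculus

variable {k A : Type*} [Field k] [Ring A] [Algebra k A]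
  (𝒜 : ℕ → Submodule k A) [GradedAlgebra 𝒜]

/-- The value of an element of `B^# A` on `[a_1 | ⋯ | a_n]`, up to the sign `(-1)^{n(n-1)/2}`,
which absorbs all signs in the product and the differential. -/
def barEval (l : List (augIdeal 𝒜)) : BarDual 𝒜 →ₗ[k] k where
  toFun x := (-1) ^ l.length.choose 2 *
    (x l.length : BarForm 𝒜 l.length) (fun i => l.getD i 0)
  map_add' x y := by
    rw [DirectSum.add_apply, Submodule.coe_add, add_apply, mul_add]
  map_smul' c x := by
    rw [DirectSum.smul_apply, Submodule.coe_smul, smul_apply, smul_eq_mul, smul_eq_mul,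
      RingHom.id_apply, mul_left_comm]

lemma barEval_of_length {l : List (augIdeal 𝒜)} {p : ℕ} (hl : l.length = p) (x : BarDual 𝒜) :
    barEval 𝒜 l x = (-1) ^ p.choose 2 * (x p : BarForm 𝒜 p) (fun i => l.getD i 0) := by
  subst hl
  rfl

/-- The inclusion of the part of cohomological degree `p` into `B^# A`. -/
abbrev lof (p : ℕ) : barCochain 𝒜 p →ₗ[k] BarDual 𝒜 :=
  DirectSum.lof k ℕ (fun p => barCochain 𝒜 p) p

lemma barEval_lof {l : List (augIdeal 𝒜)} {p : ℕ} (f : barCochain 𝒜 p) :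
    barEval 𝒜 l (lof 𝒜 p f) = if l.length = p then
      (-1) ^ p.choose 2 * (f : BarForm 𝒜 p) (fun i => l.getD i 0) else 0 := by
  split_ifs with h
  · rw [barEval_of_length 𝒜 h, DirectSum.lof_apply]
  · rw [barEval_of_length 𝒜 rfl, DirectSum.lof_eq_of, DirectSum.of_eq_of_ne _ _ _ h]
    simp

lemma apply_eq_barEval (x : BarDual 𝒜) (p : ℕ) (a : Fin p → augIdeal 𝒜) :
    (x p : BarForm 𝒜 p) a = (-1) ^ p.choose 2 * barEval 𝒜 (List.ofFn a) x := by
  rw [barEval_of_length 𝒜 List.length_ofFn, ← mul_assoc, ← mul_pow]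
  simp

lemma ext_barEval {x y : BarDual 𝒜} (h : ∀ l, barEval 𝒜 l x = barEval 𝒜 l y) : x = y := by
  refine DFinsupp.ext fun p => Subtype.ext (MultilinearMap.ext fun a => ?_)
  exact (apply_eq_barEval 𝒜 x p a).trans (by rw [h, ← apply_eq_barEval])

lemma induction_lof {P : BarDual 𝒜 → Prop} (x : BarDual 𝒜) (h0 : P 0)
    (h : ∀ p f, P (lof 𝒜 p f)) (hadd : ∀ x y, P x → P y → P (x + y)) : P x :=
  DirectSum.induction_on x h0 (fun p f => h p f) hadd

lemma choose_two_add (p q : ℕ) : ((-1 : k) ^ (p + q).choose 2) =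
    (-1) ^ p.choose 2 * (-1) ^ q.choose 2 * (-1) ^ (p * q) := by
  rw [← pow_add, ← pow_add]
  congr 1
  induction q with
  | zero => simp
  | succ q ih =>
    rw [← add_assoc, Nat.choose_succ_succ', Nat.choose_succ_succ' q, ih]
    simp
    ring

lemma barMul_lof_lof {p q : ℕ} (f : barCochain 𝒜 p) (g : barCochain 𝒜 q) :
    barMul 𝒜 (lof 𝒜 p f) (lof 𝒜 q g) = lof 𝒜 (p + q) (cochainMul 𝒜 p q f g) := by
  rw [barMul, DirectSum.toModule_lof, LinearMap.flip_apply, DirectSum.toModule_lof]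
  rfl

lemma barD_lof {p : ℕ} (f : barCochain 𝒜 p) :
    barD 𝒜 (lof 𝒜 p f) = lof 𝒜 (p + 1) ((formDifferential 𝒜 p).restrict
      (fun _ hf => formDifferential_mem 𝒜 hf) f) := by
  rw [barD, DirectSum.toModule_lof]
  rfl

lemma barEval_barMul (l : List (augIdeal 𝒜)) (x y : BarDual 𝒜) :
    barEval 𝒜 l (barMul 𝒜 x y) =
      splitSum (fun u v => LinearMap.mul k k (barEval 𝒜 u x) (barEval 𝒜 v y)) l := by
  induction x using induction_lof with
  | h0 => simp [splitSum_zero]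
  | hadd x x' hx hx' => simp only [map_add, LinearMap.add_apply, hx, hx', splitSum_add]
  | h p f =>
    induction y using induction_lof with
    | h0 => simp [splitSum_zero]
    | hadd x x' hx hx' => simp only [map_add, hx, hx', splitSum_add]
    | h q g =>
      rw [barMul_lof_lof, barEval_lof, splitSum_eq_sum]
      simp only [barEval_lof, LinearMap.mul_apply']
      split_ifs with h
      · rw [Finset.sum_eq_single p]
        · rw [if_pos (by simp [h]), if_pos (by simp [h])]
          change _ * (formMul 𝒜 p q f g) _ = _
          rw [formMul_apply, choose_two_add]
          have e₁ : (fun i : Fin p => l.getD (Fin.castAdd q i : ℕ) 0) =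
              fun i : Fin p => (l.take p).getD i 0 := by
            funext i
            simp
          have e₂ : (fun i : Fin q => l.getD (Fin.natAdd p i : ℕ) 0) =
              fun i : Fin q => (l.drop p).getD i 0 := by
            funext i
            simp
          rw [e₁, e₂]
          have e₃ : ((-1 : k) ^ (p * q)) * (-1) ^ (p * q) = 1 := by
            rw [← mul_pow]; simp
          linear_combination ((-1 : k) ^ p.choose 2 * (-1) ^ q.choose 2 *
            (f : BarForm 𝒜 p) (fun i : Fin p => (l.take p).getD i 0) *
            (g : BarForm 𝒜 q) (fun i : Fin q => (l.drop p).getD i 0)) * e₃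
        · intro i hi hip
          have : ¬ (l.take i).length = p := by
            rw [Finset.mem_range] at hi
            rw [List.length_take]
            omega
          rw [if_neg this, zero_mul]
        · intro hp
          rw [Finset.mem_range] at hp
          omega
      · refine (Finset.sum_eq_zero fun i hi => ?_).symm
        rw [Finset.mem_range] at hi
        by_cases h' : (l.take i).length = p
        · have : ¬ (l.drop i).length = q := by
            rw [List.length_take] at h'
            rw [List.length_drop]
            omega
          rw [if_neg this, mul_zero]
        · rw [if_neg h', zero_mul]

/-- The multiplication of `𝔪`, as a function. -/
abbrev μ (a b : augIdeal 𝒜) : augIdeal 𝒜 := augMul 𝒜 a b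

lemma coe_μ (a b : augIdeal 𝒜) : (μ 𝒜 a b : A) = a * b := rfl

lemma barEval_barD (l : List (augIdeal 𝒜)) (x : BarDual 𝒜) :
    barEval 𝒜 l (barD 𝒜 x) = delta (μ 𝒜) (fun m => barEval 𝒜 m x) l := by
  induction x using induction_lof with
  | h0 => simp [delta_eq_sum]
  | hadd x x' hx hx' => simp only [map_add, hx, hx', delta_add]
  | h p f =>
    rw [barD_lof, barEval_lof, delta_eq_sum]
    simp only [barEval_lof]
    split_ifs with h
    · have hl : l.length - 1 = p := by omega
      rw [hl, LinearMap.coe_restrict_apply, formDifferential, LinearMap.smul_apply,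
        LinearMap.sum_apply, smul_apply, sum_apply, Finset.sum_range,
        smul_eq_mul, Finset.mul_sum, Finset.mul_sum]
      refine Finset.sum_congr rfl fun j _ => ?_
      have hj : (j : ℕ) + 1 < l.length := by have := j.2; omega
      have hc := length_contractList (μ 𝒜) hj
      rw [if_pos (by omega), LinearMap.smul_apply, smul_apply]
      have e : (fun i : Fin p => (contractList (μ 𝒜) j l).getD i 0) =
          Fin.contractNth j.castSucc (fun u v => augMul 𝒜 u v)
            (fun i : Fin (p + 1) => l.getD i 0) := by
        funext i
        rw [getD_contractList (μ 𝒜) hj, Fin.contractNth]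
        rfl
      rw [e]
      change _ * (_ * ((-1) ^ _ • (f : BarForm 𝒜 p) _)) = _
      have e₁ : ((-1 : k) ^ (p + 1).choose 2) = (-1) ^ p.choose 2 * (-1) ^ p := by
        rw [choose_two_add]; simp
      have e₂ : ((-1 : k) ^ p) * (-1) ^ p = 1 := by
        rw [← mul_pow]; simp
      rw [e₁, smul_eq_mul, pow_succ]
      generalize (f : BarForm 𝒜 p) _ = y
      linear_combination ((-1 : k) ^ p.choose 2 * (-1) ^ (j : ℕ) * y) * e₂
    · refine (Finset.sum_eq_zero fun j hj => ?_).symm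
      rw [Finset.mem_range] at hj
      have hc := length_contractList (μ 𝒜) (show j + 1 < l.length by omega)
      rw [if_neg (by omega), mul_zero]

lemma barEval_barOne (l : List (augIdeal 𝒜)) :
    barEval 𝒜 l (barOne 𝒜) = if l = [] then 1 else 0 := by
  rw [barOne, barEval_lof]
  simp [List.length_eq_zero_iff]

/-- The sign involution of `B^# A`. -/
def barSign : BarDual 𝒜 →ₗ[k] BarDual 𝒜 :=
  DirectSum.toModule k ℕ _ fun p => (-1 : k) ^ p • lof 𝒜 p

lemma barEval_barSign (l : List (augIdeal 𝒜)) (x : BarDual 𝒜) :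
    barEval 𝒜 l (barSign 𝒜 x) = (-1 : k) ^ l.length • barEval 𝒜 l x := by
  induction x using induction_lof with
  | h0 => simp
  | hadd x x' hx hx' => simp only [map_add, hx, hx', smul_add]
  | h p f =>
    rw [barSign, DirectSum.toModule_lof, LinearMap.smul_apply, map_smul, barEval_lof]
    split_ifs with h
    · rw [h]
    · simp

lemma barD_barD (x : BarDual 𝒜) : barD 𝒜 (barD 𝒜 x) = 0 := by
  refine ext_barEval 𝒜 fun l => ?_
  rw [barEval_barD]
  simp only [barEval_barD]
  rw [delta_delta _ (fun a b c => Subtype.ext (mul_assoc (a : A) b c)), map_zero]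

lemma barD_barMul (x y : BarDual 𝒜) :
    barD 𝒜 (barMul 𝒜 x y) = barMul 𝒜 (barD 𝒜 x) y + barMul 𝒜 (barSign 𝒜 x) (barD 𝒜 y) := by
  refine ext_barEval 𝒜 fun l => ?_
  rw [map_add, barEval_barMul, barEval_barMul, barEval_barD]
  simp only [barEval_barMul, barEval_barD, barEval_barSign]
  exact delta_conv _ (LinearMap.mul k k) _ _ l

lemma barMul_assoc (x y z : BarDual 𝒜) :
    barMul 𝒜 (barMul 𝒜 x y) z = barMul 𝒜 x (barMul 𝒜 y z) := by
  refine ext_barEval 𝒜 fun l => ?_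
  rw [barEval_barMul, barEval_barMul]
  have h₁ : ∀ u v, LinearMap.mul k k (barEval 𝒜 u (barMul 𝒜 x y)) (barEval 𝒜 v z) =
      splitSum (fun u₁ u₂ => barEval 𝒜 u₁ x * barEval 𝒜 u₂ y * barEval 𝒜 v z) u := fun u v => by
    rw [barEval_barMul]
    exact map_splitSum ((LinearMap.mul k k).flip (barEval 𝒜 v z)).toAddMonoidHom _ _
  have h₂ : ∀ u v, LinearMap.mul k k (barEval 𝒜 u x) (barEval 𝒜 v (barMul 𝒜 y z)) =
      splitSum (fun v₁ v₂ => barEval 𝒜 u x * barEval 𝒜 v₁ y * barEval 𝒜 v₂ z) v := fun u v => by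
    rw [barEval_barMul]
    refine (map_splitSum (LinearMap.mul k k (barEval 𝒜 u x)).toAddMonoidHom _ _).trans
      (splitSum_congr fun _ _ _ => (mul_assoc _ _ _).symm)
  simp only [h₁, h₂]
  exact (splitSum_splitSum
    (fun u v w => barEval 𝒜 u x * barEval 𝒜 v y * barEval 𝒜 w z) l).symm

lemma barOne_mul (x : BarDual 𝒜) : barMul 𝒜 (barOne 𝒜) x = x := by
  refine ext_barEval 𝒜 fun l => ?_
  rw [barEval_barMul]
  cases l with
  | nil => simp [splitSum, barEval_barOne]
  | cons a l => simp [splitSum, barEval_barOne, splitSum_zero]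

lemma barMul_one (x : BarDual 𝒜) : barMul 𝒜 x (barOne 𝒜) = x := by
  refine ext_barEval 𝒜 fun l => ?_
  rw [barEval_barMul, splitSum_eq_last fun u v hv => by simp [barEval_barOne, hv]]
  simp [barEval_barOne]

lemma barSign_barSign (x : BarDual 𝒜) : barSign 𝒜 (barSign 𝒜 x) = x := by
  refine ext_barEval 𝒜 fun l => ?_
  rw [barEval_barSign, barEval_barSign, smul_smul, ← mul_pow]
  simp

lemma barSign_barMul (x y : BarDual 𝒜) :
    barSign 𝒜 (barMul 𝒜 x y) = barMul 𝒜 (barSign 𝒜 x) (barSign 𝒜 y) := by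
  refine ext_barEval 𝒜 fun l => ?_
  rw [barEval_barSign, barEval_barMul, barEval_barMul]
  refine (map_splitSum (DistribSMul.toAddMonoidHom k ((-1 : k) ^ l.length)) _ _).trans
    (splitSum_congr fun u v huv => ?_)
  rw [barEval_barSign, barEval_barSign, ← huv, List.length_append, pow_add]
  simp only [DistribSMul.toAddMonoidHom_apply, smul_eq_mul, LinearMap.mul_apply']
  ring

lemma barSign_barD (x : BarDual 𝒜) : barSign 𝒜 (barD 𝒜 x) = -barD 𝒜 (barSign 𝒜 x) := by
  refine ext_barEval 𝒜 fun l => ?_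
  rw [barEval_barSign, map_neg, barEval_barD, barEval_barD, delta_eq_sum, delta_eq_sum,
    Finset.smul_sum, ← Finset.sum_neg_distrib]
  refine Finset.sum_congr rfl fun j hj => ?_
  rw [Finset.mem_range] at hj
  rw [barEval_barSign, ← length_contractList (μ 𝒜) (show j + 1 < l.length by omega), pow_succ]
  simp only [smul_eq_mul]
  ring

lemma barSign_barOne : barSign 𝒜 (barOne 𝒜) = barOne 𝒜 := by
  refine ext_barEval 𝒜 fun l => ?_
  rw [barEval_barSign, barEval_barOne]
  split_ifs with h <;> simp [h]

/-! ### The bigrading -/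

/-- The entries of `l` are homogeneous elements of `𝔪`, of the degrees listed in `ts`. -/
abbrev IsHomogeneousList (l : List (augIdeal 𝒜)) (ts : List ℕ) : Prop :=
  List.Forall₂ (fun (a : augIdeal 𝒜) t => (a : A) ∈ 𝒜 t) l ts

lemma mem_barBigrading_iff {p s : ℤ} {x : BarDual 𝒜} :
    x ∈ barBigrading 𝒜 p s ↔ ∀ l ts, IsHomogeneousList 𝒜 l ts →
      ¬ ((l.length : ℤ) = p ∧ -((ts.sum : ℕ) : ℤ) = s) → barEval 𝒜 l x = 0 := by
  constructor
  · intro hx l ts hl h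
    have hlen := hl.length_eq
    rw [barEval_of_length 𝒜 rfl]
    refine mul_eq_zero_of_right _ (hx l.length (fun i => ts.getD i 0) _ (fun i => ?_) ?_)
    · have hi : (i : ℕ) < ts.length := by rw [← hlen]; exact i.2
      have := (List.forall₂_iff_get.1 hl).2 i i.2 hi
      simpa [hi] using this
    · convert h using 4
      have : ts = List.ofFn (fun i : Fin l.length => ts.getD i 0) := by
        refine List.ext_getElem (by simp [hlen]) fun i h₁ h₂ => ?_
        simp [h₁]
      conv_rhs => rw [this]
      rw [List.sum_ofFn]
  · intro hx q t a ha h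
    rw [apply_eq_barEval, hx (List.ofFn a) (List.ofFn t), mul_zero]
    · exact List.forall₂_iff_get.2 ⟨by simp, fun i h₁ h₂ => by simpa using ha _⟩
    · simpa [List.sum_ofFn] using h

lemma barMul_mem {p s q t : ℤ} {x y : BarDual 𝒜} (hx : x ∈ barBigrading 𝒜 p s)
    (hy : y ∈ barBigrading 𝒜 q t) : barMul 𝒜 x y ∈ barBigrading 𝒜 (p + q) (s + t) := by
  rw [mem_barBigrading_iff] at hx hy ⊢
  intro l ts hl h
  rw [barEval_barMul]
  refine splitSum_eq_zero fun u v huv => ?_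
  subst huv
  have h₁ := List.forall₂_take u.length hl
  have h₂ := List.forall₂_drop u.length hl
  rw [List.take_left] at h₁
  rw [List.drop_left] at h₂
  have hsum := congrArg List.sum (List.take_append_drop u.length ts)
  rw [List.sum_append] at hsum
  by_cases hu : (u.length : ℤ) = p ∧ -(((ts.take u.length).sum : ℕ) : ℤ) = s
  · rw [hy v _ h₂, map_zero]
    rintro ⟨h₃, h₄⟩
    refine h ⟨?_, ?_⟩
    · rw [List.length_append]; push_cast; omega
    · omega
  · rw [hx u _ h₁ hu, map_zero, LinearMap.zero_apply]

lemma barD_mem {p s : ℤ} {x : BarDual 𝒜} (hx : x ∈ barBigrading 𝒜 p s) :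
    barD 𝒜 x ∈ barBigrading 𝒜 (p + 1) s := by
  rw [mem_barBigrading_iff] at hx ⊢
  intro l ts hl h
  rw [barEval_barD, delta_eq_sum]
  refine Finset.sum_eq_zero fun j hj => ?_
  rw [Finset.mem_range] at hj
  have hlen := length_contractList (μ 𝒜) (show j + 1 < l.length by omega)
  rw [hx _ _ (forall₂_contractList (μ 𝒜) (ν := (· + ·)) (fun a b s t ha hb => ?_) j hl), mul_zero]
  · rw [sum_contractList]
    rintro ⟨h₁, h₂⟩
    exact h ⟨by omega, h₂⟩
  · exact SetLike.mul_mem_graded ha hb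

/-- The projection of `𝔪` onto its part of degree `t`. -/
def augProj (t : ℕ) : augIdeal 𝒜 →ₗ[k] augIdeal 𝒜 :=
  (GradedAlgebra.proj 𝒜 t).restrict fun a ha => by
    rcases eq_or_ne t 0 with rfl | ht
    · rw [augIdeal, LinearMap.mem_ker] at ha
      rw [ha]
      exact zero_mem _
    · exact mem_augIdeal_of_mem 𝒜 ht (SetLike.coe_mem _)

lemma augProj_mem (t : ℕ) (a : augIdeal 𝒜) : (augProj 𝒜 t a : A) ∈ 𝒜 t := SetLike.coe_mem _

lemma augProj_of_mem {t : ℕ} {a : augIdeal 𝒜} (ha : (a : A) ∈ 𝒜 t) (s : ℕ) :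
    augProj 𝒜 s a = if s = t then a else 0 := by
  split_ifs with h
  · subst h
    exact Subtype.ext (DirectSum.decompose_of_mem_same 𝒜 ha)
  · exact Subtype.ext (DirectSum.decompose_of_mem_ne 𝒜 ha (Ne.symm h))

lemma exists_sum_augProj (a : augIdeal 𝒜) : ∃ S : Finset ℕ, ∑ t ∈ S, augProj 𝒜 t a = a := by
  classical
  refine ⟨(DirectSum.decompose 𝒜 (a : A)).support, Subtype.ext ?_⟩
  rw [AddSubmonoidClass.coe_finsetSum]
  exact DirectSum.sum_support_decompose 𝒜 (a : A)

lemma augIdeal_induction {P : augIdeal 𝒜 → Prop} (a : augIdeal 𝒜) (h0 : P 0)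
    (h : ∀ t (a : augIdeal 𝒜), (a : A) ∈ 𝒜 t → P a) (hadd : ∀ a b, P a → P b → P (a + b)) :
    P a := by
  obtain ⟨S, hS⟩ := exists_sum_augProj 𝒜 a
  rw [← hS]
  exact Finset.sum_induction _ P hadd h0 fun t _ => h t _ (augProj_mem 𝒜 t a)

lemma ext_homogeneous {p : ℕ} {f g : BarForm 𝒜 p}
    (h : ∀ (t : Fin p → ℕ) (a : Fin p → augIdeal 𝒜), (∀ i, (a i : A) ∈ 𝒜 (t i)) → f a = g a) :
    f = g := by
  ext a
  choose S hS using exists_sum_augProj 𝒜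
  have e : a = fun i => ∑ t ∈ S (a i), augProj 𝒜 t (a i) := funext fun i => (hS (a i)).symm
  rw [e, MultilinearMap.map_sum_finset, MultilinearMap.map_sum_finset]
  exact Finset.sum_congr rfl fun r _ => h r _ fun i => augProj_mem 𝒜 _ _

lemma apply_eq_zero_of_mem {p s : ℤ} {x : BarDual 𝒜} (hx : x ∈ barBigrading 𝒜 p s) {q : ℕ}
    (hq : (q : ℤ) ≠ p) : x q = 0 :=
  Subtype.ext (ext_homogeneous 𝒜 fun t a ha => hx q t a ha fun h => hq h.1)

lemma barSign_eq {p s : ℤ} {x : BarDual 𝒜} (hx : x ∈ barBigrading 𝒜 p s) :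
    barSign 𝒜 x = p.negOnePow • x := by
  refine ext_barEval 𝒜 fun l => ?_
  rw [barEval_barSign, AInf.map_units_smul']
  by_cases h : (l.length : ℤ) = p
  · subst h
    rw [← Int.cast_negOnePow_natCast k, Units.smul_def, ← Int.cast_smul_eq_zsmul k]
  · have : barEval 𝒜 l x = 0 := by
      rw [barEval_of_length 𝒜 rfl, apply_eq_zero_of_mem 𝒜 hx h]
      simp
    rw [this, smul_zero, smul_zero]

lemma barOne_mem : barOne 𝒜 ∈ barBigrading 𝒜 0 0 := by
  rw [mem_barBigrading_iff]
  intro l ts hl h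
  rw [barEval_barOne, if_neg]
  rintro rfl
  cases hl
  simp at h

end DualBar

/-! ### Recursion on tensor algebras -/

namespace TensorAlgebra

variable {k V : Type*} [CommRing k] [AddCommGroup V] [Module k V]

/-- The tensor algebra is spanned by `1` and the products `v * t` with `v ∈ V`. -/
lemma eq_top_of_ι_mul_mem {S : Submodule k (TensorAlgebra k V)} (h1 : 1 ∈ S)
    (hι : ∀ v, ∀ t ∈ S, ι k v * t ∈ S) : S = ⊤ := by
  refine Submodule.eq_top_iff'.2 fun t => ?_
  suffices h : ∀ s ∈ S, t * s ∈ S by simpa using h 1 h1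
  induction t using TensorAlgebra.induction with
  | algebraMap c => intro s hs; rw [← Algebra.smul_def]; exact S.smul_mem c hs
  | ι v => exact hι v
  | mul a b ha hb => intro s hs; rw [mul_assoc]; exact ha _ (hb _ hs)
  | add a b ha hb => intro s hs; rw [add_mul]; exact S.add_mem (ha _ hs) (hb _ hs)

variable {M : Type*} [AddCommGroup M] [Module k M]

lemma left_ext {f g : TensorAlgebra k V →ₗ[k] M} (h1 : f 1 = g 1)
    (h : ∀ v t, f (ι k v * t) = g (ι k v * t)) : f = g := by
  have : LinearMap.eqLocus f g = ⊤ := eq_top_of_ι_mul_mem h1 fun v t _ => h v t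
  exact LinearMap.ext fun t => (this ▸ Submodule.mem_top : t ∈ LinearMap.eqLocus f g)

/-- The action of `v` on `T(V) × M` by `(s, m) ↦ (v * s, g v s)`. -/
def leftRecStep (g : V →ₗ[k] TensorAlgebra k V →ₗ[k] M) :
    V →ₗ[k] Module.End k (TensorAlgebra k V × M) where
  toFun v := ((LinearMap.mulLeft k (ι k v)).prod (g v)).comp (LinearMap.fst k _ _)
  map_add' v w := by ext <;> simp [add_mul]
  map_smul' c v := by ext <;> simp

/-- The linear map `φ` on the tensor algebra with `φ 1 = 0` and `φ (v * t) = g v t`. -/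
def leftRec (g : V →ₗ[k] TensorAlgebra k V →ₗ[k] M) : TensorAlgebra k V →ₗ[k] M where
  toFun t := (lift k (leftRecStep g) t (1, 0)).2
  map_add' s t := by simp
  map_smul' c t := by simp

lemma leftRec_one (g : V →ₗ[k] TensorAlgebra k V →ₗ[k] M) : leftRec g 1 = 0 := by
  simp [leftRec]

lemma leftRec_ι_mul (g : V →ₗ[k] TensorAlgebra k V →ₗ[k] M) (v : V) (t : TensorAlgebra k V) :
    leftRec g (ι k v * t) = g v t := by
  have h : ∀ t s m, (lift k (leftRecStep g) t (s, m)).1 = t * s := by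
    intro t
    induction t using TensorAlgebra.induction with
    | algebraMap c => intro s m; simp [Algebra.smul_def]
    | ι v => intro s m; simp [leftRecStep]
    | mul a b ha hb =>
      intro s m
      rw [map_mul, Module.End.mul_apply, mul_assoc, ← hb s m,
        ← ha _ (lift k (leftRecStep g) b (s, m)).2]
    | add a b ha hb => intro s m; simp [ha, hb, add_mul]
  have h' := h t 1 0
  rw [mul_one] at h'
  change (lift k (leftRecStep g) (ι k v * t) (1, 0)).2 = g v t
  rw [map_mul, Module.End.mul_apply, lift_ι_apply]
  exact congrArg (g v) h'

lemma toTensorAlgebra_mem (n : ℕ) (r : ⨂[k]^n V) :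
    TensorPower.toTensorAlgebra r ∈ (LinearMap.range (ι k : V →ₗ[k] _)) ^ n := by
  induction r using PiTensorProduct.induction_on with
  | smul_tprod c x =>
    rw [map_smul, TensorPower.toTensorAlgebra_tprod, tprod_apply]
    refine Submodule.smul_mem _ _ ?_
    have := SetLike.list_prod_ofFn_mem_graded
      (A := fun n : ℕ => (LinearMap.range (ι k : V →ₗ[k] TensorAlgebra k V)) ^ n)
      (fun _ : Fin n => 1) (fun i => ι k (x i)) fun i => by simp
    simpa [List.sum_ofFn] using this
  | add x y hx hy => rw [map_add]; exact Submodule.add_mem _ hx hy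

end TensorAlgebra

/-! ### Minimal relations -/

namespace TensorAlgebra

variable {k V : Type*} [Field k] [AddCommGroup V] [Module k V]

/-- The grading of the tensor algebra. -/
abbrev grading (k V : Type*) [Field k] [AddCommGroup V] [Module k V] (n : ℕ) :
    Submodule k (TensorAlgebra k V) := (LinearMap.range (ι k : V →ₗ[k] _)) ^ n

/-- The degree `n` component of an element of the tensor algebra. -/
def component (n : ℕ) : TensorAlgebra k V →ₗ[k] TensorAlgebra k V :=
  GradedAlgebra.proj (grading k V) n

lemma component_apply (n : ℕ) (t : TensorAlgebra k V) :
    component n t = DirectSum.decompose (grading k V) t n := rfl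

lemma component_of_mem {n : ℕ} {t : TensorAlgebra k V} (ht : t ∈ grading k V n) :
    component n t = t := DirectSum.decompose_of_mem_same _ ht

/-- A two-sided ideal generated by homogeneous elements contains the components of its elements. -/
lemma component_mem_span {X : Set (TensorAlgebra k V)} (hX : ∀ x ∈ X, ∃ d, x ∈ grading k V d)
    {t : TensorAlgebra k V} (ht : t ∈ TwoSidedIdeal.span X) (m : ℕ) :
    component m t ∈ TwoSidedIdeal.span X := by
  induction ht using TwoSidedIdeal.span_induction generalizing m with
  | mem x hx =>
    obtain ⟨d, hd⟩ := hX x hx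
    rcases eq_or_ne d m with rfl | h
    · rw [component_of_mem hd]
      exact TwoSidedIdeal.subset_span hx
    · rw [component_apply, DirectSum.decompose_of_mem_ne _ hd h]
      exact TwoSidedIdeal.zero_mem _
  | zero => rw [map_zero]; exact TwoSidedIdeal.zero_mem _
  | add x y _ _ hx hy => rw [map_add]; exact TwoSidedIdeal.add_mem _ (hx m) (hy m)
  | neg x _ hx =>
    rw [map_neg]
    exact TwoSidedIdeal.neg_mem _ (hx m)
  | left_absorb a x _ hx =>
    induction a using DirectSum.Decomposition.inductionOn (grading k V) with
    | zero => rw [zero_mul, map_zero]; exact TwoSidedIdeal.zero_mem _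
    | homogeneous a =>
      rw [component_apply, DirectSum.coe_decompose_mul_of_left_mem _ _ a.2]
      split_ifs
      · exact TwoSidedIdeal.mul_mem_left _ _ _ (hx _)
      · exact TwoSidedIdeal.zero_mem _
    | add a b ha hb => rw [add_mul, map_add]; exact TwoSidedIdeal.add_mem _ ha hb
  | right_absorb a x _ hx =>
    induction a using DirectSum.Decomposition.inductionOn (grading k V) with
    | zero => rw [mul_zero, map_zero]; exact TwoSidedIdeal.zero_mem _
    | homogeneous a =>
      rw [component_apply, DirectSum.coe_decompose_mul_of_right_mem _ _ a.2]
      split_ifs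
      · exact TwoSidedIdeal.mul_mem_right _ _ _ (hx _)
      · exact TwoSidedIdeal.zero_mem _
    | add a b ha hb => rw [mul_add, map_add]; exact TwoSidedIdeal.add_mem _ ha hb

lemma mem_of_component_mem {J : TwoSidedIdeal (TensorAlgebra k V)} {t : TensorAlgebra k V}
    (h : ∀ m, component m t ∈ J) : t ∈ J := by
  classical
  rw [← DirectSum.sum_support_decompose (grading k V) t]
  exact sum_mem fun m _ => h m

/-- The two-sided ideal generated by a graded space of relations. -/
def relationIdeal (R : ∀ n : ℕ, Submodule k (⨂[k]^n V)) : TwoSidedIdeal (TensorAlgebra k V) :=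
  TwoSidedIdeal.span {x | ∃ n, 2 ≤ n ∧ ∃ r ∈ R n, TensorPower.toTensorAlgebra r = x}

lemma component_mem_relationIdeal {R : ∀ n : ℕ, Submodule k (⨂[k]^n V)} {t : TensorAlgebra k V}
    (ht : t ∈ relationIdeal R) (m : ℕ) : component m t ∈ relationIdeal R :=
  component_mem_span (by rintro _ ⟨n, -, r, -, rfl⟩; exact ⟨n, toTensorAlgebra_mem n r⟩) ht m

/-- The decomposable part `V I + I V` of a two-sided ideal `I` of the tensor algebra. -/
inductive Decomposable (I : TwoSidedIdeal (TensorAlgebra k V)) : TensorAlgebra k V → Prop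
  | zero : Decomposable I 0
  | ι_mul (v : V) {x} : x ∈ I → Decomposable I (ι k v * x)
  | mul_ι (v : V) {x} : x ∈ I → Decomposable I (x * ι k v)
  | add {x y} : Decomposable I x → Decomposable I y → Decomposable I (x + y)

lemma Decomposable.mem {I : TwoSidedIdeal (TensorAlgebra k V)} {t : TensorAlgebra k V}
    (ht : Decomposable I t) : t ∈ I := by
  induction ht with
  | zero => exact I.zero_mem
  | ι_mul v hx => exact I.mul_mem_left _ _ hx
  | mul_ι v hx => exact I.mul_mem_right _ _ hx
  | add _ _ hx hy => exact I.add_mem hx hy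

lemma Decomposable.smul {I : TwoSidedIdeal (TensorAlgebra k V)} {t : TensorAlgebra k V}
    (ht : Decomposable I t) (c : k) : Decomposable I (c • t) := by
  induction ht with
  | zero => rw [smul_zero]; exact .zero
  | ι_mul v hx => rw [← smul_mul_assoc, ← map_smul]; exact .ι_mul _ hx
  | mul_ι v hx => rw [← mul_smul_comm, ← map_smul]; exact .mul_ι _ hx
  | add _ _ hx hy => rw [smul_add]; exact .add hx hy

lemma Decomposable.mul_left {I : TwoSidedIdeal (TensorAlgebra k V)} {t : TensorAlgebra k V}
    (ht : Decomposable I t) (a : TensorAlgebra k V) : Decomposable I (a * t) := by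
  induction a using TensorAlgebra.induction generalizing t with
  | algebraMap c => rw [← Algebra.smul_def]; exact ht.smul c
  | ι v => exact .ι_mul v ht.mem
  | mul a b ha hb => rw [mul_assoc]; exact ha (hb ht)
  | add a b ha hb => rw [add_mul]; exact .add (ha ht) (hb ht)

lemma Decomposable.mul_right {I : TwoSidedIdeal (TensorAlgebra k V)} {t : TensorAlgebra k V}
    (ht : Decomposable I t) (a : TensorAlgebra k V) : Decomposable I (t * a) := by
  induction a using TensorAlgebra.induction generalizing t with
  | algebraMap c => rw [← Algebra.commutes, ← Algebra.smul_def]; exact ht.smul c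
  | ι v => exact .mul_ι v ht.mem
  | mul a b ha hb => rw [← mul_assoc]; exact hb (ha ht)
  | add a b ha hb => rw [mul_add]; exact .add (ha ht) (hb ht)

/-- The graded Nakayama lemma: relations that generate `I` up to decomposable elements
generate `I`. -/
lemma le_relationIdeal {S : ∀ n : ℕ, Submodule k (⨂[k]^n V)}
    {I : TwoSidedIdeal (TensorAlgebra k V)}
    (h : ∀ t ∈ I, ∃ s ∈ relationIdeal S, Decomposable I (t - s)) : I ≤ relationIdeal S := by
  have key : ∀ m, ∀ t ∈ I, component m t ∈ relationIdeal S := by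
    intro m
    induction m using Nat.strong_induction_on with
    | _ m ih =>
      intro t ht
      obtain ⟨s, hs, hd⟩ := h t ht
      -- a component of `v x` or `x v` is `v` times a component of `x` of smaller degree
      have hd' : component m (t - s) ∈ relationIdeal S := by
        generalize t - s = u at hd
        induction hd with
        | zero => rw [map_zero]; exact TwoSidedIdeal.zero_mem _
        | @ι_mul v x hx =>
          rw [component_apply, DirectSum.coe_decompose_mul_of_left_mem (i := 1) _ _ (by simp)]
          split_ifs with hm
          · exact TwoSidedIdeal.mul_mem_left _ _ _ (ih (m - 1) (by omega) _ hx)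
          · exact TwoSidedIdeal.zero_mem _
        | @mul_ι v x hx =>
          rw [component_apply, DirectSum.coe_decompose_mul_of_right_mem (i := 1) _ _ (by simp)]
          split_ifs with hm
          · exact TwoSidedIdeal.mul_mem_right _ _ _ (ih (m - 1) (by omega) _ hx)
          · exact TwoSidedIdeal.zero_mem _
        | add _ _ hx hy => rw [map_add]; exact TwoSidedIdeal.add_mem _ hx hy
      have := TwoSidedIdeal.add_mem _ hd' (component_mem_relationIdeal hs m)
      rwa [← map_add, sub_add_cancel] at this
  exact fun t ht => mem_of_component_mem fun m => key m t ht

/-- No nonzero element of a minimal space of relations is decomposable. -/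
lemma eq_zero_of_decomposable {R : ∀ n : ℕ, Submodule k (⨂[k]^n V)}
    (hmin : ∀ S : ∀ n : ℕ, Submodule k (⨂[k]^n V), (∀ n, S n ≤ R n) →
      relationIdeal S = relationIdeal R → ∀ n, 2 ≤ n → S n = R n)
    {n : ℕ} (hn : 2 ≤ n) {r : ⨂[k]^n V} (hr : r ∈ R n)
    (hd : Decomposable (relationIdeal R) (TensorPower.toTensorAlgebra r)) : r = 0 := by
  classical
  by_contra hr0
  obtain ⟨f, hf⟩ : ∃ f : Module.Dual k (⨂[k]^n V), f r ≠ 0 := by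
    by_contra! h
    exact hr0 ((Module.forall_dual_apply_eq_zero_iff k r).1 h)
  -- replace `R n` by a hyperplane that does not contain `r`; by Nakayama's lemma this still
  -- generates, against minimality
  let S : ∀ n : ℕ, Submodule k (⨂[k]^n V) := Function.update R n (R n ⊓ LinearMap.ker f)
  have hS : S n = R n ⊓ LinearMap.ker f := Function.update_self ..
  have hS' : ∀ m, m ≠ n → S m = R m := fun m hm => Function.update_of_ne hm ..
  have hle : ∀ m, S m ≤ R m := fun m => by
    rcases eq_or_ne m n with rfl | hm
    · rw [hS]; exact inf_le_left
    · rw [hS' m hm]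
  have hmono : relationIdeal S ≤ relationIdeal R := by
    refine TwoSidedIdeal.span_mono ?_
    rintro _ ⟨m, hm, s, hs, rfl⟩
    exact ⟨m, hm, s, hle m hs, rfl⟩
  have hgen : relationIdeal S = relationIdeal R := by
    refine le_antisymm hmono (le_relationIdeal ?_)
    intro t ht
    rw [relationIdeal] at ht
    induction ht using TwoSidedIdeal.span_induction with
    | mem x hx =>
      obtain ⟨m, hm, s, hs, rfl⟩ := hx
      rcases eq_or_ne m n with rfl | hmn
      · refine ⟨TensorPower.toTensorAlgebra (s - (f s / f r) • r), TwoSidedIdeal.subset_span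
          ⟨m, hm, _, ?_, rfl⟩, ?_⟩
        · rw [hS]
          refine ⟨Submodule.sub_mem _ hs (Submodule.smul_mem _ _ hr), ?_⟩
          simp [hf]
        · rw [map_sub, sub_sub_cancel, map_smul]
          exact hd.smul _
      · refine ⟨_, TwoSidedIdeal.subset_span ⟨m, hm, s, by rwa [hS' m hmn], rfl⟩, ?_⟩
        rw [sub_self]
        exact .zero
    | zero => exact ⟨0, TwoSidedIdeal.zero_mem _, by rw [sub_self]; exact .zero⟩
    | add x y _ _ hx hy =>
      obtain ⟨s, hs, hd₁⟩ := hx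
      obtain ⟨s', hs', hd₂⟩ := hy
      exact ⟨s + s', TwoSidedIdeal.add_mem _ hs hs', by rw [add_sub_add_comm]; exact .add hd₁ hd₂⟩
    | neg x _ hx =>
      obtain ⟨s, hs, hd₁⟩ := hx
      refine ⟨-s, TwoSidedIdeal.neg_mem _ hs, ?_⟩
      have := hd₁.smul (-1)
      rwa [neg_smul, one_smul, neg_sub, ← neg_sub_neg] at this
    | left_absorb a x _ hx =>
      obtain ⟨s, hs, hd₁⟩ := hx
      exact ⟨a * s, TwoSidedIdeal.mul_mem_left _ _ _ hs, by rw [← mul_sub]; exact hd₁.mul_left a⟩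
    | right_absorb a x _ hx =>
      obtain ⟨s, hs, hd₁⟩ := hx
      exact ⟨s * a, TwoSidedIdeal.mul_mem_right _ _ _ hs, by rw [← sub_mul]; exact hd₁.mul_right a⟩
  have := hmin S hle hgen n hn
  rw [hS] at this
  have hr' := this ▸ hr
  exact hf hr'.2

/-- A linear form on a minimal space of relations extends to the tensor algebra, vanishing on the
decomposable elements of the ideal of relations. -/
lemma exists_dual_extension {R : ∀ n : ℕ, Submodule k (⨂[k]^n V)}
    (hmin : ∀ S : ∀ n : ℕ, Submodule k (⨂[k]^n V), (∀ n, S n ≤ R n) →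
      relationIdeal S = relationIdeal R → ∀ n, 2 ≤ n → S n = R n)
    {n : ℕ} (hn : 2 ≤ n) (ρ : Module.Dual k (R n)) :
    ∃ φ : TensorAlgebra k V →ₗ[k] k,
      (∀ r : R n, φ (TensorPower.toTensorAlgebra (r : ⨂[k]^n V)) = ρ r) ∧
      ∀ t, Decomposable (relationIdeal R) t → φ t = 0 := by
  let N : Submodule k (TensorAlgebra k V) :=
    { carrier := {t | Decomposable (relationIdeal R) t}
      zero_mem' := .zero
      add_mem' := .add
      smul_mem' := fun c _ h => h.smul c }
  let j : R n →ₗ[k] TensorAlgebra k V ⧸ N :=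
    N.mkQ ∘ₗ TensorPower.toTensorAlgebra ∘ₗ (R n).subtype
  have hj : LinearMap.ker j = ⊥ := by
    refine LinearMap.ker_eq_bot'.2 fun r hr => ?_
    have : Decomposable (relationIdeal R) (TensorPower.toTensorAlgebra (r : ⨂[k]^n V)) :=
      (Submodule.Quotient.mk_eq_zero N).1 hr
    exact Subtype.ext (eq_zero_of_decomposable hmin hn r.2 this)
  obtain ⟨g, hg⟩ := LinearMap.exists_leftInverse_of_injective j hj
  refine ⟨ρ ∘ₗ g ∘ₗ N.mkQ, fun r => ?_, fun t ht => ?_⟩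
  · exact congrArg ρ (LinearMap.congr_fun hg r)
  · have : N.mkQ t = 0 := (Submodule.Quotient.mk_eq_zero N).2 ht
    rw [LinearMap.comp_apply, LinearMap.comp_apply, this, map_zero, map_zero]

end TensorAlgebra

/-! ### Forms on `𝔪 ⊗ 𝔪` and the tensor algebra -/

namespace DualBar

open ListCalculus TensorAlgebra

variable {k A : Type*} [Field k] [Ring A] [Algebra k A]
  (𝒜 : ℕ → Submodule k A) [GradedAlgebra 𝒜]

/-- The inclusion of `A_1` into `𝔪`. -/
def inclOne : 𝒜 1 →ₗ[k] augIdeal 𝒜 :=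
  (𝒜 1).subtype.codRestrict _ fun a => mem_augIdeal_of_mem 𝒜 one_ne_zero a.2

lemma coe_inclOne (a : 𝒜 1) : (inclOne 𝒜 a : A) = a := rfl

/-- The projection of `A = k ⊕ 𝔪` onto `𝔪`. -/
def projAug : A →ₗ[k] augIdeal 𝒜 :=
  (LinearMap.id - GradedAlgebra.proj 𝒜 0).codRestrict _ fun a => by
    rw [augIdeal, LinearMap.mem_ker, LinearMap.sub_apply, map_sub, GradedAlgebra.proj_apply,
      GradedAlgebra.proj_apply, LinearMap.id_apply, GradedAlgebra.proj_apply,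
      DirectSum.decompose_of_mem_same 𝒜 (SetLike.coe_mem _), sub_self]

lemma coe_projAug (a : A) : (projAug 𝒜 a : A) = a - DirectSum.decompose 𝒜 a 0 := rfl

lemma projAug_coe (a : augIdeal 𝒜) : projAug 𝒜 a = a := by
  refine Subtype.ext ?_
  have : (DirectSum.decompose 𝒜 (a : A) 0 : A) = 0 := LinearMap.mem_ker.1 a.2
  rw [coe_projAug, this, sub_zero]

lemma projAug_zero {a : A} (ha : a ∈ 𝒜 0) : projAug 𝒜 a = 0 :=
  Subtype.ext (by rw [coe_projAug, DirectSum.decompose_of_mem_same 𝒜 ha, sub_self]; rfl)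

lemma projAug_mem {n : ℕ} {a : A} (ha : a ∈ 𝒜 n) : (projAug 𝒜 a : A) ∈ 𝒜 n := by
  cases n with
  | zero => rw [projAug_zero 𝒜 ha]; exact zero_mem _
  | succ n => rwa [coe_projAug, DirectSum.decompose_of_mem_ne 𝒜 ha (Nat.succ_ne_zero n), sub_zero]

/-- The map `b ↦ a * b` from `A` to `𝔪`, for `a ∈ 𝔪`. -/
def mulRight (a : augIdeal 𝒜) : A →ₗ[k] augIdeal 𝒜 :=
  (LinearMap.mulLeft k (a : A)).codRestrict _ fun _ => mul_mem_augIdeal 𝒜 a.2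

lemma coe_mulRight (a : augIdeal 𝒜) (b : A) : (mulRight 𝒜 a b : A) = a * b := rfl

lemma mulRight_coe (a b : augIdeal 𝒜) : mulRight 𝒜 a b = μ 𝒜 a b := rfl

lemma formTwo_apply (z : BarForm 𝒜 2) (a b : augIdeal 𝒜) : formTwo 𝒜 z a b = z ![a, b] := rfl

/-- The form `z` on `𝔪 ⊗ 𝔪`, restricted to `A_1 ⊗ 𝔪` and pulled back to the tensor algebra: the
linear form `φ` with `φ 1 = 0` and `φ (v * t) = z [v | t]`. -/
def pullback (z : BarForm 𝒜 2) : TensorAlgebra k (𝒜 1) →ₗ[k] k :=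
  leftRec ((formTwo 𝒜 z).compl₁₂ (inclOne 𝒜) (projAug 𝒜 ∘ₗ (tensorToAlg 𝒜).toLinearMap))

lemma pullback_one (z : BarForm 𝒜 2) : pullback 𝒜 z 1 = 0 := leftRec_one _

lemma pullback_ι_mul (z : BarForm 𝒜 2) (v : 𝒜 1) (t : TensorAlgebra k (𝒜 1)) :
    pullback 𝒜 z (ι k v * t) = z ![inclOne 𝒜 v, projAug 𝒜 (tensorToAlg 𝒜 t)] :=
  leftRec_ι_mul _ v t

lemma pullback_add (z z' : BarForm 𝒜 2) : pullback 𝒜 (z + z') = pullback 𝒜 z + pullback 𝒜 z' :=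
  left_ext (by simp [pullback_one]) fun v t => by simp [pullback_ι_mul]

lemma pullback_smul (c : k) (z : BarForm 𝒜 2) : pullback 𝒜 (c • z) = c • pullback 𝒜 z :=
  left_ext (by simp [pullback_one]) fun v t => by simp [pullback_ι_mul]

omit [GradedAlgebra 𝒜] in
lemma tensorToAlg_ι (v : 𝒜 1) : tensorToAlg 𝒜 (ι k v) = v := by simp [tensorToAlg]

lemma restrictTwo_eq (n : ℕ) (z : BarForm 𝒜 2) (r : ⨂[k]^(n + 2) (𝒜 1)) :
    restrictTwo 𝒜 n z r = pullback 𝒜 z (TensorPower.toTensorAlgebra r) := by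
  refine LinearMap.congr_fun (f := restrictTwo 𝒜 n z)
    (g := pullback 𝒜 z ∘ₗ TensorPower.toTensorAlgebra) (PiTensorProduct.ext ?_) r
  ext a
  simp only [LinearMap.compMultilinearMap_apply, LinearMap.comp_apply,
    TensorPower.toTensorAlgebra_tprod, tprod_apply, restrictTwo, PiTensorProduct.lift.tprod,
    headTailForm_apply]
  rw [List.ofFn_succ, List.prod_cons, pullback_ι_mul]
  congr 2
  have h : tensorToAlg 𝒜 (List.ofFn fun i : Fin (n + 1) => ι k (a i.succ)).prod =
      (tailProduct 𝒜 n (fun i => a i.succ) : A) := by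
    rw [map_list_prod, List.map_ofFn]
    simp only [Function.comp_def, tensorToAlg_ι]
    rfl
  rw [h, projAug_coe]

/-! ### Embedding the algebra into the tensor algebra -/

/-- The embedding of `A` into the tensor algebra with components `θ`. -/
def embed (θ : ∀ n : ℕ, 𝒜 n →ₗ[k] ⨂[k]^n (𝒜 1)) : A →ₗ[k] TensorAlgebra k (𝒜 1) :=
  DirectSum.toModule k ℕ _ (fun n => TensorPower.toTensorAlgebra ∘ₗ θ n) ∘ₗ
    (DirectSum.decomposeLinearEquiv 𝒜).toLinearMap

variable (θ : ∀ n : ℕ, 𝒜 n →ₗ[k] ⨂[k]^n (𝒜 1))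

lemma embed_coe {n : ℕ} (a : 𝒜 n) : embed 𝒜 θ a = TensorPower.toTensorAlgebra (θ n a) := by
  rw [embed, LinearMap.comp_apply, LinearEquiv.coe_coe, DirectSum.decomposeLinearEquiv_apply,
    DirectSum.decompose_coe]
  exact DirectSum.toModule_lof (M := fun n => 𝒜 n) k n a

variable {θ}

lemma tensorToAlg_embed (hθ : IsTensorEmbedding 𝒜 θ) (a : A) :
    tensorToAlg 𝒜 (embed 𝒜 θ a) = a := by
  induction a using DirectSum.Decomposition.inductionOn 𝒜 with
  | zero => simp
  | homogeneous a => rw [embed_coe, hθ.split]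
  | add a b ha hb => rw [map_add, map_add, ha, hb]

lemma embed_mem_genTensor (hθ : IsTensorEmbedding 𝒜 θ) {n : ℕ} {a : A} (ha : a ∈ 𝒜 (n + 1)) :
    embed 𝒜 θ a ∈ genTensor 𝒜 (θ n) := by
  rw [embed_coe 𝒜 θ (⟨a, ha⟩ : 𝒜 (n + 1))]
  exact hθ.recursive n _

lemma genTensor_induction {n : ℕ} {P : TensorAlgebra k (𝒜 1) → Prop} {t : TensorAlgebra k (𝒜 1)}
    (ht : t ∈ genTensor 𝒜 (θ n)) (h : ∀ v, ∀ a ∈ 𝒜 n, P (ι k v * embed 𝒜 θ a))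
    (hadd : ∀ s t, P s → P t → P (s + t)) : P t := by
  refine Submodule.mul_induction_on ht ?_ hadd
  rintro _ ⟨v, rfl⟩ _ ⟨a, rfl⟩
  rw [LinearMap.comp_apply, ← embed_coe]
  exact h v a a.2

lemma eq_zero_of_mem_zero {a : augIdeal 𝒜} (ha : (a : A) ∈ 𝒜 0) : a = 0 := by
  rw [← projAug_coe 𝒜 a, projAug_zero 𝒜 ha]

/-- The augmentation ideal is spanned by products with left factor in `A_1`. -/
lemma augIdeal_ext (hθ : IsTensorEmbedding 𝒜 θ) {M : Type*} [AddCommGroup M] [Module k M]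
    {f g : augIdeal 𝒜 →ₗ[k] M}
    (h : ∀ v n, ∀ a ∈ 𝒜 n, f (mulRight 𝒜 (inclOne 𝒜 v) a) = g (mulRight 𝒜 (inclOne 𝒜 v) a)) :
    f = g := by
  ext a
  induction a using augIdeal_induction with
  | h0 => simp
  | hadd a b ha hb => rw [map_add, map_add, ha, hb]
  | h t a ha =>
    cases t with
    | zero => rw [eq_zero_of_mem_zero 𝒜 ha, map_zero, map_zero]
    | succ n =>
      have key : ∀ t ∈ genTensor 𝒜 (θ n), f (projAug 𝒜 (tensorToAlg 𝒜 t)) =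
          g (projAug 𝒜 (tensorToAlg 𝒜 t)) := by
        intro t ht
        refine genTensor_induction 𝒜 (P := fun t => f (projAug 𝒜 (tensorToAlg 𝒜 t)) =
          g (projAug 𝒜 (tensorToAlg 𝒜 t))) ht (fun v a ha => ?_) fun s t hs ht => ?_
        · rw [map_mul, tensorToAlg_ι, tensorToAlg_embed 𝒜 hθ]
          have := h v n a ha
          rwa [← projAug_coe 𝒜 (mulRight 𝒜 (inclOne 𝒜 v) a), coe_mulRight, coe_inclOne] at this
        · simp only [map_add, hs, ht]
      have := key _ (embed_mem_genTensor 𝒜 hθ ha)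
      rwa [tensorToAlg_embed 𝒜 hθ, projAug_coe] at this

/-- The embedding of `A` into the tensor algebra is the identity on `A_0 = k`. -/
lemma embed_mem_zero (h₀ : 𝒜 0 = 1) (hθ : IsTensorEmbedding 𝒜 θ) {a : A} (ha : a ∈ 𝒜 0) :
    ∃ c : k, embed 𝒜 θ a = algebraMap k _ c ∧ a = algebraMap k A c := by
  obtain ⟨c, rfl⟩ := Submodule.mem_one.1 (h₀ ▸ ha : a ∈ (1 : Submodule k A))
  obtain ⟨e, he⟩ : ∃ e : k, embed 𝒜 θ (algebraMap k A c) = algebraMap k _ e := by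
    rw [embed_coe 𝒜 θ (⟨_, ha⟩ : 𝒜 0)]
    generalize θ 0 _ = t
    refine ⟨PiTensorProduct.isEmptyEquiv (Fin 0) t, ?_⟩
    induction t using PiTensorProduct.induction_on with
    | smul_tprod r f =>
      rw [map_smul, TensorPower.toTensorAlgebra_tprod]
      simp [Algebra.algebraMap_eq_smul_one]
    | add x y hx hy => rw [map_add, hx, hy, map_add, map_add]
  have h := tensorToAlg_embed 𝒜 hθ (algebraMap k A c)
  rw [he, AlgHom.commutes] at h
  exact ⟨e, he, h.symm⟩

lemma embed_one (h₀ : 𝒜 0 = 1) (hθ : IsTensorEmbedding 𝒜 θ) (v : 𝒜 1) :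
    embed 𝒜 θ v = ι k v := by
  obtain ⟨w, hw⟩ : ∃ w, embed 𝒜 θ v = ι k w := by
    refine genTensor_induction 𝒜 (P := fun t => ∃ w, t = ι k w)
      (embed_mem_genTensor 𝒜 hθ (n := 0) v.2) (fun u a ha => ?_) ?_
    · obtain ⟨c, hc, -⟩ := embed_mem_zero 𝒜 h₀ hθ ha
      exact ⟨c • u, by rw [hc, ← Algebra.commutes, ← Algebra.smul_def, map_smul]⟩
    · rintro _ _ ⟨s, rfl⟩ ⟨t, rfl⟩
      exact ⟨s + t, (map_add _ _ _).symm⟩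
  have h := tensorToAlg_embed 𝒜 hθ (v : A)
  rw [hw, tensorToAlg_ι] at h
  rw [hw, Subtype.ext h]

/-! ### Cocycles in degree two -/

/-- The cocycle condition for a form on `𝔪 ⊗ 𝔪`. -/
def IsCocycleTwo (z : BarForm 𝒜 2) : Prop :=
  ∀ a b c, z ![μ 𝒜 a b, c] = z ![a, μ 𝒜 b c]

lemma barEval_pair (a b : augIdeal 𝒜) (x : BarDual 𝒜) :
    barEval 𝒜 [a, b] x = -(x 2 : BarForm 𝒜 2) ![a, b] := by
  have e : (fun i : Fin 2 => [a, b].getD (i : ℕ) 0) = ![a, b] := by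
    funext i; fin_cases i <;> rfl
  rw [barEval_of_length 𝒜 (p := 2) rfl, e]
  simp

lemma barEval_single (a : augIdeal 𝒜) (x : BarDual 𝒜) :
    barEval 𝒜 [a] x = (x 1 : BarForm 𝒜 1) (fun _ => a) := by
  have e : (fun i : Fin 1 => [a].getD (i : ℕ) 0) = fun _ => a := by
    funext i; fin_cases i; rfl
  rw [barEval_of_length 𝒜 (p := 1) rfl, e]
  simp

lemma barD_two (x : BarDual 𝒜) (a b : augIdeal 𝒜) :
    (barD 𝒜 x 2 : BarForm 𝒜 2) ![a, b] = -(x 1 : BarForm 𝒜 1) (fun _ => μ 𝒜 a b) := by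
  rw [← barEval_single, ← neg_neg ((barD 𝒜 x 2 : BarForm 𝒜 2) ![a, b]), ← barEval_pair,
    barEval_barD]
  simp [delta]

lemma isCocycleTwo_of_barD {x : BarDual 𝒜} (hx : barD 𝒜 x = 0) :
    IsCocycleTwo 𝒜 (x 2 : BarForm 𝒜 2) := by
  intro a b c
  have h := barEval_barD 𝒜 [a, b, c] x
  rw [hx, map_zero] at h
  simp only [delta, barEval_pair] at h
  linear_combination h

lemma barD_lof_two {z : barCochain 𝒜 2} (hz : IsCocycleTwo 𝒜 (z : BarForm 𝒜 2)) :
    barD 𝒜 (lof 𝒜 2 z) = 0 := by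
  refine ext_barEval 𝒜 fun l => ?_
  rw [barEval_barD, map_zero]
  have h₂ : (lof 𝒜 2 z : BarDual 𝒜) 2 = z :=
    DirectSum.lof_apply (M := fun p => barCochain 𝒜 p) k 2 z
  match l with
  | [] => rfl
  | [a] => rfl
  | [a, b] =>
    simp [delta, barEval_lof]
  | [a, b, c] =>
    simp only [delta, barEval_pair, h₂, hz a b c]
    ring
  | a :: b :: c :: d :: l =>
    rw [delta_eq_sum]
    refine Finset.sum_eq_zero fun j hj => ?_
    rw [Finset.mem_range] at hj
    have := length_contractList (μ 𝒜) (j := j) (l := a :: b :: c :: d :: l) (by omega)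
    rw [barEval_lof, if_neg, mul_zero]
    simp only [List.length_cons] at this
    omega

lemma barD_lof_one {f : barCochain 𝒜 1}
    (hf : ∀ a b, (f : BarForm 𝒜 1) (fun _ => μ 𝒜 a b) = 0) : barD 𝒜 (lof 𝒜 1 f) = 0 := by
  refine ext_barEval 𝒜 fun l => ?_
  rw [barEval_barD, map_zero]
  have h₂ : (lof 𝒜 1 f : BarDual 𝒜) 1 = f :=
    DirectSum.lof_apply (M := fun p => barCochain 𝒜 p) k 1 f
  match l with
  | [] => rfl
  | [a] => rfl
  | [a, b] => simp only [delta, barEval_single, h₂, hf a b, sub_zero]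
  | a :: b :: c :: l =>
    rw [delta_eq_sum]
    refine Finset.sum_eq_zero fun j hj => ?_
    rw [Finset.mem_range] at hj
    have := length_contractList (μ 𝒜) (j := j) (l := a :: b :: c :: l) (by omega)
    rw [barEval_lof, if_neg, mul_zero]
    simp only [List.length_cons] at this
    omega

/-- The cocycle condition remains true if the middle factor is taken from `A = k ⊕ 𝔪`. -/
lemma IsCocycleTwo.mul_middle (h₀ : 𝒜 0 = 1) {z : BarForm 𝒜 2} (hz : IsCocycleTwo 𝒜 z)
    (a : augIdeal 𝒜) (b : A) (c : augIdeal 𝒜) :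
    z ![mulRight 𝒜 a b, c] = z ![a, projAug 𝒜 (b * c)] := by
  simp only [← formTwo_apply]
  have hb : b = (DirectSum.decompose 𝒜 b 0 : A) + projAug 𝒜 b := by rw [coe_projAug]; abel
  obtain ⟨e, he⟩ : ∃ e : k, algebraMap k A e = DirectSum.decompose 𝒜 b 0 := by
    have : (DirectSum.decompose 𝒜 b 0 : A) ∈ (1 : Submodule k A) := h₀ ▸ SetLike.coe_mem _
    exact Submodule.mem_one.1 this
  rw [hb, ← he]
  have h₁ : mulRight 𝒜 a (algebraMap k A e) = e • a :=
    Subtype.ext (by rw [coe_mulRight, ← Algebra.commutes, ← Algebra.smul_def]; rfl)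
  have h₂ : projAug 𝒜 ((projAug 𝒜 b : A) * c) = μ 𝒜 (projAug 𝒜 b) c :=
    projAug_coe 𝒜 (μ 𝒜 (projAug 𝒜 b) c)
  rw [map_add, h₁, mulRight_coe, add_mul, map_add, ← Algebra.smul_def, map_add (projAug 𝒜),
    map_smul (projAug 𝒜),
    projAug_coe, h₂]
  simp only [map_add, map_smul, LinearMap.add_apply, LinearMap.smul_apply]
  rw [formTwo_apply _ _ (μ 𝒜 a (projAug 𝒜 b)), hz]
  rfl

/-- The pullback of a cocycle satisfies the same recursion on the right as on the left. -/
lemma IsCocycleTwo.pullback_mul_ι (h₀ : 𝒜 0 = 1) {z : BarForm 𝒜 2} (hz : IsCocycleTwo 𝒜 z)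
    (t : TensorAlgebra k (𝒜 1)) (v : 𝒜 1) :
    pullback 𝒜 z (t * ι k v) = z ![projAug 𝒜 (tensorToAlg 𝒜 t), inclOne 𝒜 v] := by
  refine LinearMap.congr_fun (f := pullback 𝒜 z ∘ₗ LinearMap.mulRight k (ι k v))
    (g := (formTwo 𝒜 z).flip (inclOne 𝒜 v) ∘ₗ projAug 𝒜 ∘ₗ (tensorToAlg 𝒜).toLinearMap)
    (left_ext ?_ fun w t => ?_) t
  · have h1 : projAug 𝒜 (1 : A) = 0 := projAug_zero 𝒜 SetLike.GradedOne.one_mem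
    have := pullback_ι_mul 𝒜 z v 1
    rw [mul_one, map_one, h1, ← formTwo_apply, map_zero] at this
    simp [this, h1]
  · simp only [LinearMap.comp_apply, LinearMap.mulRight_apply, LinearMap.flip_apply,
      AlgHom.toLinearMap_apply, map_mul, tensorToAlg_ι, formTwo_apply]
    rw [mul_assoc, pullback_ι_mul, map_mul, tensorToAlg_ι]
    have h := hz.mul_middle 𝒜 h₀ (inclOne 𝒜 w) (tensorToAlg 𝒜 t) (inclOne 𝒜 v)
    rw [coe_inclOne, ← projAug_coe 𝒜 (mulRight 𝒜 (inclOne 𝒜 w) _), coe_mulRight,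
      coe_inclOne] at h
    exact h.symm

/-- A two-cocycle whose pullback vanishes on the relations has a pullback that vanishes on the
whole kernel of `T(A_1) → A`. -/
lemma IsCocycleTwo.pullback_eq_zero (h₀ : 𝒜 0 = 1) {z : BarForm 𝒜 2} (hz : IsCocycleTwo 𝒜 z)
    {R : ∀ n : ℕ, Submodule k (⨂[k]^n (𝒜 1))}
    (hR : relationIdeal R = TwoSidedIdeal.ker (tensorToAlg 𝒜))
    (h : ∀ n, 2 ≤ n → ∀ r ∈ R n, pullback 𝒜 z (TensorPower.toTensorAlgebra r) = 0)
    {t : TensorAlgebra k (𝒜 1)} (ht : tensorToAlg 𝒜 t = 0) : pullback 𝒜 z t = 0 := by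
  have hker : ∀ x, x ∈ relationIdeal R ↔ tensorToAlg 𝒜 x = 0 := fun x => by
    rw [hR, TwoSidedIdeal.mem_ker]
  have ht' := (hker t).2 ht
  clear ht
  rw [relationIdeal] at ht'
  induction ht' using TwoSidedIdeal.span_induction with
  | mem x hx => obtain ⟨n, hn, r, hr, rfl⟩ := hx; exact h n hn r hr
  | zero => exact map_zero _
  | add x y _ _ hx hy => rw [map_add, hx, hy, add_zero]
  | neg x _ hx => rw [map_neg, hx, neg_zero]
  | left_absorb a x hx' hx =>
    have hx₀ := (hker x).1 hx'
    refine LinearMap.congr_fun (f := pullback 𝒜 z ∘ₗ LinearMap.mulRight k x) (g := 0)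
      (left_ext ?_ fun v t => ?_) a
    · simpa using hx
    · rw [LinearMap.comp_apply, LinearMap.mulRight_apply, mul_assoc, pullback_ι_mul, map_mul, hx₀,
        mul_zero, map_zero, ← formTwo_apply, map_zero, LinearMap.zero_apply]
  | right_absorb a x hx' hx =>
    have hx₀ := (hker x).1 hx'
    clear hx'
    induction a using TensorAlgebra.induction generalizing x with
    | algebraMap c => rw [← Algebra.commutes, ← Algebra.smul_def, map_smul, hx, smul_zero]
    | ι v => rw [hz.pullback_mul_ι 𝒜 h₀, hx₀, map_zero, ← formTwo_apply, map_zero,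
        LinearMap.zero_apply]
    | mul a b ha hb =>
      rw [← mul_assoc]
      exact hb _ (ha _ hx hx₀) (by rw [map_mul, hx₀, zero_mul])
    | add a b ha hb => rw [mul_add, map_add, ha _ hx hx₀, hb _ hx hx₀, add_zero]

/-- A two-cocycle whose pullback vanishes on the kernel of `T(A_1) → A` factors through the
multiplication of `𝔪`, hence is a coboundary. -/
lemma IsCocycleTwo.eq_pullback_embed (h₀ : 𝒜 0 = 1) (hθ : IsTensorEmbedding 𝒜 θ)
    {z : BarForm 𝒜 2} (hz : IsCocycleTwo 𝒜 z)
    (h : ∀ t, tensorToAlg 𝒜 t = 0 → pullback 𝒜 z t = 0) (a b : augIdeal 𝒜) :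
    z ![a, b] = pullback 𝒜 z (embed 𝒜 θ (a * b)) := by
  have key : ∀ (v : 𝒜 1) (c : A),
      pullback 𝒜 z (embed 𝒜 θ (v * c)) = z ![inclOne 𝒜 v, projAug 𝒜 c] := fun v c => by
    have h₁ := h (embed 𝒜 θ (v * c) - ι k v * embed 𝒜 θ c) (by
      rw [map_sub, map_mul (tensorToAlg 𝒜), tensorToAlg_ι, tensorToAlg_embed 𝒜 hθ,
        tensorToAlg_embed 𝒜 hθ, sub_self])
    rwa [map_sub, sub_eq_zero, pullback_ι_mul, tensorToAlg_embed 𝒜 hθ] at h₁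
  refine LinearMap.congr_fun (f := (formTwo 𝒜 z).flip b)
    (g := pullback 𝒜 z ∘ₗ embed 𝒜 θ ∘ₗ LinearMap.mulRight k (b : A) ∘ₗ (augIdeal 𝒜).subtype)
    (augIdeal_ext 𝒜 hθ fun v n c _ => ?_) a
  simp only [LinearMap.flip_apply, formTwo_apply, LinearMap.comp_apply, LinearMap.mulRight_apply,
    Submodule.subtype_apply, coe_mulRight, coe_inclOne]
  rw [hz.mul_middle 𝒜 h₀, mul_assoc, key]

/-- On `A_1 ⊗ A_n` with `n ≥ 1`, a coboundary is given by the multiplication `A_1 ⊗ A_n → A`. -/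
lemma pullback_barD (x : BarDual 𝒜) {n : ℕ} {t : TensorAlgebra k (𝒜 1)}
    (ht : t ∈ genTensor 𝒜 (θ (n + 1))) (hθ : IsTensorEmbedding 𝒜 θ) :
    pullback 𝒜 (barD 𝒜 x 2 : BarForm 𝒜 2) t =
      -(x 1 : BarForm 𝒜 1) (fun _ => projAug 𝒜 (tensorToAlg 𝒜 t)) := by
  let f : augIdeal 𝒜 →ₗ[k] k := (MultilinearMap.ofSubsingleton k _ k (0 : Fin 1)).symm (x 1).1
  have hf : ∀ a, (x 1 : BarForm 𝒜 1) (fun _ => a) = f a := fun a => rfl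
  rw [hf]
  refine genTensor_induction 𝒜 (P := fun t => pullback 𝒜 (barD 𝒜 x 2 : BarForm 𝒜 2) t =
    -f (projAug 𝒜 (tensorToAlg 𝒜 t))) ht (fun v a ha => ?_) fun s t hs ht => ?_
  · have ha' := mem_augIdeal_of_mem 𝒜 (Nat.succ_ne_zero n) ha
    rw [pullback_ι_mul, tensorToAlg_embed 𝒜 hθ, barD_two, hf, map_mul, tensorToAlg_ι,
      tensorToAlg_embed 𝒜 hθ, projAug_coe 𝒜 ⟨a, ha'⟩]
    congr 2
    exact (projAug_coe 𝒜 (μ 𝒜 (inclOne 𝒜 v) ⟨a, ha'⟩)).symm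
  · rw [map_add, hs, ht, map_add, map_add, map_add, neg_add]

/-- If `z` vanishes on `A_1 ⊗ A_n`, then its pullback vanishes on the image of `A_{n+1}`. -/
lemma pullback_embed_eq_zero (hθ : IsTensorEmbedding 𝒜 θ) {z : BarForm 𝒜 2} {m : ℕ}
    (h : ∀ n (v : 𝒜 1) (b : augIdeal 𝒜), n + 1 = m → (b : A) ∈ 𝒜 n → z ![inclOne 𝒜 v, b] = 0)
    {a : augIdeal 𝒜} (ha : (a : A) ∈ 𝒜 m) : pullback 𝒜 z (embed 𝒜 θ a) = 0 := by
  cases m with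
  | zero => rw [eq_zero_of_mem_zero 𝒜 ha]; simp
  | succ n =>
    refine genTensor_induction 𝒜 (P := fun t => pullback 𝒜 z t = 0)
      (embed_mem_genTensor 𝒜 hθ ha) (fun v b hb => ?_) fun s t hs ht => by
        rw [map_add, hs, ht, add_zero]
    rw [pullback_ι_mul, tensorToAlg_embed 𝒜 hθ]
    exact h n v _ rfl (projAug_mem 𝒜 hb)

/-! ### The homotopy in degree two -/

/-- The functional `a ↦ -z (ξ a)` on `𝔪`, where `ξ : A_n → A_1 ⊗ A_{n-1}` are the splittings of the
multiplication maps underlying `θ`. -/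
def homotopyForm (θ : ∀ n : ℕ, 𝒜 n →ₗ[k] ⨂[k]^n (𝒜 1)) : BarForm 𝒜 2 →ₗ[k] BarForm 𝒜 1 where
  toFun z := MultilinearMap.ofSubsingleton k _ k (0 : Fin 1)
    (-(pullback 𝒜 z ∘ₗ embed 𝒜 θ ∘ₗ (augIdeal 𝒜).subtype))
  map_add' z z' := by
    ext a
    simp [pullback_add, add_comm]
  map_smul' c z := by
    ext a
    simp [pullback_smul]

lemma homotopyForm_apply (z : BarForm 𝒜 2) (a : Fin 1 → augIdeal 𝒜) :
    homotopyForm 𝒜 θ z a = -pullback 𝒜 z (embed 𝒜 θ (a 0)) := rfl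

lemma homotopyForm_mem (hθ : IsTensorEmbedding 𝒜 θ) {z : BarForm 𝒜 2} (hz : z ∈ barCochain 𝒜 2) :
    homotopyForm 𝒜 θ z ∈ barCochain 𝒜 1 := by
  obtain ⟨N, hN⟩ := hz
  refine ⟨N, fun s a ha hs => ?_⟩
  rw [homotopyForm_apply, pullback_embed_eq_zero 𝒜 hθ ?_ (ha 0), neg_zero]
  intro n v b hn hb
  refine hN ![1, n] _ (fun i => ?_) ?_
  · fin_cases i
    · exact v.2
    · exact hb
  · simp at hs ⊢
    omega

/-- The homotopy `z ↦ -z ∘ ξ` from cohomological degree `2` to degree `1`. -/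
def homotopyTwo (hθ : IsTensorEmbedding 𝒜 θ) : BarDual 𝒜 →ₗ[k] BarDual 𝒜 :=
  lof 𝒜 1 ∘ₗ (homotopyForm 𝒜 θ).restrict (fun _ hz => homotopyForm_mem 𝒜 hθ hz) ∘ₗ
    DirectSum.component k ℕ (fun p => barCochain 𝒜 p) 2

lemma homotopyTwo_one (hθ : IsTensorEmbedding 𝒜 θ) (x : BarDual 𝒜) (a : augIdeal 𝒜) :
    (homotopyTwo 𝒜 hθ x 1 : BarForm 𝒜 1) (fun _ => a) =
      -pullback 𝒜 (x 2 : BarForm 𝒜 2) (embed 𝒜 θ a) := by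
  rw [homotopyTwo, LinearMap.comp_apply, DirectSum.lof_apply]
  rfl

lemma homotopyTwo_eq_zero (hθ : IsTensorEmbedding 𝒜 θ) (x : BarDual 𝒜) {p : ℕ} (hp : p ≠ 1) :
    homotopyTwo 𝒜 hθ x p = 0 := by
  rw [homotopyTwo, LinearMap.comp_apply, DirectSum.lof_eq_of, DirectSum.of_eq_of_ne _ _ _ hp]

lemma homotopyTwo_mem (hθ : IsTensorEmbedding 𝒜 θ) {x : BarDual 𝒜} {s : ℤ}
    (hx : x ∈ barBigrading 𝒜 2 s) : homotopyTwo 𝒜 hθ x ∈ barBigrading 𝒜 1 s := by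
  intro q t a ha h
  rcases eq_or_ne q 1 with rfl | hq
  · have e : a = fun _ => a 0 := funext fun i => by rw [Subsingleton.elim i 0]
    rw [e, homotopyTwo_one, pullback_embed_eq_zero 𝒜 hθ ?_ (ha 0), neg_zero]
    intro n v b hn hb
    refine hx 2 ![1, n] _ (fun i => ?_) fun hs => h ⟨rfl, ?_⟩
    · fin_cases i
      · exact v.2
      · exact hb
    · rw [← hs.2]
      simp
      omega
  · rw [homotopyTwo_eq_zero 𝒜 hθ x hq]
    rfl

/-- The values of the homotopy vanish on `A_1`. -/
lemma homotopyTwo_inclOne (h₀ : 𝒜 0 = 1) (hθ : IsTensorEmbedding 𝒜 θ) (x : BarDual 𝒜) (v : 𝒜 1) :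
    (homotopyTwo 𝒜 hθ x 1 : BarForm 𝒜 1) (fun _ => inclOne 𝒜 v) = 0 := by
  rw [homotopyTwo_one, coe_inclOne, embed_one 𝒜 h₀ hθ, ← mul_one (ι k v), pullback_ι_mul, map_one,
    projAug_zero 𝒜 SetLike.GradedOne.one_mem, ← formTwo_apply, map_zero, neg_zero]

/-- In Adams degrees `≥ 2` the homotopy is a left inverse of the differential. -/
lemma homotopyTwo_barD (hθ : IsTensorEmbedding 𝒜 θ) (x : BarDual 𝒜) {n : ℕ} {a : augIdeal 𝒜}
    (ha : (a : A) ∈ 𝒜 (n + 2)) :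
    (homotopyTwo 𝒜 hθ (barD 𝒜 x) 1 : BarForm 𝒜 1) (fun _ => a) =
      (x 1 : BarForm 𝒜 1) (fun _ => a) := by
  rw [homotopyTwo_one, pullback_barD 𝒜 x (embed_mem_genTensor 𝒜 hθ ha) hθ, neg_neg,
    tensorToAlg_embed 𝒜 hθ, projAug_coe]

/-- Forms of cohomological degree one are determined on homogeneous elements. -/
lemma ext_one {f g : BarForm 𝒜 1}
    (h : ∀ n (a : augIdeal 𝒜), (a : A) ∈ 𝒜 n → f (fun _ => a) = g (fun _ => a)) : f = g :=
  ext_homogeneous 𝒜 fun t a ha => by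
    have e : a = fun _ => a 0 := funext fun i => by rw [Subsingleton.elim i 0]
    rw [e, h _ _ (ha 0)]

lemma apply_zero_one (f : BarForm 𝒜 1) : f (fun _ => 0) = 0 := f.map_coord_zero 0 rfl

lemma homotopyTwo_barD_homotopyTwo (h₀ : 𝒜 0 = 1) (hθ : IsTensorEmbedding 𝒜 θ) (x : BarDual 𝒜) :
    homotopyTwo 𝒜 hθ (barD 𝒜 (homotopyTwo 𝒜 hθ x)) = homotopyTwo 𝒜 hθ x := by
  refine DFinsupp.ext fun p => ?_
  rcases eq_or_ne p 1 with rfl | hp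
  · refine Subtype.ext (ext_one 𝒜 fun n a ha => ?_)
    match n with
    | 0 => rw [eq_zero_of_mem_zero 𝒜 ha, apply_zero_one, apply_zero_one]
    | 1 =>
      have := homotopyTwo_inclOne 𝒜 h₀ hθ x ⟨a, ha⟩
      have h' := homotopyTwo_inclOne 𝒜 h₀ hθ (barD 𝒜 (homotopyTwo 𝒜 hθ x)) ⟨a, ha⟩
      exact h'.trans this.symm
    | n + 2 => exact homotopyTwo_barD 𝒜 hθ _ ha
  · exact (homotopyTwo_eq_zero 𝒜 hθ _ hp).trans (homotopyTwo_eq_zero 𝒜 hθ _ hp).symm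

/-- A form of cohomological degree one that vanishes in Adams degrees `≥ 2` vanishes on products. -/
lemma apply_mul_eq_zero {f : BarForm 𝒜 1}
    (h : ∀ n (a : augIdeal 𝒜), (a : A) ∈ 𝒜 (n + 2) → f (fun _ => a) = 0) (a b : augIdeal 𝒜) :
    f (fun _ => μ 𝒜 a b) = 0 := by
  let g : augIdeal 𝒜 →ₗ[k] k := (MultilinearMap.ofSubsingleton k _ k (0 : Fin 1)).symm f
  change g (augMul 𝒜 a b) = 0
  induction a using augIdeal_induction with
  | h0 => simp
  | hadd a a' ha ha' => rw [map_add, LinearMap.add_apply, map_add, ha, ha', add_zero]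
  | h m a ha =>
    induction b using augIdeal_induction with
    | h0 => simp
    | hadd b b' hb hb' => rw [map_add, map_add, hb, hb', add_zero]
    | h n b hb =>
      match m, n with
      | 0, n => rw [eq_zero_of_mem_zero 𝒜 ha, map_zero, LinearMap.zero_apply, map_zero]
      | m, 0 => rw [eq_zero_of_mem_zero 𝒜 hb, map_zero, map_zero]
      | m + 1, n + 1 =>
        refine h (m + n) _ ?_
        have := SetLike.mul_mem_graded ha hb
        rwa [show m + 1 + (n + 1) = m + n + 2 by omega] at this

lemma barD_eq_zero_of_mem {x : BarDual 𝒜} {s : ℤ} (hx : x ∈ barBigrading 𝒜 1 s)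
    (h : ∀ n (a : augIdeal 𝒜), (a : A) ∈ 𝒜 (n + 2) → (x 1 : BarForm 𝒜 1) (fun _ => a) = 0) :
    barD 𝒜 x = 0 := by
  have e : x = lof 𝒜 1 (x 1) := DFinsupp.ext fun p => by
    rcases eq_or_ne p 1 with rfl | hp
    · exact (DirectSum.lof_apply (M := fun p => barCochain 𝒜 p) k 1 (x 1)).symm
    · rw [apply_eq_zero_of_mem 𝒜 hx (by exact_mod_cast hp)]
      exact (DirectSum.of_eq_of_ne (β := fun p => barCochain 𝒜 p) _ _ (x 1) hp).symm
  rw [e]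
  exact barD_lof_one 𝒜 (apply_mul_eq_zero 𝒜 h)

lemma barD_homotopyTwo_barD (hθ : IsTensorEmbedding 𝒜 θ) {x : BarDual 𝒜} {s : ℤ}
    (hx : x ∈ barBigrading 𝒜 1 s) :
    barD 𝒜 (homotopyTwo 𝒜 hθ (barD 𝒜 x)) = barD 𝒜 x := by
  rw [← sub_eq_zero, ← map_sub]
  have hm := Submodule.sub_mem _ (homotopyTwo_mem 𝒜 hθ (barD_mem 𝒜 hx)) hx
  refine barD_eq_zero_of_mem 𝒜 hm fun n a ha => ?_
  rw [DirectSum.sub_apply, Submodule.coe_sub, sub_apply, homotopyTwo_barD 𝒜 hθ x ha, sub_self]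

end DualBar

/-! ### The decomposition by Adams degree -/

/-- Linear maps on the summands of an internal direct sum glue. -/
lemma DirectSum.IsInternal.exists_linearMap {k ι M N : Type*} [DecidableEq ι] [CommRing k]
    [AddCommGroup M] [Module k M] [AddCommGroup N] [Module k N] {G : ι → Submodule k M}
    (hG : DirectSum.IsInternal G) (h : ∀ i, G i →ₗ[k] N) :
    ∃ f : M →ₗ[k] N, ∀ i (x : G i), f x = h i x := by
  let e := LinearEquiv.ofBijective (DirectSum.coeLinearMap G) hG
  refine ⟨DirectSum.toModule k ι N h ∘ₗ e.symm.toLinearMap, fun i x => ?_⟩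
  have : e.symm x = DirectSum.lof k ι (fun i => G i) i x := by
    rw [LinearEquiv.symm_apply_eq]
    exact (DirectSum.coeLinearMap_lof G i x).symm
  rw [LinearMap.comp_apply, LinearEquiv.coe_coe, this, DirectSum.toModule_lof]

namespace DualBar

open ListCalculus TensorAlgebra

variable {k A : Type*} [Field k] [Ring A] [Algebra k A]
  (𝒜 : ℕ → Submodule k A) [GradedAlgebra 𝒜]

/-- The part of a form of Adams degree `-s`: the form agrees with it on tensors of degree `s`. -/
def adamsForm (p s : ℕ) : BarForm 𝒜 p →ₗ[k] BarForm 𝒜 p :=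
  ∑ t ∈ Finset.finAntidiagonal p s, MultilinearMap.compLinearMapₗ (fun i => augProj 𝒜 (t i))

lemma adamsForm_apply {p : ℕ} (s : ℕ) (f : BarForm 𝒜 p) {t : Fin p → ℕ} {a : Fin p → augIdeal 𝒜}
    (ha : ∀ i, (a i : A) ∈ 𝒜 (t i)) :
    adamsForm 𝒜 p s f a = if ∑ i, t i = s then f a else 0 := by
  have key : ∀ u : Fin p → ℕ, f.compLinearMap (fun i => augProj 𝒜 (u i)) a =
      if t = u then f a else 0 := fun u => by
    rw [MultilinearMap.compLinearMap_apply]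
    split_ifs with h
    · subst h
      congr 1
      funext i
      rw [augProj_of_mem 𝒜 (ha i), if_pos rfl]
    · obtain ⟨i, hi⟩ := Function.ne_iff.1 h
      exact f.map_coord_zero i (by rw [augProj_of_mem 𝒜 (ha i), if_neg (Ne.symm hi)])
  rw [adamsForm, LinearMap.sum_apply, sum_apply]
  change ∑ u ∈ Finset.finAntidiagonal p s, f.compLinearMap (fun i => augProj 𝒜 (u i)) a = _
  rw [Finset.sum_congr rfl fun u _ => key u, Finset.sum_ite_eq]
  simp only [Finset.mem_finAntidiagonal]

lemma adamsForm_mem {p : ℕ} (s : ℕ) (f : BarForm 𝒜 p) : adamsForm 𝒜 p s f ∈ barCochain 𝒜 p :=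
  ⟨s, fun t a ha hs => by rw [adamsForm_apply 𝒜 s f ha, if_neg hs.ne']⟩

/-- The element of `B^# A` given by the part of Adams degree `-s` of a form. -/
def adamsPart (p s : ℕ) : BarForm 𝒜 p →ₗ[k] BarDual 𝒜 :=
  lof 𝒜 p ∘ₗ (adamsForm 𝒜 p s).codRestrict _ (adamsForm_mem 𝒜 s)

lemma adamsPart_apply {p s : ℕ} (f : BarForm 𝒜 p) :
    (adamsPart 𝒜 p s f p : BarForm 𝒜 p) = adamsForm 𝒜 p s f := by
  rw [adamsPart, LinearMap.comp_apply, DirectSum.lof_apply]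
  rfl

lemma adamsPart_apply_ne {p s : ℕ} (f : BarForm 𝒜 p) {q : ℕ} (hq : q ≠ p) :
    adamsPart 𝒜 p s f q = 0 := by
  rw [adamsPart, LinearMap.comp_apply, DirectSum.lof_eq_of, DirectSum.of_eq_of_ne _ _ _ hq]

lemma adamsPart_mem {p s : ℕ} (f : BarForm 𝒜 p) :
    adamsPart 𝒜 p s f ∈ barBigrading 𝒜 p (-s) := by
  intro q t a ha h
  rcases eq_or_ne q p with rfl | hq
  · rw [adamsPart_apply, adamsForm_apply 𝒜 s f ha, if_neg]
    rintro rfl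
    exact h ⟨rfl, rfl⟩
  · rw [adamsPart_apply_ne 𝒜 f hq]
    rfl

/-- An element of bidegree `(p, s)` is determined by its component of cohomological degree `p`, on
tensors of Adams degree `-s`. -/
lemma ext_of_mem {p : ℕ} {s : ℤ} {x y : BarDual 𝒜} (hx : x ∈ barBigrading 𝒜 p s)
    (hy : y ∈ barBigrading 𝒜 p s)
    (h : ∀ (t : Fin p → ℕ) (a : Fin p → augIdeal 𝒜), (∀ i, (a i : A) ∈ 𝒜 (t i)) →
      -((∑ i, t i : ℕ) : ℤ) = s → (x p : BarForm 𝒜 p) a = (y p : BarForm 𝒜 p) a) : x = y := by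
  refine DFinsupp.ext fun q => Subtype.ext (ext_homogeneous 𝒜 fun t a ha => ?_)
  by_cases hq : (q : ℤ) = p ∧ -((∑ i, t i : ℕ) : ℤ) = s
  · obtain rfl : q = p := by exact_mod_cast hq.1
    exact h t a ha hq.2
  · exact (hx q t a ha hq).trans (hy q t a ha hq).symm

lemma adamsPart_of_mem {p s : ℕ} {x : BarDual 𝒜} (hx : x ∈ barBigrading 𝒜 p (-s)) :
    adamsPart 𝒜 p s (x p : BarForm 𝒜 p) = x :=
  ext_of_mem 𝒜 (adamsPart_mem 𝒜 _) hx fun t a ha hs => by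
    rw [adamsPart_apply, adamsForm_apply 𝒜 s _ ha, if_pos (by exact_mod_cast neg_injective hs)]

lemma adamsPart_of_mem_ne {p s q t : ℕ} {x : BarDual 𝒜} (hx : x ∈ barBigrading 𝒜 q (-t))
    (h : (q, t) ≠ (p, s)) : adamsPart 𝒜 p s (x p : BarForm 𝒜 p) = 0 := by
  refine ext_of_mem 𝒜 (adamsPart_mem 𝒜 _) (zero_mem _) fun u a ha hs => ?_
  have hs' : ∑ i, u i = s := by exact_mod_cast neg_injective hs
  rw [adamsPart_apply, adamsForm_apply 𝒜 s _ ha, if_pos hs', hx p u a ha]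
  · rfl
  · rintro ⟨h₁, h₂⟩
    rw [hs'] at h₂
    exact h (Prod.ext (by exact_mod_cast h₁.symm) (by exact_mod_cast (neg_injective h₂).symm))

/-- `B^# A` is the direct sum of its homogeneous parts. -/
lemma isInternal_barBigrading :
    DirectSum.IsInternal fun i : ℕ × ℕ => barBigrading 𝒜 i.1 (-i.2) := by
  constructor
  · intro y z hyz
    have key : ∀ (i : ℕ × ℕ) (y : ⨁ i : ℕ × ℕ, barBigrading 𝒜 i.1 (-i.2)),
        adamsPart 𝒜 i.1 i.2 (DirectSum.coeAddMonoidHom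
          (fun i : ℕ × ℕ => barBigrading 𝒜 i.1 (-i.2)) y i.1 : BarForm 𝒜 i.1) = y i := by
      intro i y
      induction y using DirectSum.induction_on with
      | zero => simp
      | of j x =>
        rw [DirectSum.coeAddMonoidHom_of]
        rcases eq_or_ne j i with rfl | h
        · rw [DirectSum.of_eq_same, adamsPart_of_mem 𝒜 x.2]
        · rw [DirectSum.of_eq_of_ne _ _ _ h.symm, adamsPart_of_mem_ne 𝒜 x.2 h]
          rfl
      | add x y hx hy =>
        rw [map_add, DirectSum.add_apply, Submodule.coe_add, map_add, hx, hy,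
          DirectSum.add_apply, Submodule.coe_add]
    refine DFinsupp.ext fun i => Subtype.ext ?_
    rw [← key i y, ← key i z, hyz]
  · intro x
    suffices h : x ∈ LinearMap.range
        (DirectSum.coeLinearMap fun i : ℕ × ℕ => barBigrading 𝒜 i.1 (-i.2)) from h
    have hof : ∀ (i : ℕ × ℕ), ∀ y ∈ barBigrading 𝒜 i.1 (-i.2), y ∈ LinearMap.range
        (DirectSum.coeLinearMap fun i : ℕ × ℕ => barBigrading 𝒜 i.1 (-i.2)) := fun i y hy =>
      ⟨DirectSum.lof k _ _ i ⟨y, hy⟩, DirectSum.coeLinearMap_lof _ _ _⟩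
    induction x using induction_lof with
    | h0 => exact zero_mem _
    | hadd x y hx hy => exact add_mem hx hy
    | h p f =>
      obtain ⟨N, hN⟩ := f.2
      have e : lof 𝒜 p f = ∑ s ∈ Finset.range (N + 1), adamsPart 𝒜 p s f := by
        simp only [adamsPart, LinearMap.comp_apply]
        rw [← map_sum]
        congr 1
        refine Subtype.ext (ext_homogeneous 𝒜 fun t a ha => ?_)
        rw [AddSubmonoidClass.coe_finsetSum, sum_apply]
        simp only [LinearMap.codRestrict_apply, adamsForm_apply 𝒜 _ _ ha, Finset.sum_ite_eq,
          Finset.mem_range]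
        split_ifs with h
        · rfl
        · exact hN t a ha (by omega)
      rw [e]
      exact sum_mem fun s _ => hof (p, s) _ (adamsPart_mem 𝒜 _)

lemma barBigrading_induction {P : BarDual 𝒜 → Prop} (x : BarDual 𝒜) (h0 : P 0)
    (h : ∀ (p s : ℕ), ∀ x ∈ barBigrading 𝒜 p (-s), P x)
    (hadd : ∀ x y, P x → P y → P (x + y)) : P x := by
  obtain ⟨y, rfl⟩ := (isInternal_barBigrading 𝒜).2 x
  induction y using DirectSum.induction_on with
  | zero => rwa [map_zero]
  | of i x => rw [DirectSum.coeAddMonoidHom_of]; exact h _ _ _ x.2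
  | add x y hx hy => rw [map_add]; exact hadd _ _ hx hy

lemma eq_zero_or_of_mem {p s : ℤ} {x : BarDual 𝒜} (hx : x ∈ barBigrading 𝒜 p s) :
    x = 0 ∨ ∃ p' s' : ℕ, p = p' ∧ s = -s' := by
  by_cases h : ∃ p' s' : ℕ, p = p' ∧ s = -s'
  · exact Or.inr h
  -- no tensor has the bidegree `(p, s)`
  · refine Or.inl (DFinsupp.ext fun q => Subtype.ext (ext_homogeneous 𝒜 fun t a ha => ?_))
    exact hx q t a ha fun e => h ⟨q, ∑ i, t i, e.1.symm, e.2.symm⟩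

end DualBar

/-! ### The first and the second Ext-group -/

namespace DualBar

open ListCalculus TensorAlgebra

variable {k A : Type*} [Field k] [Ring A] [Algebra k A]
  (𝒜 : ℕ → Submodule k A) [GradedAlgebra 𝒜]

lemma extClass_eq_iff {z z' : LinearMap.ker (barD 𝒜)} :
    extClass 𝒜 z = extClass 𝒜 z' ↔ ∃ x, barD 𝒜 x = (z : BarDual 𝒜) - z' := by
  rw [extClass, Submodule.mkQ_apply, Submodule.mkQ_apply, Submodule.Quotient.eq]
  rfl

lemma extClass_surjective : Function.Surjective (extClass 𝒜) := Submodule.mkQ_surjective _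

lemma extClass_mem {p s : ℤ} {z : LinearMap.ker (barD 𝒜)}
    (hz : (z : BarDual 𝒜) ∈ barBigrading 𝒜 p s) : extClass 𝒜 z ∈ extBigrading 𝒜 p s :=
  ⟨z, hz, rfl⟩

lemma barD_one (x : BarDual 𝒜) : (barD 𝒜 x 1 : BarForm 𝒜 1) = 0 := by
  refine ext_one 𝒜 fun n a _ => ?_
  rw [← barEval_single, barEval_barD]
  rfl

variable {𝒜} {θ : ∀ n : ℕ, 𝒜 n →ₗ[k] ⨂[k]^n (𝒜 1)}

/-- A one-cocycle vanishes in Adams degrees `≥ 2`. -/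
lemma IsTensorEmbedding.apply_eq_zero (hθ : IsTensorEmbedding 𝒜 θ) {z : BarDual 𝒜}
    (hz : barD 𝒜 z = 0) {n : ℕ} {a : augIdeal 𝒜} (ha : (a : A) ∈ 𝒜 (n + 2)) :
    (z 1 : BarForm 𝒜 1) (fun _ => a) = 0 := by
  rw [← homotopyTwo_barD 𝒜 hθ z ha, hz, map_zero]
  rfl

variable (𝒜)

/-- The projection of `A` onto `A_1`. -/
def projOne : A →ₗ[k] 𝒜 1 :=
  (GradedAlgebra.proj 𝒜 1).codRestrict _ fun _ => SetLike.coe_mem _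

lemma projOne_coe (v : 𝒜 1) : projOne 𝒜 v = v :=
  Subtype.ext (DirectSum.decompose_of_mem_same 𝒜 v.2)

/-- A linear form on `A_1`, extended by zero to an element of `B^# A` of bidegree `(1, -1)`. -/
def formOne : Module.Dual k (𝒜 1) →ₗ[k] BarDual 𝒜 :=
  adamsPart 𝒜 1 1 ∘ₗ (MultilinearMap.ofSubsingletonₗ k k (augIdeal 𝒜) k (0 : Fin 1)).toLinearMap ∘ₗ
    LinearMap.lcomp k k (projOne 𝒜 ∘ₗ (augIdeal 𝒜).subtype)

lemma formOne_mem (β : Module.Dual k (𝒜 1)) : formOne 𝒜 β ∈ barBigrading 𝒜 1 (-1) :=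
  adamsPart_mem 𝒜 (p := 1) (s := 1) _

lemma formOne_apply (β : Module.Dual k (𝒜 1)) (v : 𝒜 1) :
    (formOne 𝒜 β 1 : BarForm 𝒜 1) (fun _ => inclOne 𝒜 v) = β v := by
  rw [formOne, LinearMap.comp_apply, adamsPart_apply,
    adamsForm_apply 𝒜 1 _ (t := fun _ => 1) fun _ => v.2, if_pos (by simp)]
  exact congrArg β (projOne_coe 𝒜 v)

lemma barD_formOne (β : Module.Dual k (𝒜 1)) : barD 𝒜 (formOne 𝒜 β) = 0 := by
  refine barD_eq_zero_of_mem 𝒜 (formOne_mem 𝒜 β) fun n a ha => ?_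
  refine formOne_mem 𝒜 β 1 (fun _ => n + 2) _ (fun _ => ha) fun h => ?_
  have := h.2
  simp at this
  omega

/-- The cohomology class of a linear form on `A_1`. -/
def classOne : Module.Dual k (𝒜 1) →ₗ[k] ExtAlg 𝒜 :=
  extClass 𝒜 ∘ₗ (formOne 𝒜).codRestrict _ fun β => LinearMap.mem_ker.2 (barD_formOne 𝒜 β)

lemma classOne_mem (β : Module.Dual k (𝒜 1)) : classOne 𝒜 β ∈ extBigrading 𝒜 1 (-1) :=
  extClass_mem 𝒜 (formOne_mem 𝒜 β)

lemma apply_inclOne_of_extClass_eq {β : Module.Dual k (𝒜 1)} {z : LinearMap.ker (barD 𝒜)}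
    (hz : extClass 𝒜 z = classOne 𝒜 β) (v : 𝒜 1) :
    ((z : BarDual 𝒜) 1 : BarForm 𝒜 1) (fun _ => inclOne 𝒜 v) = β v := by
  obtain ⟨x, hx⟩ := (extClass_eq_iff 𝒜).1 hz
  have h := barD_one 𝒜 x
  rw [hx, DirectSum.sub_apply, Submodule.coe_sub, sub_eq_zero] at h
  rw [h]
  exact formOne_apply 𝒜 β v

lemma classOne_injective : Function.Injective (classOne 𝒜) := by
  intro β β' h
  ext v
  obtain ⟨z, hz⟩ := extClass_surjective 𝒜 (classOne 𝒜 β)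
  rw [← apply_inclOne_of_extClass_eq 𝒜 hz, apply_inclOne_of_extClass_eq 𝒜 (hz.trans h)]

/-- A cocycle of cohomological degree one is determined by its restriction to `A_1`. -/
lemma eq_formOne (hθ : IsTensorEmbedding 𝒜 θ) {z : BarDual 𝒜} {s : ℤ}
    (hz : z ∈ barBigrading 𝒜 1 s) (hd : barD 𝒜 z = 0) :
    z = formOne 𝒜 ((MultilinearMap.ofSubsingleton k _ k (0 : Fin 1)).symm
      (z 1 : BarForm 𝒜 1) ∘ₗ inclOne 𝒜) := by
  refine DFinsupp.ext fun p => ?_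
  rcases eq_or_ne p 1 with rfl | hp
  · refine Subtype.ext (ext_one 𝒜 fun n a ha => ?_)
    match n with
    | 0 => rw [eq_zero_of_mem_zero 𝒜 ha, apply_zero_one, apply_zero_one]
    | 1 => exact Eq.trans (by rfl) (formOne_apply 𝒜 _ ⟨a, ha⟩).symm
    | n + 2 =>
      rw [IsTensorEmbedding.apply_eq_zero hθ hd ha,
        IsTensorEmbedding.apply_eq_zero hθ (barD_formOne 𝒜 _) ha]
  · rw [apply_eq_zero_of_mem 𝒜 hz (by exact_mod_cast hp),
      apply_eq_zero_of_mem 𝒜 (formOne_mem 𝒜 _) (by exact_mod_cast hp)]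

lemma range_classOne (hθ : IsTensorEmbedding 𝒜 θ) :
    LinearMap.range (classOne 𝒜) = extDegree 𝒜 1 := by
  refine le_antisymm ?_ (iSup_le fun s => ?_)
  · rintro _ ⟨β, rfl⟩
    exact Submodule.mem_iSup_of_mem (-1) (classOne_mem 𝒜 β)
  · rintro _ ⟨z, hz, rfl⟩
    exact ⟨_, congrArg (extClass 𝒜) (Subtype.ext (eq_formOne 𝒜 hθ hz z.2).symm)⟩

/-- The isomorphism `A_1^# = E^1`. -/
def equivOne (hθ : IsTensorEmbedding 𝒜 θ) : Module.Dual k (𝒜 1) ≃ₗ[k] extDegree 𝒜 1 :=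
  (LinearEquiv.ofInjective (classOne 𝒜) (classOne_injective 𝒜)).trans
    (LinearEquiv.ofEq _ _ (range_classOne 𝒜 hθ))

/-- Restriction of elements of cohomological degree two to a space of relations. -/
def relRestrict (R : ∀ n : ℕ, Submodule k (⨂[k]^n (𝒜 1))) (n : ℕ) :
    BarDual 𝒜 →ₗ[k] Module.Dual k (R (n + 2)) where
  toFun x := restrictTwo 𝒜 n (x 2 : BarForm 𝒜 2) ∘ₗ (R (n + 2)).subtype
  map_add' x y := by
    ext r
    simp [restrictTwo_eq, pullback_add]
  map_smul' c x := by
    ext r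
    simp [restrictTwo_eq, pullback_smul, DirectSum.smul_apply]

variable {R : ∀ n : ℕ, Submodule k (⨂[k]^n (𝒜 1))}

lemma relRestrict_apply {n : ℕ} (x : BarDual 𝒜) (r : R (n + 2)) : relRestrict 𝒜 R n x r =
    pullback 𝒜 (x 2 : BarForm 𝒜 2) (TensorPower.toTensorAlgebra (r : ⨂[k]^(n + 2) (𝒜 1))) :=
  restrictTwo_eq 𝒜 n _ _

/-- The conditions on the embeddings `θ` of `A_n` into `A_1^{⊗ n}` and on the relations `R`. -/
structure Presentation (θ : ∀ n : ℕ, 𝒜 n →ₗ[k] ⨂[k]^n (𝒜 1))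
    (R : ∀ n : ℕ, Submodule k (⨂[k]^n (𝒜 1))) : Prop where
  connected : 𝒜 0 = 1
  embedding : IsTensorEmbedding 𝒜 θ
  minimal : IsMinimalRelations 𝒜 R
  /-- `R_{n+2}` is contained in `A_1 ⊗ A_{n+1}` -/
  mem_genTensor : ∀ n : ℕ, ∀ r ∈ R (n + 2),
    TensorPower.toTensorAlgebra r ∈ genTensor 𝒜 (θ (n + 1))

variable {𝒜}

namespace Presentation

variable (h : Presentation 𝒜 θ R)
include h

omit [GradedAlgebra 𝒜] in
lemma mem_relationIdeal {t : TensorAlgebra k (𝒜 1)} :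
    t ∈ relationIdeal R ↔ tensorToAlg 𝒜 t = 0 := by
  rw [show relationIdeal R = TwoSidedIdeal.ker (tensorToAlg 𝒜) from h.minimal.1,
    TwoSidedIdeal.mem_ker]

omit [GradedAlgebra 𝒜] in
lemma tensorToAlg_relation {n : ℕ} {r : ⨂[k]^(n + 2) (𝒜 1)} (hr : r ∈ R (n + 2)) :
    tensorToAlg 𝒜 (TensorPower.toTensorAlgebra r) = 0 :=
  h.mem_relationIdeal.1 (TwoSidedIdeal.subset_span ⟨n + 2, by omega, r, hr, rfl⟩)

lemma relRestrict_barD (n : ℕ) (x : BarDual 𝒜) : relRestrict 𝒜 R n (barD 𝒜 x) = 0 := by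
  ext r
  rw [relRestrict_apply, pullback_barD 𝒜 x (h.mem_genTensor n r r.2) h.embedding,
    h.tensorToAlg_relation r.2, map_zero, apply_zero_one, neg_zero]
  rfl

lemma relRestrict_of_mem {s : ℤ} {x : BarDual 𝒜} (hx : x ∈ barBigrading 𝒜 2 s) {n : ℕ}
    (hs : s ≠ -((n + 2 : ℕ) : ℤ)) : relRestrict 𝒜 R n x = 0 := by
  ext r
  rw [relRestrict_apply]
  refine genTensor_induction 𝒜 (P := fun t => pullback 𝒜 (x 2 : BarForm 𝒜 2) t = 0)
    (h.mem_genTensor n r r.2) (fun v b hb => ?_) fun s t hs ht => by rw [map_add, hs, ht, add_zero]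
  rw [pullback_ι_mul, tensorToAlg_embed 𝒜 h.embedding]
  refine hx 2 ![1, n + 1] _ (fun i => ?_) fun e => hs ?_
  · fin_cases i
    · exact v.2
    · exact projAug_mem 𝒜 hb
  · rw [← e.2]
    simp
    omega

/-- The restriction of classes of cohomological degree two to the relations. -/
def extRestrict (n : ℕ) : ExtAlg 𝒜 →ₗ[k] Module.Dual k (R (n + 2)) :=
  Submodule.liftQ _ (relRestrict 𝒜 R n ∘ₗ (LinearMap.ker (barD 𝒜)).subtype) (by
    rintro z ⟨x, hx⟩
    rw [LinearMap.mem_ker, LinearMap.comp_apply, ← hx]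
    exact h.relRestrict_barD n x)

/-- A two-cocycle that vanishes on the relations is a coboundary. -/
lemma exists_barD_eq {z : BarDual 𝒜} (hz : ∀ p, p ≠ 2 → z p = 0) (hd : barD 𝒜 z = 0)
    (hr : ∀ n, relRestrict 𝒜 R n z = 0) : ∃ x, barD 𝒜 x = z := by
  have hc := isCocycleTwo_of_barD 𝒜 hd
  have h₁ := fun t => hc.pullback_eq_zero 𝒜 h.connected h.minimal.1 (t := t) (by
    rintro n hn r hrn
    obtain ⟨n, rfl⟩ := Nat.exists_eq_add_of_le' hn
    rw [← relRestrict_apply 𝒜 z ⟨r, hrn⟩, hr]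
    rfl)
  refine ⟨homotopyTwo 𝒜 h.embedding z, ext_barEval 𝒜 fun l => ?_⟩
  by_cases hl : l.length = 2
  · obtain ⟨a, b, rfl⟩ := List.length_eq_two.1 hl
    rw [barEval_pair, barEval_pair, barD_two, homotopyTwo_one, neg_neg, coe_μ,
      hc.eq_pullback_embed 𝒜 h.connected h.embedding h₁]
  · rw [barEval_of_length 𝒜 (x := z) rfl, hz _ hl, barEval_barD, delta_eq_sum]
    refine (Finset.sum_eq_zero fun j hj => ?_).trans (by simp)
    rw [Finset.mem_range] at hj
    have := length_contractList (μ 𝒜) (j := j) (l := l) (by omega)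
    rw [barEval_of_length 𝒜 rfl, homotopyTwo_eq_zero 𝒜 h.embedding z (by omega)]
    simp

/-- Classes in `E^2_{-n}` are determined by their restrictions to `R_n`, since they vanish on
the other relations for degree reasons. -/
lemma extRestrict_injOn (n : ℕ) {x : ExtAlg 𝒜} (hx : x ∈ extBigrading 𝒜 2 (-((n + 2 : ℕ) : ℤ)))
    (h0 : h.extRestrict n x = 0) : x = 0 := by
  obtain ⟨z, hz, rfl⟩ := hx
  obtain ⟨y, hy⟩ := h.exists_barD_eq (z := z)
    (fun p hp => apply_eq_zero_of_mem 𝒜 hz (by exact_mod_cast hp)) z.2 fun m => by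
      by_cases hm : m = n
      · subst hm
        exact h0
      · exact h.relRestrict_of_mem hz (by omega)
  rw [← map_zero (extClass 𝒜), extClass_eq_iff]
  exact ⟨y, by rw [hy]; simp⟩

end Presentation

lemma IsCocycleTwo.of_homogeneous {z : BarForm 𝒜 2}
    (hz : ∀ {s t u : ℕ} {a b c : augIdeal 𝒜}, (a : A) ∈ 𝒜 s → (b : A) ∈ 𝒜 t → (c : A) ∈ 𝒜 u →
      z ![μ 𝒜 a b, c] = z ![a, μ 𝒜 b c]) : IsCocycleTwo 𝒜 z := by
  intro a b c
  simp only [← formTwo_apply] at hz ⊢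
  change formTwo 𝒜 z (augMul 𝒜 a b) c = formTwo 𝒜 z a (augMul 𝒜 b c)
  induction a using augIdeal_induction with
  | h0 => simp
  | hadd a a' h h' => simp only [map_add, LinearMap.add_apply, h, h']
  | h s a ha =>
    induction b using augIdeal_induction with
    | h0 => simp
    | hadd b b' h h' => simp only [map_add, LinearMap.add_apply, h, h']
    | h t b hb =>
      induction c using augIdeal_induction with
      | h0 => simp
      | hadd c c' h h' => simp only [map_add, h, h']
      | h u c hc => exact hz ha hb hc

variable (𝒜 θ) in
/-- The form `[a | b] ↦ φ (a ⊗ b - a b)` for a linear form `φ` on the tensor algebra, into which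
`A` is embedded by `θ`. -/
def associatorForm (φ : TensorAlgebra k (𝒜 1) →ₗ[k] k) : BarForm 𝒜 2 :=
  LinearMap.uncurryLeft (M := fun _ : Fin 2 => augIdeal 𝒜)
    ((MultilinearMap.ofSubsingletonₗ k k (augIdeal 𝒜) k (0 : Fin 1)).toLinearMap ∘ₗ
      (((LinearMap.mul k (TensorAlgebra k (𝒜 1))).compl₁₂ (embed 𝒜 θ ∘ₗ (augIdeal 𝒜).subtype)
        (embed 𝒜 θ ∘ₗ (augIdeal 𝒜).subtype)).compr₂ φ -
      (augMul 𝒜).compr₂ (φ ∘ₗ embed 𝒜 θ ∘ₗ (augIdeal 𝒜).subtype)))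

lemma associatorForm_apply (φ : TensorAlgebra k (𝒜 1) →ₗ[k] k) (a b : augIdeal 𝒜) :
    associatorForm 𝒜 θ φ ![a, b] =
      φ (embed 𝒜 θ a * embed 𝒜 θ b) - φ (embed 𝒜 θ ((a : A) * b)) := rfl

namespace Presentation

variable (h : Presentation 𝒜 θ R)
include h

lemma decomposable_mul {n : ℕ} {a : A} (ha : a ∈ 𝒜 (n + 1)) {x : TensorAlgebra k (𝒜 1)}
    (hx : x ∈ relationIdeal R) : Decomposable (relationIdeal R) (embed 𝒜 θ a * x) ∧
      Decomposable (relationIdeal R) (x * embed 𝒜 θ a) := by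
  refine genTensor_induction 𝒜 (P := fun t => Decomposable (relationIdeal R) (t * x) ∧
      Decomposable (relationIdeal R) (x * t)) (embed_mem_genTensor 𝒜 h.embedding ha)
    (fun v b hb => ⟨?_, ?_⟩) fun s t hs ht => ⟨?_, ?_⟩
  · rw [mul_assoc]
    exact .ι_mul v (TwoSidedIdeal.mul_mem_left _ _ _ hx)
  · rw [← mul_assoc]
    exact (Decomposable.mul_ι v hx).mul_right _
  · rw [add_mul]
    exact .add hs.1 ht.1
  · rw [mul_add]
    exact .add hs.2 ht.2

/-- The associator form is a cocycle if the linear form vanishes on decomposable relations. -/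
lemma associatorForm_cocycle {φ : TensorAlgebra k (𝒜 1) →ₗ[k] k}
    (hφ : ∀ t, Decomposable (relationIdeal R) t → φ t = 0) {s u : ℕ} {a b c : augIdeal 𝒜}
    (ha : (a : A) ∈ 𝒜 s) (hc : (c : A) ∈ 𝒜 u) :
    associatorForm 𝒜 θ φ ![μ 𝒜 a b, c] = associatorForm 𝒜 θ φ ![a, μ 𝒜 b c] := by
  have hI : ∀ a b : A, embed 𝒜 θ a * embed 𝒜 θ b - embed 𝒜 θ (a * b) ∈ relationIdeal R :=
    fun a b => h.mem_relationIdeal.2 (by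
      rw [map_sub, map_mul (tensorToAlg 𝒜), tensorToAlg_embed 𝒜 h.embedding,
        tensorToAlg_embed 𝒜 h.embedding, tensorToAlg_embed 𝒜 h.embedding, sub_self])
  rw [associatorForm_apply, associatorForm_apply, coe_μ, coe_μ]
  match s, u with
  | 0, u => rw [eq_zero_of_mem_zero 𝒜 ha]; simp
  | s, 0 => rw [eq_zero_of_mem_zero 𝒜 hc]; simp
  | s + 1, u + 1 =>
    -- the difference of the two sides is `φ` of `(a b - a ⊗ b) ⊗ c + a ⊗ (b ⊗ c - b c)`
    have h₁ := hφ _ (h.decomposable_mul ha (hI b c)).1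
    have h₂ := hφ _ (h.decomposable_mul hc (hI a b)).2
    rw [mul_sub, map_sub, sub_eq_zero] at h₁
    rw [sub_mul, map_sub, sub_eq_zero] at h₂
    rw [← h₁, ← h₂, mul_assoc, mul_assoc]

/-- Every linear form on `R_n` is the restriction of a cocycle: it is the component of Adams degree
`-n` of an associator form. -/
lemma exists_cocycle (n : ℕ) (ρ : Module.Dual k (R (n + 2))) :
    ∃ z ∈ barBigrading 𝒜 2 (-((n + 2 : ℕ) : ℤ)), barD 𝒜 z = 0 ∧ relRestrict 𝒜 R n z = ρ := by
  obtain ⟨φ, hφρ, hφ⟩ := exists_dual_extension (R := R)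
    (fun S hS hSR => h.minimal.2 S hS (hSR.trans h.minimal.1)) (n := n + 2) (by omega) ρ
  have hdeg : ∀ {a b : augIdeal 𝒜} {s t : ℕ}, (a : A) ∈ 𝒜 s → (b : A) ∈ 𝒜 t →
      adamsForm 𝒜 2 (n + 2) (associatorForm 𝒜 θ φ) ![a, b] =
        if s + t = n + 2 then associatorForm 𝒜 θ φ ![a, b] else 0 := fun {a b s t} ha hb => by
    rw [adamsForm_apply 𝒜 (t := ![s, t]) _ _ (fun i => ?_)]
    · simp
    · fin_cases i
      · exact ha
      · exact hb
  refine ⟨adamsPart 𝒜 2 (n + 2) (associatorForm 𝒜 θ φ), adamsPart_mem 𝒜 _,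
    barD_lof_two 𝒜 (IsCocycleTwo.of_homogeneous fun {s t u a b c} ha hb hc => ?_), ?_⟩
  · have hab : ((μ 𝒜 a b : augIdeal 𝒜) : A) ∈ 𝒜 (s + t) := SetLike.mul_mem_graded ha hb
    have hbc : ((μ 𝒜 b c : augIdeal 𝒜) : A) ∈ 𝒜 (t + u) := SetLike.mul_mem_graded hb hc
    rw [LinearMap.codRestrict_apply, hdeg hab hc, hdeg ha hbc, add_assoc,
      h.associatorForm_cocycle hφ ha hc]
  · ext r
    have hr := h.mem_genTensor n r r.2
    -- on `A_1 ⊗ A_{n+1}` the form is `t ↦ φ t - φ (π t)`, with `π : T(A_1) → A`, and `π r = 0`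
    rw [relRestrict_apply, adamsPart_apply, ← hφρ, ← sub_zero (φ _), ← map_zero φ,
      ← map_zero (embed 𝒜 θ), ← h.tensorToAlg_relation r.2]
    refine genTensor_induction 𝒜 (P := fun t => pullback 𝒜 (adamsForm 𝒜 2 (n + 2)
      (associatorForm 𝒜 θ φ)) t = φ t - φ (embed 𝒜 θ (tensorToAlg 𝒜 t))) hr
      (fun v b hb => ?_) fun s t hs ht => ?_
    · rw [pullback_ι_mul, tensorToAlg_embed 𝒜 h.embedding,
        hdeg (s := 1) (t := n + 1) v.2 (projAug_mem 𝒜 hb), if_pos (by omega), associatorForm_apply,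
        projAug_coe 𝒜 ⟨b, mem_augIdeal_of_mem 𝒜 (Nat.succ_ne_zero n) hb⟩, coe_inclOne,
        embed_one 𝒜 h.connected h.embedding, map_mul (tensorToAlg 𝒜), tensorToAlg_ι,
        tensorToAlg_embed 𝒜 h.embedding]
    · simp only [map_add, hs, ht]
      abel

/-- The isomorphism `R_n^# = E^2_{-n}`. -/
def equivTwo (n : ℕ) :
    Module.Dual k (R (n + 2)) ≃ₗ[k] extBigrading 𝒜 2 (-((n + 2 : ℕ) : ℤ)) :=
  (LinearEquiv.ofBijective (h.extRestrict n ∘ₗ (extBigrading 𝒜 2 _).subtype) (by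
    refine ⟨(injective_iff_map_eq_zero _).2 fun x hx => ?_, fun ρ => ?_⟩
    · exact Subtype.ext (h.extRestrict_injOn n x.2 hx)
    · obtain ⟨z, hz, hd, hρ⟩ := h.exists_cocycle n ρ
      exact ⟨⟨extClass 𝒜 ⟨z, hd⟩, extClass_mem 𝒜 hz⟩, hρ⟩)).symm

lemma extRestrict_equivTwo (n : ℕ) (ρ : Module.Dual k (R (n + 2))) :
    h.extRestrict n (h.equivTwo n ρ) = ρ :=
  (h.equivTwo n).symm_apply_apply ρ

lemma eq_equivTwo {n : ℕ} {x : ExtAlg 𝒜} (hx : x ∈ extBigrading 𝒜 2 (-((n + 2 : ℕ) : ℤ)))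
    {ρ : Module.Dual k (R (n + 2))} (hρ : h.extRestrict n x = ρ) : x = h.equivTwo n ρ := by
  refine sub_eq_zero.1 (h.extRestrict_injOn n (Submodule.sub_mem _ hx (SetLike.coe_mem _)) ?_)
  rw [map_sub, hρ, extRestrict_equivTwo, sub_self]

end Presentation

end DualBar

/-! ### A homotopy for the dual bar construction -/

/-- A generalized inverse `h` of `d` on a subspace `M`, with values in a subspace `K` that has the
same image under `d`. -/
lemma LinearMap.exists_generalizedInverse {k V W : Type*} [Field k] [AddCommGroup V] [Module k V]
    [AddCommGroup W] [Module k W] (d : V →ₗ[k] W) (K M : Submodule k V)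
    (hKM : ∀ x ∈ M, ∃ y ∈ K, d y = d x) :
    ∃ h : W →ₗ[k] V, (∀ x, h x ∈ K) ∧ ∀ x ∈ M, d (h (d x)) = d x := by
  let f : K →ₗ[k] W := d ∘ₗ K.subtype
  obtain ⟨s, hs⟩ := f.rangeRestrict.exists_rightInverse_of_surjective f.range_rangeRestrict
  obtain ⟨s', hs'⟩ := s.exists_extend
  refine ⟨K.subtype ∘ₗ s', fun x => (s' x).2, fun x hx => ?_⟩
  obtain ⟨y, hy, hyx⟩ := hKM x hx
  rw [← hyx]
  have h₁ := LinearMap.congr_fun hs (f.rangeRestrict ⟨y, hy⟩)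
  have h₂ := LinearMap.congr_fun hs' (f.rangeRestrict ⟨y, hy⟩)
  rw [LinearMap.comp_apply] at h₁ h₂
  have h₃ : s' (d y) = s (f.rangeRestrict ⟨y, hy⟩) := h₂
  rw [LinearMap.comp_apply, h₃]
  exact congrArg Subtype.val h₁

namespace DualBar

open ListCalculus TensorAlgebra AInf

variable {k A : Type*} [Field k] [Ring A] [Algebra k A]
  (𝒜 : ℕ → Submodule k A) [GradedAlgebra 𝒜]

lemma barD_of_mem_zero {x : BarDual 𝒜} {s : ℤ} (hx : x ∈ barBigrading 𝒜 0 s) :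
    barD 𝒜 x = 0 := by
  refine ext_barEval 𝒜 fun l => ?_
  rw [barEval_barD, delta_eq_sum, map_zero]
  refine Finset.sum_eq_zero fun j hj => ?_
  rw [Finset.mem_range] at hj
  have := length_contractList (μ 𝒜) (j := j) (l := l) (by omega)
  rw [barEval_of_length 𝒜 rfl, apply_eq_zero_of_mem 𝒜 hx (by omega)]
  simp

/-- A homotopy of degree `-1` on `B^# A` such that `1 - d Q - Q d` is a projection onto a space of
representatives of the cohomology, subject to the side conditions. -/
structure Homotopy where
  /-- the homotopy -/
  Q : BarDual 𝒜 →ₗ[k] BarDual 𝒜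
  Q_mem : ∀ {p s : ℤ} {x}, x ∈ barBigrading 𝒜 p s → Q x ∈ barBigrading 𝒜 (p - 1) s
  Q_Q : ∀ x, Q (Q x) = 0
  d_Q_d : ∀ x, barD 𝒜 (Q (barD 𝒜 x)) = barD 𝒜 x
  Q_d_Q : ∀ x, Q (barD 𝒜 (Q x)) = Q x

variable {𝒜}

/-- A homotopy that satisfies only `d h d = d` can be improved to one with all side conditions. -/
def Homotopy.ofRegular (h : BarDual 𝒜 →ₗ[k] BarDual 𝒜)
    (h_mem : ∀ {p s : ℤ} {x}, x ∈ barBigrading 𝒜 p s → h x ∈ barBigrading 𝒜 (p - 1) s)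
    (d_h_d : ∀ x, barD 𝒜 (h (barD 𝒜 x)) = barD 𝒜 x) : Homotopy 𝒜 where
  Q := (LinearMap.id - barD 𝒜 ∘ₗ h) ∘ₗ h ∘ₗ barD 𝒜 ∘ₗ h
  Q_mem {p s x} hx := by
    have h₁ := h_mem (barD_mem 𝒜 (h_mem hx))
    rw [sub_add_cancel] at h₁
    have h₂ := barD_mem 𝒜 (h_mem h₁)
    rw [sub_add_cancel] at h₂
    exact Submodule.sub_mem _ h₁ h₂
  Q_Q x := by
    simp only [LinearMap.comp_apply, LinearMap.sub_apply, LinearMap.id_apply]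
    rw [map_sub h (h (barD 𝒜 (h x))), map_sub (barD 𝒜), d_h_d, sub_self, map_zero, map_zero,
      map_zero, sub_zero]
  d_Q_d x := by
    simp only [LinearMap.comp_apply, LinearMap.sub_apply, LinearMap.id_apply]
    rw [map_sub, barD_barD, sub_zero, d_h_d, d_h_d]
  Q_d_Q x := by
    simp only [LinearMap.comp_apply, LinearMap.sub_apply, LinearMap.id_apply]
    rw [map_sub (barD 𝒜), barD_barD, sub_zero, d_h_d, d_h_d]

namespace Homotopy

variable (H : Homotopy 𝒜)

/-- The projection `1 - d Q - Q d` onto representatives of the cohomology. -/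
def proj : BarDual 𝒜 →ₗ[k] BarDual 𝒜 :=
  LinearMap.id - barD 𝒜 ∘ₗ H.Q - H.Q ∘ₗ barD 𝒜

lemma proj_apply (x : BarDual 𝒜) : H.proj x = x - barD 𝒜 (H.Q x) - H.Q (barD 𝒜 x) := rfl

lemma barD_proj (x : BarDual 𝒜) : barD 𝒜 (H.proj x) = 0 := by
  rw [proj_apply, map_sub, map_sub, barD_barD, H.d_Q_d, sub_zero, sub_self]

lemma proj_barD (x : BarDual 𝒜) : H.proj (barD 𝒜 x) = 0 := by
  rw [proj_apply, barD_barD, H.d_Q_d, map_zero, sub_zero, sub_self]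

lemma Q_proj (x : BarDual 𝒜) : H.Q (H.proj x) = 0 := by
  rw [proj_apply, map_sub, map_sub, H.Q_d_Q, H.Q_Q, sub_zero, sub_self]

lemma proj_Q (x : BarDual 𝒜) : H.proj (H.Q x) = 0 := by
  rw [proj_apply, H.Q_d_Q, H.Q_Q, map_zero, sub_zero, sub_self]

lemma proj_proj (x : BarDual 𝒜) : H.proj (H.proj x) = H.proj x := by
  rw [proj_apply, Q_proj, barD_proj, map_zero, map_zero, sub_zero, sub_zero]

lemma proj_mem {p s : ℤ} {x : BarDual 𝒜} (hx : x ∈ barBigrading 𝒜 p s) :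
    H.proj x ∈ barBigrading 𝒜 p s := by
  have h₁ := barD_mem 𝒜 (H.Q_mem hx)
  have h₂ := H.Q_mem (barD_mem 𝒜 hx)
  rw [sub_add_cancel] at h₁
  rw [add_sub_cancel_right] at h₂
  exact Submodule.sub_mem _ (Submodule.sub_mem _ hx h₁) h₂

lemma barSign_Q (x : BarDual 𝒜) : barSign 𝒜 (H.Q x) = -H.Q (barSign 𝒜 x) := by
  induction x using barBigrading_induction with
  | h0 => simp
  | hadd x y hx hy => rw [map_add, map_add, hx, hy, map_add, map_add, neg_add]
  | h p s x hx =>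
    rw [barSign_eq 𝒜 hx, barSign_eq 𝒜 (H.Q_mem hx), map_units_smul', Int.negOnePow_sub,
      Int.negOnePow_one]
    simp

/-- The class in the Ext-algebra of the projection of an element to the representatives. -/
def toExt : BarDual 𝒜 →ₗ[k] ExtAlg 𝒜 :=
  extClass 𝒜 ∘ₗ H.proj.codRestrict _ fun x => LinearMap.mem_ker.2 (H.barD_proj x)

/-- The representative of a class. -/
def ofExt : ExtAlg 𝒜 →ₗ[k] BarDual 𝒜 :=
  Submodule.liftQ _ (H.proj ∘ₗ (LinearMap.ker (barD 𝒜)).subtype) (by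
    rintro z ⟨x, hx⟩
    rw [LinearMap.mem_ker, LinearMap.comp_apply, ← hx, proj_barD])

lemma ofExt_extClass (z : LinearMap.ker (barD 𝒜)) : H.ofExt (extClass 𝒜 z) = H.proj z := rfl

lemma ofExt_toExt (x : BarDual 𝒜) : H.ofExt (H.toExt x) = H.proj x := H.proj_proj x

lemma toExt_of_barD_eq_zero {x : BarDual 𝒜} (hx : barD 𝒜 x = 0) :
    H.toExt x = extClass 𝒜 ⟨x, hx⟩ := by
  refine (extClass_eq_iff 𝒜).2 ⟨-H.Q x, ?_⟩
  change _ = H.proj x - x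
  rw [proj_apply, hx, map_zero, map_neg]
  abel

lemma barD_ofExt (v : ExtAlg 𝒜) : barD 𝒜 (H.ofExt v) = 0 := by
  obtain ⟨z, rfl⟩ := extClass_surjective 𝒜 v
  exact H.barD_proj z

lemma Q_ofExt (v : ExtAlg 𝒜) : H.Q (H.ofExt v) = 0 := by
  obtain ⟨z, rfl⟩ := extClass_surjective 𝒜 v
  exact H.Q_proj z

lemma toExt_ofExt (v : ExtAlg 𝒜) : H.toExt (H.ofExt v) = v := by
  obtain ⟨z, rfl⟩ := extClass_surjective 𝒜 v
  rw [← H.toExt_of_barD_eq_zero z.2, ofExt_toExt]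
  exact congrArg (extClass 𝒜) (Subtype.ext (H.proj_proj z))

lemma extClass_ofExt (v : ExtAlg 𝒜) : extClass 𝒜 ⟨H.ofExt v, H.barD_ofExt v⟩ = v := by
  rw [← toExt_of_barD_eq_zero, toExt_ofExt]

lemma toExt_mem {p s : ℤ} {x : BarDual 𝒜} (hx : x ∈ barBigrading 𝒜 p s) :
    H.toExt x ∈ extBigrading 𝒜 p s := extClass_mem 𝒜 (H.proj_mem hx)

lemma ofExt_mem {p s : ℤ} {v : ExtAlg 𝒜} (hv : v ∈ extBigrading 𝒜 p s) :
    H.ofExt v ∈ barBigrading 𝒜 p s := by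
  obtain ⟨z, hz, rfl⟩ := hv
  exact H.proj_mem hz

/-- The contraction of `B^# A` onto its cohomology given by a homotopy. -/
def contraction : Contraction k (BarDual 𝒜) (ExtAlg 𝒜) where
  d := barD 𝒜
  mul := barMul 𝒜
  one := barOne 𝒜
  ε := barSign 𝒜
  εV := H.toExt ∘ₗ barSign 𝒜 ∘ₗ H.ofExt
  i := H.ofExt
  P := H.toExt
  Q := H.Q
  d_d := barD_barD 𝒜
  mul_assoc := barMul_assoc 𝒜
  one_mul := barOne_mul 𝒜
  mul_one := barMul_one 𝒜
  leibniz := barD_barMul 𝒜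
  ε_ε := barSign_barSign 𝒜
  ε_mul := barSign_barMul 𝒜
  ε_d := barSign_barD 𝒜
  ε_Q := H.barSign_Q
  ε_one := barSign_barOne 𝒜
  ε_i v := by
    rw [LinearMap.comp_apply, LinearMap.comp_apply, ofExt_toExt, proj_apply,
      ← neg_eq_iff_eq_neg.2 (H.barSign_Q _), ← neg_eq_iff_eq_neg.2 (barSign_barD 𝒜 _),
      Q_ofExt, barD_ofExt]
    simp
  P_i := H.toExt_ofExt
  i_P := H.ofExt_toExt
  Q_i := H.Q_ofExt
  Q_Q := H.Q_Q
  P_Q x := (congrArg (extClass 𝒜) (Subtype.ext (H.proj_Q x))).trans (map_zero _)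
  d_i := H.barD_ofExt
  P_d x := (congrArg (extClass 𝒜) (Subtype.ext (H.proj_barD x))).trans (map_zero _)

lemma contraction_isBigraded : H.contraction.IsBigraded (barBigrading 𝒜) (extBigrading 𝒜) where
  mul_mem := barMul_mem 𝒜
  Q_mem := H.Q_mem
  i_mem := H.ofExt_mem
  P_mem := H.toExt_mem
  ε_eq := barSign_eq 𝒜
  εV_eq {p s v} hv := by
    change H.toExt (barSign 𝒜 (H.ofExt v)) = _
    rw [barSign_eq 𝒜 (H.ofExt_mem hv), map_units_smul', toExt_ofExt]

lemma extOne_mem : extOne 𝒜 ∈ extBigrading 𝒜 0 0 := extClass_mem 𝒜 (barOne_mem 𝒜)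

lemma ofExt_extOne : H.ofExt (extOne 𝒜) = barOne 𝒜 := by
  have hQ : H.Q (barOne 𝒜) = 0 := by
    rcases eq_zero_or_of_mem 𝒜 (H.Q_mem (barOne_mem 𝒜)) with h | ⟨p, s, hp, -⟩
    · exact h
    · omega
  rw [extOne, ofExt_extClass, proj_apply, hQ, barD_barOne, map_zero, map_zero, sub_zero, sub_zero]

/-- The `A_∞`-Ext-algebra obtained by transfer along a homotopy. -/
def aInfinityExt : AInfinityExt 𝒜 where
  str := Contraction.aInfinityStructure H.contraction_isBigraded extOne_mem H.ofExt_extOne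
  m_one := Contraction.aInfinityStructure_m_one _ _ _
  quasiIso := Contraction.morphismToDG H.contraction_isBigraded extOne_mem H.ofExt_extOne
  lifts_id x :=
    have e := Contraction.morphismToDG_f_one H.contraction_isBigraded extOne_mem
      H.ofExt_extOne x
    ⟨(congrArg (barD 𝒜) e).trans (H.barD_ofExt x),
      (congrArg (extClass 𝒜) (Subtype.ext e)).trans (H.extClass_ofExt x)⟩

end Homotopy

namespace Presentation

variable {θ : ∀ n : ℕ, 𝒜 n →ₗ[k] ⨂[k]^n (𝒜 1)} {R : ∀ n : ℕ, Submodule k (⨂[k]^n (𝒜 1))}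
  (h : Presentation 𝒜 θ R)
include h

/-- Every element of cohomological degree two agrees on the relations with a cocycle, so that its
coboundary is the coboundary of an element that vanishes on the relations. -/
lemma exists_sub_cocycle {s : ℤ} {x : BarDual 𝒜} (hx : x ∈ barBigrading 𝒜 2 s) :
    ∃ y ∈ barBigrading 𝒜 2 s, (∀ n, relRestrict 𝒜 R n y = 0) ∧ barD 𝒜 y = barD 𝒜 x := by
  by_cases hs : ∃ n : ℕ, s = -((n + 2 : ℕ) : ℤ)
  · obtain ⟨n, rfl⟩ := hs
    obtain ⟨z, hz, hd, hr⟩ := h.exists_cocycle n (relRestrict 𝒜 R n x)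
    refine ⟨x - z, Submodule.sub_mem _ hx hz, fun m => ?_, by rw [map_sub, hd, sub_zero]⟩
    by_cases hm : m = n
    · subst hm
      rw [map_sub, hr, sub_self]
    · exact h.relRestrict_of_mem (Submodule.sub_mem _ hx hz) (by omega)
  · exact ⟨x, hx, fun n => h.relRestrict_of_mem hx fun e => hs ⟨n, e⟩, rfl⟩

/-- The components of the homotopy: the explicit one in cohomological degree two, one with values in
the elements that vanish on the relations in degree three, and arbitrary ones elsewhere. -/
lemma exists_component_homotopy (p s : ℕ) : ∃ g : BarDual 𝒜 →ₗ[k] BarDual 𝒜,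
    (∀ x ∈ barBigrading 𝒜 p (-s), g x ∈ barBigrading 𝒜 (p - 1) (-s)) ∧
    (∀ x ∈ barBigrading 𝒜 (p - 1) (-s), barD 𝒜 (g (barD 𝒜 x)) = barD 𝒜 x) ∧
    (p = 2 → g = homotopyTwo 𝒜 h.embedding) ∧
    (p = 3 → ∀ x n, relRestrict 𝒜 R n (g x) = 0) := by
  by_cases h2 : p = 2
  · subst h2
    exact ⟨homotopyTwo 𝒜 h.embedding, fun x hx => homotopyTwo_mem 𝒜 h.embedding hx,
      fun x hx => barD_homotopyTwo_barD 𝒜 h.embedding hx, fun _ => rfl, fun h => by omega⟩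
  by_cases h3 : p = 3
  · subst h3
    obtain ⟨g, hg, hd⟩ := (barD 𝒜).exists_generalizedInverse
      (barBigrading 𝒜 2 (-s) ⊓ ⨅ n, LinearMap.ker (relRestrict 𝒜 R n)) (barBigrading 𝒜 2 (-s))
      fun x hx => by
        obtain ⟨y, hy, hr, hd⟩ := h.exists_sub_cocycle hx
        exact ⟨y, ⟨hy, (Submodule.mem_iInf _).2 hr⟩, hd⟩
    exact ⟨g, fun x _ => (hg x).1, hd, fun h => by omega,
      fun _ x n => (Submodule.mem_iInf _).1 (hg x).2 n⟩
  · obtain ⟨g, hg, hd⟩ := (barD 𝒜).exists_generalizedInverse (barBigrading 𝒜 (p - 1) (-s))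
      (barBigrading 𝒜 (p - 1) (-s)) fun x hx => ⟨x, hx, rfl⟩
    exact ⟨g, fun x _ => hg x, hd, fun h => absurd h h2, fun h => absurd h h3⟩

/-- There is a homotopy that is the explicit one in cohomological degree two and whose values on
elements of cohomological degree three vanish on the relations. -/
lemma exists_homotopy : ∃ H : Homotopy 𝒜,
    (∀ s, ∀ x ∈ barBigrading 𝒜 2 s, H.Q x = homotopyTwo 𝒜 h.embedding x) ∧
    ∀ s, ∀ x ∈ barBigrading 𝒜 3 s, ∀ n, relRestrict 𝒜 R n (H.Q x) = 0 := by
  choose g g_mem d_g_d g_two g_three using h.exists_component_homotopy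
  obtain ⟨f, hf⟩ := (isInternal_barBigrading 𝒜).exists_linearMap
    fun i => g i.1 i.2 ∘ₗ (barBigrading 𝒜 i.1 (-i.2)).subtype
  have hf : ∀ (p s : ℕ), ∀ x ∈ barBigrading 𝒜 p (-s), f x = g p s x :=
    fun p s x hx => hf (p, s) ⟨x, hx⟩
  have f_mem : ∀ {p s : ℤ} {x}, x ∈ barBigrading 𝒜 p s → f x ∈ barBigrading 𝒜 (p - 1) s := by
    intro p s x hx
    rcases eq_zero_or_of_mem 𝒜 hx with rfl | ⟨p, s, rfl, rfl⟩
    · rw [map_zero]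
      exact zero_mem _
    · rw [hf p s x hx]
      exact g_mem p s x hx
  have d_f_d : ∀ x, barD 𝒜 (f (barD 𝒜 x)) = barD 𝒜 x := by
    intro x
    induction x using barBigrading_induction with
    | h0 => simp
    | hadd x y hx hy => simp only [map_add, hx, hy]
    | h p s x hx =>
      rw [hf (p + 1) s _ (by exact_mod_cast barD_mem 𝒜 hx)]
      exact d_g_d (p + 1) s x (by simpa using hx)
  have f_two : ∀ s, ∀ x ∈ barBigrading 𝒜 2 s, f x = homotopyTwo 𝒜 h.embedding x := by
    intro s x hx
    rcases eq_zero_or_of_mem 𝒜 hx with rfl | ⟨p, s, hp, rfl⟩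
    · rw [map_zero, map_zero]
    · rw [hf 2 s x hx, g_two 2 s rfl]
  -- passing to a homotopy with side conditions preserves both properties
  refine ⟨.ofRegular f f_mem d_f_d, fun s x hx => ?_, fun s x hx n => ?_⟩
  · change f (barD 𝒜 (f x)) - barD 𝒜 (f (f (barD 𝒜 (f x)))) = _
    have h₁ := f_mem hx
    have h₂ := barD_mem 𝒜 h₁
    have h₃ : f (barD 𝒜 (f x)) = f x := by
      rw [f_two s _ h₂, f_two s x hx,
        homotopyTwo_barD_homotopyTwo 𝒜 h.connected h.embedding]
    rw [h₃, barD_of_mem_zero 𝒜 (f_mem h₁), sub_zero, f_two s x hx]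
  · change relRestrict 𝒜 R n (f (barD 𝒜 (f x)) - barD 𝒜 (f (f (barD 𝒜 (f x))))) = 0
    rw [map_sub, h.relRestrict_barD, sub_zero]
    have h₁ : barD 𝒜 (f x) ∈ barBigrading 𝒜 3 s := barD_mem 𝒜 (f_mem hx)
    rcases eq_zero_or_of_mem 𝒜 h₁ with h₀ | ⟨p, s, hp, rfl⟩
    · rw [h₀, map_zero, map_zero]
    · rw [hf 3 s _ h₁, g_three 3 s rfl]

end Presentation

end DualBar

/-! ### The multiplications on the first Ext-group -/

namespace DualBar

open ListCalculus TensorAlgebra AInf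

variable {k A : Type*} [Field k] [Ring A] [Algebra k A]
  {𝒜 : ℕ → Submodule k A} [GradedAlgebra 𝒜]

/-- The product of linear forms `β_1, …, β_n`, as a linear form on the tensor algebra. Only its
values on tensors of degree `n` matter. -/
def prodForm {V : Type*} [AddCommGroup V] [Module k V] :
    List (Module.Dual k V) → TensorAlgebra k V →ₗ[k] k
  | [] => algebraMapInv.toLinearMap
  | β :: bs => leftRec (LinearMap.toSpanSingleton k _ (prodForm bs) ∘ₗ β)

lemma prodForm_ι_mul {V : Type*} [AddCommGroup V] [Module k V] (β : Module.Dual k V)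
    (bs : List (Module.Dual k V)) (v : V) (t : TensorAlgebra k V) :
    prodForm (β :: bs) (ι k v * t) = β v * prodForm bs t := by
  rw [prodForm, leftRec_ι_mul]
  rfl

lemma prodForm_ofFn {V : Type*} [AddCommGroup V] [Module k V] {n : ℕ} (β : Fin n → Module.Dual k V)
    (v : Fin n → V) :
    prodForm (List.ofFn β) (List.ofFn fun i => ι k (v i)).prod = ∏ i, β i (v i) := by
  induction n with
  | zero => simp [prodForm]
  | succ n ih =>
    rw [List.ofFn_succ, List.ofFn_succ, List.prod_cons, prodForm_ι_mul, ih, Fin.prod_univ_succ]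

lemma prodForm_toTensorAlgebra {V : Type*} [AddCommGroup V] [Module k V] {n : ℕ}
    (β : Fin n → Module.Dual k V) (r : ⨂[k]^n V) :
    prodForm (List.ofFn β) (TensorPower.toTensorAlgebra r) =
      PiTensorProduct.lift ((MultilinearMap.mkPiAlgebra k (Fin n) k).compLinearMap β) r := by
  refine LinearMap.congr_fun (f := prodForm (List.ofFn β) ∘ₗ TensorPower.toTensorAlgebra)
    (PiTensorProduct.ext ?_) r
  ext v
  simp only [LinearMap.compMultilinearMap_apply, LinearMap.comp_apply,
    TensorPower.toTensorAlgebra_tprod, tprod_apply, PiTensorProduct.lift.tprod, prodForm_ofFn]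
  simp

lemma map_classOne_eq_seq (bs : List (Module.Dual k (𝒜 1))) :
    bs.map (classOne 𝒜) = seq bs.length (fun i => classOne 𝒜 (bs.getD i 0)) := by
  rw [seq]
  refine List.ext_getElem (by simp) fun i h₁ h₂ => ?_
  rw [List.length_map] at h₁
  simp

lemma weight_one (n : ℕ) : (weight n fun _ => 1) = (n * (n - 1) / 2 : ℕ) := by
  rw [← Finset.sum_range_id_mul_two, Nat.mul_div_cancel _ two_pos, ← Finset.sum_range_reflect]
  push_cast
  refine Finset.sum_congr rfl fun l hl => ?_
  have := Finset.mem_range.1 hl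
  rw [Nat.cast_sub (by omega), Nat.cast_sub (by omega)]
  simp

lemma apply_one_eq_zero {p s : ℤ} {x : BarDual 𝒜} (hx : x ∈ barBigrading 𝒜 p s) {n : ℕ}
    {a : augIdeal 𝒜} (ha : (a : A) ∈ 𝒜 n) (hs : (n : ℤ) ≠ -s) :
    (x 1 : BarForm 𝒜 1) (fun _ => a) = 0 := by
  refine hx 1 (fun _ => n) _ (fun _ => ha) fun h => hs ?_
  rw [← h.2]
  simp

namespace Homotopy

variable (H : Homotopy 𝒜)

lemma tau_classOne_mem (bs : List (Module.Dual k (𝒜 1))) :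
    H.contraction.tau (bs.map (classOne 𝒜)) ∈ barBigrading 𝒜 1 (-bs.length) := by
  have h := Contraction.tau_mem H.contraction_isBigraded bs.length (fun _ => 1) (fun _ => -1) _
    fun i => classOne_mem 𝒜 (bs.getD i 0)
  rw [map_classOne_eq_seq]
  simpa using h

lemma defect_classOne_mem (bs : List (Module.Dual k (𝒜 1))) :
    H.contraction.defect (bs.map (classOne 𝒜)) ∈ barBigrading 𝒜 2 (-bs.length) := by
  have h := Contraction.defect_mem_of_tau_mem H.contraction_isBigraded bs.length (fun _ => 1)
    (fun _ => -1) _ (fun i => classOne_mem 𝒜 (bs.getD i 0))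
    fun m _ => Contraction.tau_mem H.contraction_isBigraded m
  rw [map_classOne_eq_seq]
  simpa [add_sub_cancel_left] using h

lemma tau_classOne (β : Module.Dual k (𝒜 1)) :
    H.contraction.tau [classOne 𝒜 β] = formOne 𝒜 β := by
  rw [Contraction.tau_singleton]
  change H.proj (formOne 𝒜 β) = _
  rw [proj_apply, barD_formOne, barD_of_mem_zero 𝒜 (H.Q_mem (formOne_mem 𝒜 β)), map_zero, sub_zero,
    sub_zero]

/-- For degree reasons, on `A_1 ⊗ 𝔪` only the summand of the defect that splits off the first entry
of the list is nonzero. -/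
lemma defect_classOne_apply (β γ : Module.Dual k (𝒜 1)) (bs : List (Module.Dual k (𝒜 1)))
    (v : 𝒜 1) (w : augIdeal 𝒜) :
    (H.contraction.defect ((β :: γ :: bs).map (classOne 𝒜)) 2 : BarForm 𝒜 2) ![inclOne 𝒜 v, w] =
      β v * (H.contraction.tau ((γ :: bs).map (classOne 𝒜)) 1 : BarForm 𝒜 1) (fun _ => w) := by
  have key : ∀ (cs : List (Module.Dual k (𝒜 1))) (y : BarDual 𝒜),
      barEval 𝒜 [inclOne 𝒜 v, w]
        (barMul 𝒜 (barSign 𝒜 (H.contraction.tau (cs.map (classOne 𝒜)))) y) =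
      -((H.contraction.tau (cs.map (classOne 𝒜)) 1 : BarForm 𝒜 1) (fun _ => inclOne 𝒜 v) *
        (y 1 : BarForm 𝒜 1) (fun _ => w)) := fun cs y => by
    have hm := H.tau_classOne_mem cs
    have h₀ : barEval 𝒜 [] (H.contraction.tau (cs.map (classOne 𝒜))) = 0 := by
      rw [barEval_of_length 𝒜 (p := 0) rfl, apply_eq_zero_of_mem 𝒜 hm (by simp)]
      simp
    have h₂ := apply_eq_zero_of_mem 𝒜 hm (q := 2) (by simp)
    rw [barEval_barMul]
    simp only [splitSum, barEval_barSign, LinearMap.mul_apply', barEval_single, barEval_pair, h₂,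
      h₀]
    simp
  rw [← neg_inj, ← barEval_pair]
  refine (map_splitSum (barEval 𝒜 [inclOne 𝒜 v, w]).toAddMonoidHom _ _).trans ?_
  simp only [LinearMap.toAddMonoidHom_coe, List.map_cons, splitSum]
  change barEval 𝒜 [inclOne 𝒜 v, w] (barMul 𝒜 (barSign 𝒜 (H.contraction.tau [])) _) +
    (barEval 𝒜 [inclOne 𝒜 v, w] (barMul 𝒜 (barSign 𝒜 (H.contraction.tau [classOne 𝒜 β])) _) +
      splitSum (fun u v' => barEval 𝒜 [inclOne 𝒜 v, w] (barMul 𝒜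
        (barSign 𝒜 (H.contraction.tau (classOne 𝒜 β :: classOne 𝒜 γ :: u)))
          (H.contraction.tau v'))) (bs.map (classOne 𝒜))) = _
  rw [splitSum_eq_zero fun u v' huv => ?_]
  · have h₁ := key [β] (H.contraction.tau ((γ :: bs).map (classOne 𝒜)))
    rw [List.map_cons, List.map_nil, tau_classOne, formOne_apply] at h₁
    rw [Contraction.tau_nil, map_zero, map_zero, LinearMap.zero_apply, map_zero, zero_add,
      add_zero, tau_classOne]
    exact h₁
  · obtain ⟨cs, ds, -, rfl, -⟩ := List.map_eq_append_iff.1 huv.symm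
    have h₁ := key (β :: γ :: cs) (H.contraction.tau v')
    have h₂ : (H.contraction.tau ((β :: γ :: cs).map (classOne 𝒜)) 1 : BarForm 𝒜 1)
        (fun _ => inclOne 𝒜 v) = 0 :=
      apply_one_eq_zero (H.tau_classOne_mem _) (n := 1) v.2 (by
        rw [List.length_cons, List.length_cons]
        omega)
    rw [h₂, zero_mul, neg_zero] at h₁
    exact h₁

end Homotopy

namespace Presentation

variable {θ : ∀ n : ℕ, 𝒜 n →ₗ[k] ⨂[k]^n (𝒜 1)} {R : ∀ n : ℕ, Submodule k (⨂[k]^n (𝒜 1))}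
  (h : Presentation 𝒜 θ R) {H : Homotopy 𝒜}
include h

/-- If `τ` of the classes of `β_2, …, β_n` is their product on `A_{n-1}`, up to sign, then the
defect of the classes of `β_1, …, β_n` is their product on `A_1 ⊗ A_{n-1}`, up to sign. -/
lemma pullback_defect_of_tau {β γ : Module.Dual k (𝒜 1)} {bs : List (Module.Dual k (𝒜 1))}
    (hτ : ∀ w : augIdeal 𝒜, (w : A) ∈ 𝒜 (bs.length + 1) →
      (H.contraction.tau ((γ :: bs).map (classOne 𝒜)) 1 : BarForm 𝒜 1) (fun _ => w) =
        (-1) ^ bs.length * prodForm (γ :: bs) (embed 𝒜 θ w))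
    {t : TensorAlgebra k (𝒜 1)} (ht : t ∈ genTensor 𝒜 (θ (bs.length + 1))) :
    pullback 𝒜 (H.contraction.defect ((β :: γ :: bs).map (classOne 𝒜)) 2 : BarForm 𝒜 2) t =
      (-1) ^ bs.length * prodForm (β :: γ :: bs) t := by
  refine genTensor_induction 𝒜 (P := fun t => pullback 𝒜 (H.contraction.defect
      ((β :: γ :: bs).map (classOne 𝒜)) 2 : BarForm 𝒜 2) t =
      (-1) ^ bs.length * prodForm (β :: γ :: bs) t) ht (fun v w hw => ?_) fun s t hs ht => ?_
  · have hw' := mem_augIdeal_of_mem 𝒜 (Nat.succ_ne_zero _) hw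
    rw [pullback_ι_mul, tensorToAlg_embed 𝒜 h.embedding, projAug_coe 𝒜 ⟨w, hw'⟩,
      H.defect_classOne_apply, hτ _ hw, prodForm_ι_mul]
    ring
  · rw [map_add, hs, ht, map_add, mul_add]

/-- The components of the morphism on classes of linear forms are, up to sign, products of the
linear forms. -/
lemma tau_classOne_apply
    (hH : ∀ s, ∀ x ∈ barBigrading 𝒜 2 s, H.Q x = homotopyTwo 𝒜 h.embedding x)
    (β : Module.Dual k (𝒜 1)) (bs : List (Module.Dual k (𝒜 1))) {a : augIdeal 𝒜}
    (ha : (a : A) ∈ 𝒜 (bs.length + 1)) :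
    (H.contraction.tau ((β :: bs).map (classOne 𝒜)) 1 : BarForm 𝒜 1) (fun _ => a) =
      (-1) ^ bs.length * prodForm (β :: bs) (embed 𝒜 θ a) := by
  induction bs generalizing β a with
  | nil =>
    rw [List.map_cons, List.map_nil, H.tau_classOne]
    refine (formOne_apply 𝒜 β ⟨a, ha⟩).trans ?_
    rw [embed_one 𝒜 h.connected h.embedding ⟨a, ha⟩, ← mul_one (ι k _), prodForm_ι_mul]
    simp [prodForm]
  | cons γ bs ih =>
    have hτ : H.contraction.tau ((β :: γ :: bs).map (classOne 𝒜)) =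
        homotopyTwo 𝒜 h.embedding (H.contraction.defect ((β :: γ :: bs).map (classOne 𝒜))) := by
      rw [← hH _ _ (H.defect_classOne_mem (β :: γ :: bs))]
      exact H.contraction.tau_cons_cons _ _ _
    rw [hτ, homotopyTwo_one, h.pullback_defect_of_tau (fun w hw => ih γ hw)
      (embed_mem_genTensor 𝒜 h.embedding ha), List.length_cons]
    ring

/-- The transferred operations on classes of linear forms, restricted to the relations. -/
lemma extRestrict_beta
    (hH : ∀ s, ∀ x ∈ barBigrading 𝒜 2 s, H.Q x = homotopyTwo 𝒜 h.embedding x)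
    (hH' : ∀ s, ∀ x ∈ barBigrading 𝒜 3 s, ∀ n, relRestrict 𝒜 R n (H.Q x) = 0)
    {n : ℕ} (β : Fin (n + 2) → Module.Dual k (𝒜 1)) (r : R (n + 2)) :
    h.extRestrict n (H.contraction.beta ((List.ofFn β).map (classOne 𝒜))) r =
      (-1) ^ (n + 1) * prodForm (List.ofFn β)
        (TensorPower.toTensorAlgebra (r : ⨂[k]^(n + 2) (𝒜 1))) := by
  have hD := H.defect_classOne_mem (List.ofFn β)
  rw [Contraction.beta, map_neg]
  change (-relRestrict 𝒜 R n (H.proj _)) r = _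
  rw [Homotopy.proj_apply, map_sub, map_sub, h.relRestrict_barD, hH' _ _ (barD_mem 𝒜 hD), sub_zero,
    sub_zero, LinearMap.neg_apply, relRestrict_apply]
  obtain ⟨β₀, γ, bs, hbs, hlen⟩ : ∃ β₀ γ bs, List.ofFn β = β₀ :: γ :: bs ∧ bs.length = n :=
    ⟨β 0, β 1, List.ofFn fun i => β i.succ.succ, by simp [List.ofFn_succ], List.length_ofFn⟩
  rw [hbs]
  subst hlen
  rw [h.pullback_defect_of_tau (fun w hw => h.tau_classOne_apply hH γ bs hw)
    (h.mem_genTensor _ r r.2)]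
  ring

/-- On classes of linear forms, the operation `m_n` is dual to the inclusion of the relations. -/
lemma aInfinityExt_m
    (hH : ∀ s, ∀ x ∈ barBigrading 𝒜 2 s, H.Q x = homotopyTwo 𝒜 h.embedding x)
    (hH' : ∀ s, ∀ x ∈ barBigrading 𝒜 3 s, ∀ n, relRestrict 𝒜 R n (H.Q x) = 0)
    {n : ℕ} (β : Fin (n + 2) → Module.Dual k (𝒜 1)) :
    H.aInfinityExt.str.m (n + 2) (fun i => classOne 𝒜 (β i)) =
      h.equivTwo n ((R (n + 2)).subtype.dualMap (koszulTensor 𝒜 β)) := by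
  refine h.eq_equivTwo ?_ ?_
  · have hm := H.aInfinityExt.str.m_mem (n + 2) (fun _ => 1) (fun _ => -1) _
      fun i => classOne_mem 𝒜 (β i)
    simpa [add_sub_cancel_left] using hm
  · have hx : (fun i => classOne 𝒜 (β i)) =
        fun i : Fin (n + 2) => classOne 𝒜 ((List.ofFn β).getD i 0) := by
      funext i
      rw [List.getD_eq_getElem _ _ (by simp; omega), List.getElem_ofFn]
    have hd := Contraction.desuspend_apply H.contraction_isBigraded
      H.contraction.isMultilinear_beta (n + 2) (fun _ => 1) (fun _ => -1) _
      fun i => classOne_mem 𝒜 ((List.ofFn β).getD i 0)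
    -- all inputs have degree `1`, so that the desuspension has the sign `(-1)^{n + 1 + n(n-1)/2}`
    have hs := map_classOne_eq_seq (List.ofFn β)
    rw [List.length_ofFn] at hs
    rw [← hs] at hd
    change h.extRestrict n (H.contraction.desuspend H.contraction.isMultilinear_beta (n + 2) _) = _
    rw [hx, hd, map_units_smul', weight_one]
    generalize hm : (n + 2) * (n + 2 - 1) / 2 = m
    rw [show ((n + 2 : ℕ) : ℤ) + 1 + (m : ℕ) = ((n + 2 + 1 + m : ℕ) : ℤ) by push_cast; ring,
      Units.smul_def, ← Int.cast_smul_eq_zsmul k, Int.cast_negOnePow_natCast]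
    ext r
    rw [LinearMap.smul_apply, h.extRestrict_beta hH hH', prodForm_toTensorAlgebra, smul_eq_mul,
      ← mul_assoc, ← pow_add, show n + 2 + 1 + m + (n + 1) = m + 2 * (n + 2) by ring, pow_add,
      pow_mul, neg_one_sq, one_pow, mul_one]
    change _ = koszulTensor 𝒜 β r
    rw [koszulTensor, hm]
    rfl

end Presentation

end DualBar

end

theorem corollaryB {k A : Type*} [Field k] [Ring A] [Nontrivial A] [Algebra k A]
    (𝒜 : ℕ → Submodule k A) [GradedAlgebra 𝒜]
    (h_connected : 𝒜 0 = 1)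
    (h_finite : FiniteDimensional k (𝒜 1))
    (h_gen : Algebra.adjoin k (𝒜 1 : Set A) = ⊤)
    (θ : ∀ n : ℕ, 𝒜 n →ₗ[k] ⨂[k]^n (𝒜 1))
    (hθ : IsTensorEmbedding 𝒜 θ)
    (R : ∀ n : ℕ, Submodule k (⨂[k]^n (𝒜 1)))
    (hR : IsMinimalRelations 𝒜 R)
    (hRθ : ∀ n : ℕ, ∀ r ∈ R (n + 2), TensorPower.toTensorAlgebra r ∈ genTensor 𝒜 (θ (n + 1))) :
    ∃ (e₁ : Module.Dual k (𝒜 1) ≃ₗ[k] extDegree 𝒜 1)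
      (e₂ : ∀ n : ℕ, Module.Dual k (R (n + 2)) ≃ₗ[k] extBigrading 𝒜 2 (-((n + 2 : ℕ) : ℤ))),
      (∀ (β : Module.Dual k (𝒜 1)) (z : LinearMap.ker (barD 𝒜)), extClass 𝒜 z = e₁ β →
        ∀ a : 𝒜 1, ((z : BarDual 𝒜) 1 : BarForm 𝒜 1)
          (fun _ => ⟨a, mem_augIdeal_of_mem 𝒜 one_ne_zero a.2⟩) = β a) ∧
      (∀ (n : ℕ) (ρ : Module.Dual k (R (n + 2))) (z : LinearMap.ker (barD 𝒜)),
        extClass 𝒜 z = e₂ n ρ →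
        ∀ r : R (n + 2), restrictTwo 𝒜 n ((z : BarDual 𝒜) 2 : BarForm 𝒜 2) r = ρ r) ∧
      ∃ E : AInfinityExt 𝒜, ∀ (n : ℕ) (β : Fin (n + 2) → Module.Dual k (𝒜 1)),
        E.str.m (n + 2) (fun i => (e₁ (β i) : ExtAlg 𝒜)) =
          e₂ n ((R (n + 2)).subtype.dualMap (koszulTensor 𝒜 β)) := by
  have h : DualBar.Presentation 𝒜 θ R := ⟨h_connected, hθ, hR, hRθ⟩
  obtain ⟨H, hH, hH'⟩ := h.exists_homotopy
  refine ⟨DualBar.equivOne 𝒜 hθ, h.equivTwo, fun β z hz a => ?_, fun n ρ z hz r => ?_,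
    H.aInfinityExt, fun n β => h.aInfinityExt_m hH hH' β⟩
  · exact DualBar.apply_inclOne_of_extClass_eq 𝒜 hz a
  · rw [← h.extRestrict_equivTwo n ρ, ← hz]
    rfl
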